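/- Let $(V,B)$ be a finite-dimensional complex symplectic vector space with basis $y^1,\dots,y^{2n}$, put $B^{ij}=B(y^i,y^j)$, and let $g$ be a linear automorphism of $V$ of finite order with $B(gu,gv)=B(u,v)$ for all $u,v$. The formal Weyl algebra $W=\mathbb C[[V]]((\hbar))$ (formal power series in $y^1,\dots,y^{2n}$, i.e. the completed symmetric algebra of $V$, with Laurent series in $\hbar$) carries the $\mathbb C((\hbar))$-bilinear product $$(a\circ b)(y,\hbar)=\exp\Big(\frac{\hbar}{2}B^{ij}\frac{\partial}{\partial y^i}\frac{\partial}{\partial z^j}\Big)a(y,\hbar)\,b(z,\hbar)\Big|_{z=y},$$ and $g$ acts on $W$ by the algebra automorphism extending $g:V\to V$. Let $Wg$ be the $W$-bimodule with elements $wg$ ($w\in W$) and actions $a\cdot(wg)\cdot b=(a\circ w\circ g(b))\,g$. Let $C_q(W,Wg)=\mathbb C[[V^{\oplus(q+1)}]]((\hbar))$ be the space of completed Hochschild chains, that is, Laurent series in $\hbar$ (exponents bounded below) whose coefficients are formal power series in $q+1$ collections of coordinates $y_0,\dots,y_q$ (the completed tensor product $Wg\,\widetilde\otimes\,W^{\widetilde\otimes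 q}$), with the Hochschild differential $$b(wg\otimes a_1\otimes\dots\otimes a_q)=(w\circ g(a_1))g\otimes a_2\otimes\dots\otimes a_q+\sum_{i=1}^{q-1}(-1)^i\,wg\otimes\dots\otimes a_i\circ a_{i+1}\otimes\dots\otimes a_q+(-1)^q(a_q\circ w)g\otimes a_1\otimes\dots\otimes a_{q-1},$$ extended to all of $C_q(W,Wg)$ by the same formula as for the product above, and let $HH_q(W,Wg)$ be its homology, a vector space over $\mathbb C((\hbar))$. The normalized complex $\overline C_\bullet(W,Wg)$ is the quotient of $C_\bullet(W,Wg)$ by the chains that are sums of chains with a factor $1$ in one of the slots $1,\dots,q$. Then $V_g=\ker(g-1)$ has even dimension $2m_g$, and $$HH_q(W,Wg)\cong\begin{cases}\mathbb C((\hbar)),& q=2m_g,\\ 0,&\text{otherwise,}\end{cases}$$ as vector spaces over $\mathbb C((\hbar))$. Moreover, let $y^1,\dots,y^{2m_g}$ be any basis of $V_g$, let $(B^g_{ab})$ be the inverse of the matrix $(B(y^a,y^b))_{a,b\le 2m_g}$, let $B^g=\frac12 B^g_{ab}\,y^a\wedge y^b$, and let $\varepsilon_{a_1\dots a_{2m_g}}$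 be the antisymmetric components of the Liouville form $\varepsilon=\wedge^{m_g}B^g=\frac1{(2m_g)!}\varepsilon_{a_1\dots a_{2m_g}}y^{a_1}\wedge\dots\wedge y^{a_{2m_g}}$. Then (summing over repeated indices) $$\psi=\varepsilon_{a_1\dots a_{2m_g}}\,1\otimes y^{a_1}\otimes\dots\otimes y^{a_{2m_g}}$$ is a cycle, and not a boundary, in the normalized Hochschild complex $\overline C_\bullet(W,Wg)$. -/

import Mathlib

noncomputable section

namespace FormalWeyl

/-! ### Laurent series in `ħ` with coefficients in a complex vector space -/

/-- `A((ħ))`: formal Laurent series `∑ k, ħ ^ k a_k`, with exponents bounded below, with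
coefficients in a complex vector space `A`. -/
def Laurent (A : Type*) [AddCommGroup A] : Type _ := HahnSeries ℤ A

namespace Laurent

variable {A A' : Type*} [AddCommGroup A] [AddCommGroup A']

instance : AddCommGroup (Laurent A) := inferInstanceAs (AddCommGroup (HahnSeries ℤ A))

/-- `A((ħ))` is a vector space over `ℂ((ħ))` through
`(∑ r_i ħ ^ i) (∑ a_j ħ ^ j) = ∑ (r_i a_j) ħ ^ (i + j)`. -/
instance [Module ℂ A] : Module (LaurentSeries ℂ) (Laurent A) :=
  inferInstanceAs (Module (HahnSeries ℤ ℂ) (HahnModule ℤ ℂ A))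

/-- The coefficient of `ħ ^ k`. -/
def coeff (a : Laurent A) (k : ℤ) : A := HahnSeries.coeff a k

/-- The Laurent series `a ħ ^ 0`. -/
def const (a : A) : Laurent A := HahnSeries.single (0 : ℤ) a

theorem ext_coeff {a b : Laurent A} (h : ∀ k, a.coeff k = b.coeff k) : a = b :=
  HahnSeries.ext (funext h)

variable [Module ℂ A] [Module ℂ A']

theorem coeff_smul (r : LaurentSeries ℂ) (a : Laurent A) {s : Set ℤ} (hs : s.IsPWO)
    (h : HahnSeries.support (Γ := ℤ) (R := A) a ⊆ s) (k : ℤ) :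
    (r • a).coeff k =
      ∑ x ∈ Finset.VAddAntidiagonal k
        (Set.VAddAntidiagonal.finite_of_isPWO r.isPWO_support hs k),
        r.coeff x.1 • a.coeff x.2 :=
  HahnModule.coeff_smul_right (x := r) (y := HahnModule.of ℂ a) hs h

/-- A `ℂ`-linear map `A → A'` applied to every coefficient. -/
def map (f : A →ₗ[ℂ] A') : Laurent A →ₗ[LaurentSeries ℂ] Laurent A' where
  toFun a := HahnSeries.map (Γ := ℤ) a f
  map_add' a b := ext_coeff fun k => map_add f (a.coeff k) (b.coeff k)
  map_smul' r a := ext_coeff fun k => by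
    have hs := HahnSeries.isPWO_support (Γ := ℤ) (R := A) a
    have e1 := coeff_smul r a hs subset_rfl k
    have e2 := coeff_smul r (HahnSeries.map (Γ := ℤ) a f : Laurent A') hs
      (Function.support_comp_subset (map_zero f) _) k
    refine (congrArg f e1).trans (Eq.trans ?_ e2.symm)
    rw [map_sum]
    exact Finset.sum_congr rfl fun x _ => map_smul f _ _

/-- The series of operators `exp (ħ D) = ∑ r, ħ ^ r / r! • D ^ r`. -/
def expSeries (D : Module.End ℂ A) : HahnSeries ℤ (Module.End ℂ A) :=
  HahnSeries.ofPowerSeries ℤ (Module.End ℂ A)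
    (PowerSeries.mk fun r => (r.factorial : ℂ)⁻¹ • D ^ r)

/-- The operator `exp (ħ D)` on `A((ħ))`, that is
`∑ k, ħ ^ k a_k ↦ ∑ k r, ħ ^ (k + r) / r! • D ^ r a_k`. -/
def expOp (D : Module.End ℂ A) : Laurent A →ₗ[LaurentSeries ℂ] Laurent A where
  toFun a := (HahnModule.of (Module.End ℂ A)).symm
    (expSeries D • HahnModule.of (Module.End ℂ A) (a : HahnSeries ℤ A))
  map_add' a b := smul_add (expSeries D) (HahnModule.of (Module.End ℂ A) (a : HahnSeries ℤ A))
    (HahnModule.of (Module.End ℂ A) (b : HahnSeries ℤ A))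
  map_smul' r a := by
    have key : ∀ x : Laurent A,
        HahnModule.of (Module.End ℂ A) (r • x : Laurent A) =
        r.map (algebraMap ℂ (Module.End ℂ A)) • HahnModule.of (Module.End ℂ A) x := by
      intro x
      ext k
      exact (HahnModule.coeff_smul_left (y := HahnModule.of (Module.End ℂ A) x) r.isPWO_support
        (x := r.map (algebraMap ℂ (Module.End ℂ A)))
        (Function.support_comp_subset (map_zero (algebraMap ℂ (Module.End ℂ A))) _)).symm
    have comm : expSeries D * r.map (algebraMap ℂ (Module.End ℂ A)) =
        r.map (algebraMap ℂ (Module.End ℂ A)) * expSeries D := by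
      ext1
      funext k
      rw [HahnSeries.coeff_mul, HahnSeries.coeff_mul]
      refine Finset.sum_nbij' Prod.swap Prod.swap ?_ ?_ ?_ ?_ ?_
      · intro x hx
        simp only [Finset.mem_antidiagonal, Prod.fst_swap, Prod.snd_swap] at hx ⊢
        exact ⟨hx.2.1, hx.1, by rw [add_comm]; exact hx.2.2⟩
      · intro x hx
        simp only [Finset.mem_antidiagonal, Prod.fst_swap, Prod.snd_swap] at hx ⊢
        exact ⟨hx.2.1, hx.1, by rw [add_comm]; exact hx.2.2⟩
      · intro x _
        rfl
      · intro x _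
        rfl
      · intro x _
        simp only [HahnSeries.map_coeff, Prod.fst_swap, Prod.snd_swap]
        exact (Algebra.commutes _ _).symm
    have h1 : ∀ v : HahnModule ℤ (Module.End ℂ A) A,
        expSeries D • r.map (algebraMap ℂ (Module.End ℂ A)) • v =
          r.map (algebraMap ℂ (Module.End ℂ A)) • expSeries D • v := by
      intro v
      rw [← mul_smul, ← comm, mul_smul]
    exact ((congrArg (fun x => expSeries D • x) (key a)).trans (h1 _)).trans (key _).symm

end Laurent

/-! ### The Moyal contraction -/

variable {V : Type*} [AddCommGroup V] [Module ℂ V] {ι : Type*} [Fintype ι]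

/-- `ℂ[[V^σ]]((ħ))`: Laurent series in `ħ`, with exponents bounded below, whose coefficients are
formal power series in the variables `X (s, i) = y_s^i`, one copy of the coordinates
`(y^i)_{i ∈ ι}` for every slot `s ∈ σ`. This is the completed tensor power `W^{⊗ σ}`. -/
abbrev SlotSeries (σ ι : Type*) : Type _ := Laurent (MvPowerSeries (σ × ι) ℂ)

/-- The constant coefficient bidifferential operator
`½ ∑ i j, B(y^i, y^j) ∂/∂y_s^i ∂/∂y_t^j`. -/
def bidiff (B : V →ₗ[ℂ] V →ₗ[ℂ] ℂ) (y : Module.Basis ι ℂ V) {σ : Type*} (s t : σ) :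
    Module.End ℂ (MvPowerSeries (σ × ι) ℂ) :=
  (1 / 2 : ℂ) • ∑ i, ∑ j, B (y i) (y j) •
    ((MvPowerSeries.pderiv ℂ (s, i)).toLinearMap ∘ₗ (MvPowerSeries.pderiv ℂ (t, j)).toLinearMap)

/-- Rename the slots along `f`, that is `y_s^i ↦ y_{f s}^i`; slots with the same image under `f`
are set equal to each other. -/
def renameSlots (ι : Type*) [Finite ι] {σ τ : Type*} [Finite σ] (f : σ → τ) :
    SlotSeries σ ι →ₗ[LaurentSeries ℂ] SlotSeries τ ι :=
  Laurent.map (MvPowerSeries.rename (R := ℂ) (Prod.map f (id : ι → ι))).toLinearMap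

/-- Apply `exp (ħ/2 B^{ij} ∂/∂y_s^i ∂/∂y_t^j)` and then identify slots along `f`. -/
def contract (B : V →ₗ[ℂ] V →ₗ[ℂ] ℂ) (y : Module.Basis ι ℂ V) {σ τ : Type*} [Finite σ]
    (s t : σ) (f : σ → τ) : SlotSeries σ ι →ₗ[LaurentSeries ℂ] SlotSeries τ ι :=
  renameSlots ι f ∘ₗ Laurent.expOp (bidiff B y s t)

/-! ### The Weyl algebra -/

/-- The underlying space `ℂ[[V]]((ħ))` of the formal Weyl algebra, in the coordinates given by a
basis of `V` indexed by `ι`. -/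
abbrev Weyl (ι : Type*) : Type _ := SlotSeries (Fin 1) ι

/-- `a_0(y_0) a_1(y_1) ⋯`, the decomposable element `a_0 ⊗ a_1 ⊗ ⋯` of the completed tensor
power. The product is the commutative product of Laurent series of power series. -/
def tensor {σ : Type*} [Fintype σ] (a : σ → Weyl ι) : SlotSeries σ ι :=
  let b : σ → HahnSeries ℤ (MvPowerSeries (σ × ι) ℂ) := fun s =>
    renameSlots ι (fun _ : Fin 1 => s) (a s)
  (∏ s, b s : HahnSeries ℤ (MvPowerSeries (σ × ι) ℂ))

/-- The Weyl product
`(a ∘ b)(y) = exp (ħ/2 B^{ij} ∂/∂y^i ∂/∂z^j) a(y) b(z) |_{y = z}`. -/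
def moyalMul (B : V →ₗ[ℂ] V →ₗ[ℂ] ℂ) (y : Module.Basis ι ℂ V) (a b : Weyl ι) : Weyl ι :=
  contract B y (0 : Fin 2) 1 (fun _ => 0) (tensor ![a, b])

/-- The vector `v ∈ V` as a linear form in the variables of the slot `s`. -/
def linearForm (y : Module.Basis ι ℂ V) {σ : Type*} (s : σ) (v : V) :
    MvPowerSeries (σ × ι) ℂ :=
  ∑ j, y.repr v j • MvPowerSeries.X (s, j)

/-- The inclusion `V → W`. -/
def ofVector (y : Module.Basis ι ℂ V) (v : V) : Weyl ι :=
  Laurent.const (linearForm y 0 v)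

/-- The unit of the Weyl algebra. -/
def weylOne (ι : Type*) : Weyl ι := Laurent.const 1

open scoped Classical in
/-- The images of the variables under the action of `g` on the slot `t`: `y_t^i ↦ (g y^i)_t`, and
the variables of all other slots are fixed. -/
def actVar (g : V ≃ₗ[ℂ] V) (y : Module.Basis ι ℂ V) {σ : Type*} (t : σ) (p : σ × ι) :
    MvPowerSeries (σ × ι) ℂ :=
  if p.1 = t then linearForm y t (g (y p.2)) else MvPowerSeries.X p

theorem hasSubst_actVar (g : V ≃ₗ[ℂ] V) (y : Module.Basis ι ℂ V) {σ : Type*} [Finite σ] (t : σ) :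
    MvPowerSeries.HasSubst (actVar g y t) := by
  apply MvPowerSeries.hasSubst_of_constantCoeff_zero
  intro p
  unfold actVar linearForm
  split_ifs <;> simp [MvPowerSeries.smul_eq_C_mul]

/-- The action of `g` on the factor in slot `t`: the automorphism of the (completed) symmetric
algebra induced by `g : V → V`. -/
def act (g : V ≃ₗ[ℂ] V) (y : Module.Basis ι ℂ V) {σ : Type*} [Finite σ] (t : σ) :
    SlotSeries σ ι →ₗ[LaurentSeries ℂ] SlotSeries σ ι :=
  Laurent.map (MvPowerSeries.substAlgHom (R := ℂ) (hasSubst_actVar g y t)).toLinearMap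

/-- The quotient `Z / (N ∩ Z)` of submodules of a module. -/
abbrev Subquotient {R M : Type*} [Ring R] [AddCommGroup M] [Module R M] (Z N : Submodule R M) :
    Type _ :=
  Z ⧸ N.submoduleOf Z

/-! ### The completed Hochschild complex of `W` with values in `Wg` -/

/-- Hochschild chains of degree `q`: the completed tensor product of `Wg` (slot `0`) and of `q`
copies of `W` (slots `1, …, q`). -/
abbrev Chain (ι : Type*) (q : ℕ) : Type _ := SlotSeries (Fin (q + 1)) ι

/-- The Hochschild differential
`b(wg ⊗ a_1 ⊗ ⋯) = w∘g(a_1) g ⊗ a_2 ⊗ ⋯ + ∑_{i ≥ 1} (-1)^i wg ⊗ ⋯ ⊗ a_i∘a_{i+1} ⊗ ⋯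
  + (-1)^{q+1} (a_{q+1}∘w) g ⊗ a_1 ⊗ ⋯ ⊗ a_q`. -/
def differential (B : V →ₗ[ℂ] V →ₗ[ℂ] ℂ) (g : V ≃ₗ[ℂ] V) (y : Module.Basis ι ℂ V) (q : ℕ) :
    Chain ι (q + 1) →ₗ[LaurentSeries ℂ] Chain ι q :=
  contract B y (0 : Fin (q + 2)) 1 (Fin.predAbove 0) ∘ₗ act g y 1
  + ∑ i : Fin q, (-1 : LaurentSeries ℂ) ^ ((i : ℕ) + 1) •
      contract B y i.succ.castSucc i.succ.succ (Fin.predAbove i.succ)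
  + (-1 : LaurentSeries ℂ) ^ (q + 1) •
      contract B y (Fin.last (q + 1)) 0 (Fin.lastCases 0 id)

/-- Hochschild cycles. -/
def cycles (B : V →ₗ[ℂ] V →ₗ[ℂ] ℂ) (g : V ≃ₗ[ℂ] V) (y : Module.Basis ι ℂ V) :
    (q : ℕ) → Submodule (LaurentSeries ℂ) (Chain ι q)
  | 0 => ⊤
  | q + 1 => LinearMap.ker (differential B g y q)

/-- Hochschild boundaries. -/
def boundaries (B : V →ₗ[ℂ] V →ₗ[ℂ] ℂ) (g : V ≃ₗ[ℂ] V) (y : Module.Basis ι ℂ V) (q : ℕ) :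
    Submodule (LaurentSeries ℂ) (Chain ι q) :=
  LinearMap.range (differential B g y q)

/-- Hochschild homology `HH_q(W, Wg)`, the space of cycles modulo boundaries. -/
def HH (B : V →ₗ[ℂ] V →ₗ[ℂ] ℂ) (g : V ≃ₗ[ℂ] V) (y : Module.Basis ι ℂ V) (q : ℕ) : Type _ :=
  Subquotient (cycles B g y q) (boundaries B g y q)

instance (B : V →ₗ[ℂ] V →ₗ[ℂ] ℂ) (g : V ≃ₗ[ℂ] V) (y : Module.Basis ι ℂ V) (q : ℕ) :
    AddCommGroup (HH B g y q) :=
  inferInstanceAs (AddCommGroup (Subquotient (cycles B g y q) (boundaries B g y q)))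

instance (B : V →ₗ[ℂ] V →ₗ[ℂ] ℂ) (g : V ≃ₗ[ℂ] V) (y : Module.Basis ι ℂ V) (q : ℕ) :
    Module (LaurentSeries ℂ) (HH B g y q) :=
  inferInstanceAs (Module (LaurentSeries ℂ)
    (Subquotient (cycles B g y q) (boundaries B g y q)))

/-! ### The normalized complex -/

/-- Degenerate chains: sums of chains which have the factor `1` in one of the slots `1, …, q`. -/
def degenerate (ι : Type*) [Finite ι] : (q : ℕ) → Submodule (LaurentSeries ℂ) (Chain ι q)
  | 0 => ⊥
  | q + 1 => ⨆ j : Fin (q + 1), LinearMap.range (renameSlots ι (Fin.succAbove j.succ))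

/-- Normalized chains: the completed tensor product of `Wg` and of `q` copies of
`W / ℂ((ħ)) 1`. -/
abbrev NormalizedChain (ι : Type*) [Finite ι] (q : ℕ) : Type _ := Chain ι q ⧸ degenerate ι q

/-- The cycles of the normalized complex: classes of chains with a degenerate differential. -/
def normalizedCycles (B : V →ₗ[ℂ] V →ₗ[ℂ] ℂ) (g : V ≃ₗ[ℂ] V) (y : Module.Basis ι ℂ V) :
    (q : ℕ) → Submodule (LaurentSeries ℂ) (NormalizedChain ι q)
  | 0 => ⊤
  | q + 1 => ((degenerate ι q).comap (differential B g y q)).map (degenerate ι (q + 1)).mkQ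

/-- The boundaries of the normalized complex. -/
def normalizedBoundaries (B : V →ₗ[ℂ] V →ₗ[ℂ] ℂ) (g : V ≃ₗ[ℂ] V) (y : Module.Basis ι ℂ V)
    (q : ℕ) : Submodule (LaurentSeries ℂ) (NormalizedChain ι q) :=
  (boundaries B g y q).map (degenerate ι q).mkQ

/-! ### The fixed subspace and the Liouville chain -/

/-- `V_g = Ker (g - 1)`. -/
def fixedSubspace (g : V ≃ₗ[ℂ] V) : Submodule ℂ V :=
  LinearMap.ker ((g : V →ₗ[ℂ] V) - LinearMap.id)

/-- The bivector `½ ∑ a b, B_{ab} y^a ∧ y^b` dual to the form `B` on a space with basis `y`, where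
`(B_{ab})` is the inverse of the matrix `B^{ab} = B(y^a, y^b)`. -/
def dualForm {U : Type*} [AddCommGroup U] [Module ℂ U] {κ : Type*} [Fintype κ] [DecidableEq κ]
    (B : U →ₗ[ℂ] U →ₗ[ℂ] ℂ) (y : Module.Basis κ ℂ U) : ExteriorAlgebra ℂ U :=
  (1 / 2 : ℂ) • ∑ a, ∑ b, (Matrix.of fun a b => B (y a) (y b))⁻¹ a b •
    (ExteriorAlgebra.ι ℂ (y a) * ExteriorAlgebra.ι ℂ (y b))

/-- The components `ε_{a_1 … a_k}` of (the degree `k` part of) an element of the exterior algebra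
in a basis `y`, normalized so that the degree `k` part is
`1/k! ∑ ε_{a_1 … a_k} y^{a_1} ∧ ⋯ ∧ y^{a_k}`: the linear functional with
`u_1 ∧ ⋯ ∧ u_k ↦ det (y^*_{a_r} (u_s))`, which vanishes in all other degrees. -/
def component {U : Type*} [AddCommGroup U] [Module ℂ U] {κ : Type*}
    (y : Module.Basis κ ℂ U) {k : ℕ} (a : Fin k → κ) : ExteriorAlgebra ℂ U →ₗ[ℂ] ℂ :=
  ExteriorAlgebra.liftAlternating (Pi.single (M := fun i => U [⋀^Fin i]→ₗ[ℂ] ℂ) k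
    (Matrix.detRowAlternating.compLinearMap (LinearMap.pi fun r => y.coord (a r))))

/-- The chain `ψ = ε_{a_1 … a_{2m}} 1 ⊗ y^{a_1} ⊗ ⋯ ⊗ y^{a_{2m}}`, where `ε` is the `m`-th
exterior power of the dual form on `V_g` and `c = (y^1, …, y^{2m})` is a basis of `V_g`. -/
def liouvilleChain (B : V →ₗ[ℂ] V →ₗ[ℂ] ℂ) (g : V ≃ₗ[ℂ] V) (y : Module.Basis ι ℂ V) {m : ℕ}
    (c : Module.Basis (Fin (2 * m)) ℂ (fixedSubspace g)) : Chain ι (2 * m) :=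
  ∑ a : Fin (2 * m) → Fin (2 * m), (HahnSeries.C : ℂ →+* LaurentSeries ℂ)
    (component c a (dualForm (B.domRestrict₁₂ (fixedSubspace g) (fixedSubspace g)) c ^ m)) •
      tensor (Fin.cons (weylOne ι) fun r => ofVector y (c (a r) : V))

end FormalWeyl

end

/-!
All maps of the Hochschild complex are *Gaussian operators* `f ↦ (exp (ħ Q(∂, ∂)) f) ∘ L` for a
linear map `L` and a bilinear form `Q` (`gauss`). On formal exponentials of linear forms such an
operator is `exp v ↦ exp (ħ Q(v, v)) exp (L v)`, so that an identity between them is an identity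
between linear maps and quadratic forms (`gauss_gauss_eq`, `gauss_heis`).

In `W` the exponentials form a Heisenberg group up to scalars, and a Hochschild chain
`w g ⊗ a_1 ⊗ ⋯ ⊗ a_q` of exponentials can, up to a scalar, be written in homogeneous
coordinates: `a_i = e^{-u_{i-1}} ∘ e^{u_i}`, while `w` is determined by `u_0`, `u_q` and one vector
`x` for the twisted conjugacy class of the product of all factors. This gives a surjection
`toChain` to the Hochschild complex from a *homogeneous complex* of power series in `u_0`, …,
`u_q` and `x`, whose differential just omits the `u_i`, and which therefore is a resolution of the
series in `x` (`Frame.isConcentrated_bot`). The simultaneous translation of all `u_i` leaves the Hochschild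
chain unchanged up to a translation of `x` and a phase; infinitesimally this says that the kernel of
`toChain` is the sum of the images of commuting operators `Z_a`, one for each vector `e_a` of a
basis adapted to the decomposition of `V` into `V_g` and its orthogonal complement
(`Frame.straight_Z`, `Frame.toChain_eq_zero_iff`). They form a regular sequence.

On the homology of the homogeneous complex, `Z_a` acts as multiplication by the variable `x^a` if
`e_a` is in the complement of `V_g`, and as `ħ ∂/∂x^a` if `e_a` is in `V_g`. Dividing out the images
of the `Z_a` one after the other, the first kind replaces the homology by a cokernel in the same
degree, the second kind by a kernel in the next degree (`IsConcentrated.step_injective`,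
`IsConcentrated.step_surjective`). What remains are the constants, in degree `dim V_g`
(`Frame.exists_isConcentrated`).

The Liouville chain is a multiple of `det (y_i^{c_j})`, with rows the slots `i = 1, …, 2m` and
columns a basis `c` of `V_g` (`liouvilleChain_eq`). The factor is not zero, since the powers of the
nondegenerate bivector do not vanish (`bivector_pow_ne_zero`). Up to degenerate chains, this
determinant is the image of the homogeneous chain `det (u_i^{c_j})`
(`Frame.toChain_detChain_sub_mem_vanish`), whose differential is the alternating sum of the images
under the `Z_{c_j}` of the determinants in which the column `j` is omitted (`Frame.diff_detChain`),
so it is mapped to a cycle. The lifts of degenerate chains form a subcomplex, modulo which the `Z_a`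
are still regular (`Frame.diff_mem_rel_full`, `Frame.rel_regular`). Hence a chain that bounds the
determinant modulo the images of the `Z_a` and degenerate chains leads to one for a determinant of
one size less, and finally to a contradiction in degree `0` (`Frame.detChain_sub_diff_notMem`).
-/

noncomputable section

set_option linter.unusedSectionVars false

namespace FormalWeyl

/-! ### Operators on Laurent series -/

namespace Laurent

variable {A A' A'' : Type*} [AddCommGroup A] [AddCommGroup A'] [AddCommGroup A'']

@[simp] theorem coeff_add (a b : Laurent A) (k : ℤ) : (a + b).coeff k = a.coeff k + b.coeff k := rfl

@[simp] theorem coeff_sub (a b : Laurent A) (k : ℤ) : (a - b).coeff k = a.coeff k - b.coeff k := rfl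

@[simp] theorem coeff_zero (k : ℤ) : (0 : Laurent A).coeff k = 0 := rfl

theorem coeff_const (a : A) (k : ℤ) : (const a).coeff k = if k = 0 then a else 0 := by
  split_ifs with h
  · rw [h]
    exact HahnSeries.coeff_single_same 0 a
  · exact HahnSeries.coeff_single_of_ne h

theorem exists_coeff_eq_zero (a : Laurent A) : ∃ k₀ : ℤ, ∀ k < k₀, a.coeff k = 0 := by
  obtain h | h := (HahnSeries.support (Γ := ℤ) (R := A) a).eq_empty_or_nonempty
  · refine ⟨0, fun k _ => ?_⟩
    by_contra hk
    have : k ∈ HahnSeries.support (Γ := ℤ) (R := A) a := hk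
    rw [h] at this
    exact this
  · have hp : (HahnSeries.support (Γ := ℤ) (R := A) a).IsWF :=
      HahnSeries.isWF_support (Γ := ℤ) (R := A) a
    refine ⟨hp.min h, fun k hk => ?_⟩
    by_contra hk'
    exact hp.not_lt_min h hk' hk

/-- The series `exp (ħ D) a` has finite sums as coefficients; `N` bounds their length. -/
theorem exists_bound (a : Laurent A) (k : ℤ) :
    ∃ N : ℕ, ∀ r : ℕ, N ≤ r → a.coeff (k - r) = 0 := by
  obtain ⟨k₀, hk⟩ := exists_coeff_eq_zero a
  exact ⟨(k - k₀ + 1).toNat, fun r hr => hk _ (by omega)⟩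

variable [Module ℂ A] [Module ℂ A'] [Module ℂ A'']

@[simp] theorem coeff_map (f : A →ₗ[ℂ] A') (a : Laurent A) (k : ℤ) :
    (map f a).coeff k = f (a.coeff k) := rfl

theorem coeff_single_smul (i : ℤ) (r : ℂ) (a : Laurent A) (k : ℤ) :
    ((HahnSeries.single i r : LaurentSeries ℂ) • a).coeff k = r • a.coeff (k - i) := by
  have h := HahnModule.coeff_single_smul_vadd (r := r)
    (x := HahnModule.of ℂ (a : HahnSeries ℤ A)) (a := k - i) (b := i)
  rw [vadd_eq_add, add_sub_cancel] at h
  exact h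

theorem coeff_C_smul (r : ℂ) (a : Laurent A) (k : ℤ) :
    ((HahnSeries.C : ℂ →+* LaurentSeries ℂ) r • a).coeff k = r • a.coeff k := by
  have h := coeff_single_smul 0 r a k
  rw [sub_zero] at h
  exact h

/-- The formal variable `ħ`. -/
def hbar : LaurentSeries ℂ := HahnSeries.single 1 1

theorem hbar_ne_zero : hbar ≠ 0 := HahnSeries.single_ne_zero one_ne_zero

@[simp] theorem coeff_hbar_smul (a : Laurent A) (k : ℤ) : (hbar • a).coeff k = a.coeff (k - 1) := by
  unfold hbar
  rw [coeff_single_smul, one_smul]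

theorem coeff_expSeries (D : Module.End ℂ A) (k : ℕ) :
    (expSeries D).coeff (k : ℤ) = (k.factorial : ℂ)⁻¹ • D ^ k := by
  unfold expSeries
  have h := HahnSeries.ofPowerSeries_apply_coeff (Γ := ℤ) (R := Module.End ℂ A)
    (PowerSeries.mk fun r => (r.factorial : ℂ)⁻¹ • D ^ r) k
  rw [PowerSeries.coeff_mk] at h
  exact h

theorem coeff_expSeries_of_neg (D : Module.End ℂ A) {k : ℤ} (hk : k < 0) :
    (expSeries D).coeff k = 0 := by
  unfold expSeries
  rw [HahnSeries.ofPowerSeries_apply]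
  apply HahnSeries.embDomain_of_notMem_range
  rintro ⟨n, hn⟩
  have : ((n : ℕ) : ℤ) = k := hn
  omega

/-- The coefficients of `exp (ħ D) a`: a finite sum, as the exponents of `a` are bounded below. -/
theorem coeff_expOp (D : Module.End ℂ A) (a : Laurent A) (k : ℤ) (N : ℕ)
    (hN : ∀ r : ℕ, N ≤ r → a.coeff (k - r) = 0) :
    (expOp D a).coeff k =
      ∑ r ∈ Finset.range N, (r.factorial : ℂ)⁻¹ • (D ^ r) (a.coeff (k - r)) := by
  have h : (expOp D a).coeff k = _ :=
    HahnModule.coeff_smul (expSeries D) (HahnModule.of (Module.End ℂ A) (a : HahnSeries ℤ A)) k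
  rw [h]
  refine Finset.sum_of_injOn (fun ij => ij.1.toNat) ?_ ?_ ?_ ?_
  · intro x hx y hy hxy
    simp only [Finset.mem_coe, Finset.mem_vaddAntidiagonal, vadd_eq_add] at hx hy
    have hx0 : 0 ≤ x.1 := by
      by_contra hlt
      exact hx.1 (coeff_expSeries_of_neg D (not_le.mp hlt))
    have hy0 : 0 ≤ y.1 := by
      by_contra hlt
      exact hy.1 (coeff_expSeries_of_neg D (not_le.mp hlt))
    have hx2 := hx.2.2
    have hy2 := hy.2.2
    dsimp only at hxy
    exact Prod.ext (by omega) (by omega)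
  · intro x hx
    simp only [Finset.mem_coe, Finset.mem_vaddAntidiagonal, vadd_eq_add] at hx
    have hx0 : 0 ≤ x.1 := by
      by_contra hlt
      exact hx.1 (coeff_expSeries_of_neg D (not_le.mp hlt))
    simp only [Finset.coe_range, Set.mem_Iio]
    by_contra hlt
    refine hx.2.1 ?_
    have := hN x.1.toNat (not_lt.mp hlt)
    rwa [show k - ((x.1.toNat : ℕ) : ℤ) = x.2 by have := hx.2.2; omega] at this
  · intro r _ hr
    by_cases h0 : a.coeff (k - r) = 0
    · rw [h0, map_zero, smul_zero]
    by_cases h1 : (expSeries D).coeff (r : ℤ) = 0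
    · rw [coeff_expSeries] at h1
      exact LinearMap.congr_fun h1 _
    · refine absurd ⟨((r : ℤ), k - r), ?_, by simp⟩ hr
      simp only [Finset.mem_coe, Finset.mem_vaddAntidiagonal, vadd_eq_add]
      exact ⟨h1, h0, by omega⟩
  · intro x hx
    simp only [Finset.mem_vaddAntidiagonal, vadd_eq_add] at hx
    have hx0 : 0 ≤ x.1 := by
      by_contra hlt
      exact hx.1 (coeff_expSeries_of_neg D (not_le.mp hlt))
    have e1 : ((x.1.toNat : ℕ) : ℤ) = x.1 := Int.toNat_of_nonneg hx0
    have e2 : k - ((x.1.toNat : ℕ) : ℤ) = x.2 := by have := hx.2.2; omega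
    rw [e2]
    conv_lhs => rw [← e1, coeff_expSeries]
    rfl

theorem expOp_zero (a : Laurent A) : expOp (0 : Module.End ℂ A) a = a := by
  refine ext_coeff fun k => ?_
  obtain ⟨N, hN⟩ := exists_bound a k
  rw [coeff_expOp 0 a k (N + 1) fun r hr => hN r (by omega), Finset.sum_range_succ',
    Finset.sum_eq_zero fun r _ => by simp [pow_succ]]
  simp

theorem expSeries_mul {D D' : Module.End ℂ A} (h : Commute D D') :
    expSeries D * expSeries D' = expSeries (D + D') := by
  unfold expSeries
  rw [← map_mul]
  congr 1
  ext n
  rw [PowerSeries.coeff_mul, PowerSeries.coeff_mk, h.add_pow', Finset.smul_sum]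
  refine congrArg (fun f : Module.End ℂ A => f _) (Finset.sum_congr rfl fun p hp => ?_)
  rw [PowerSeries.coeff_mk, PowerSeries.coeff_mk, smul_mul_smul_comm, ← Nat.cast_smul_eq_nsmul ℂ,
    smul_smul]
  congr 1
  rw [Finset.HasAntidiagonal.mem_antidiagonal] at hp
  have h1 := Nat.add_choose_mul_factorial_mul_factorial p.2 p.1
  rw [add_comm, hp] at h1
  have h2 : ((n.choose p.1 : ℕ) : ℂ) * (p.2.factorial : ℂ) * (p.1.factorial : ℂ) =
      (n.factorial : ℂ) := by exact_mod_cast h1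
  have h3 : (n.factorial : ℂ) ≠ 0 := by exact_mod_cast n.factorial_ne_zero
  have h4 : (p.1.factorial : ℂ) ≠ 0 := by exact_mod_cast p.1.factorial_ne_zero
  have h5 : (p.2.factorial : ℂ) ≠ 0 := by exact_mod_cast p.2.factorial_ne_zero
  field_simp
  rw [← h2]
  ring

theorem expOp_expOp {D D' : Module.End ℂ A} (h : Commute D D') (a : Laurent A) :
    expOp D (expOp D' a) = expOp (D + D') a := by
  have h1 := mul_smul (expSeries D) (expSeries D')
    (HahnModule.of (Module.End ℂ A) (a : HahnSeries ℤ A))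
  rw [expSeries_mul h] at h1
  exact h1.symm

theorem map_map (f : A' →ₗ[ℂ] A'') (f' : A →ₗ[ℂ] A') (a : Laurent A) :
    map f (map f' a) = map (f ∘ₗ f') a := rfl

theorem map_const (f : A →ₗ[ℂ] A') (a : A) : map f (const a) = const (f a) :=
  ext_coeff fun k => by
    rw [coeff_map, coeff_const, coeff_const]
    split_ifs <;> simp

theorem map_expOp {f : A →ₗ[ℂ] A'} {D : Module.End ℂ A} {D' : Module.End ℂ A'}
    (h : f ∘ₗ D = D' ∘ₗ f) (a : Laurent A) : map f (expOp D a) = expOp D' (map f a) := by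
  refine ext_coeff fun k => ?_
  obtain ⟨N, hN⟩ := exists_bound a k
  rw [coeff_map, coeff_expOp D a k N hN,
    coeff_expOp D' (map f a) k N fun r hr => by rw [coeff_map, hN r hr, map_zero], map_sum]
  refine Finset.sum_congr rfl fun r _ => ?_
  rw [map_smul, coeff_map]
  congr 1
  have hpow : f ∘ₗ (D ^ r) = (D' ^ r) ∘ₗ f := by
    clear * - h
    induction r with
    | zero => rfl
    | succ r ih =>
      rw [pow_succ, pow_succ, Module.End.mul_eq_comp, Module.End.mul_eq_comp,
        ← LinearMap.comp_assoc, ih, LinearMap.comp_assoc, h, LinearMap.comp_assoc]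
  exact LinearMap.congr_fun hpow _

/-- If the commutator `c = [D, m]` commutes with `D`, then `exp (ħ D) m = (m + ħ c) exp (ħ D)`. -/
theorem expOp_map_of_commutator {D m c : Module.End ℂ A} (h : D * m = m * D + c)
    (hc : Commute D c) (a : Laurent A) :
    expOp D (map m a) = map m (expOp D a) + hbar • map c (expOp D a) := by
  have hpow : ∀ r : ℕ, D ^ (r + 1) * m = m * D ^ (r + 1) + ((r + 1 : ℕ) : ℂ) • (c * D ^ r) := by
    intro r
    induction r with
    | zero => simp [h]
    | succ r ih =>
      rw [pow_succ', mul_assoc, ih, mul_add, ← mul_assoc, h, mul_smul_comm, ← mul_assoc D c,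
        hc.eq, add_mul, mul_assoc, mul_assoc c D, ← pow_succ', ← pow_succ', add_assoc]
      congr 1
      push_cast
      module
  refine ext_coeff fun k => ?_
  obtain ⟨N, hN⟩ := exists_bound a k
  rw [coeff_add, coeff_hbar_smul, coeff_map, coeff_map,
    coeff_expOp D (map m a) k (N + 1) fun r hr => by rw [coeff_map, hN r (by omega), map_zero],
    coeff_expOp D a k (N + 1) fun r hr => hN r (by omega),
    coeff_expOp D a (k - 1) N fun r hr => by
      rw [show k - 1 - (r : ℤ) = k - ((r + 1 : ℕ) : ℤ) by push_cast; ring]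
      exact hN _ (by omega),
    Finset.sum_range_succ', Finset.sum_range_succ', map_add, map_sum, map_sum,
    add_right_comm, ← Finset.sum_add_distrib]
  congr 1
  · refine Finset.sum_congr rfl fun r _ => ?_
    have h1 := LinearMap.congr_fun (hpow r) (a.coeff (k - ((r + 1 : ℕ) : ℤ)))
    rw [Module.End.mul_apply] at h1
    rw [coeff_map, h1, map_smul, map_smul,
      show k - 1 - (r : ℤ) = k - ((r + 1 : ℕ) : ℤ) by push_cast; ring]
    simp only [LinearMap.add_apply, LinearMap.smul_apply, Module.End.mul_apply, smul_add, smul_smul]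
    congr 2
    rw [Nat.factorial_succ]
    have h5 : (r.factorial : ℂ) ≠ 0 := by exact_mod_cast r.factorial_ne_zero
    have h6 : ((r + 1 : ℕ) : ℂ) ≠ 0 := by exact_mod_cast r.succ_ne_zero
    push_cast at h6 ⊢
    field_simp
  · simp

end Laurent

/-! ### Linear substitutions and constant coefficient operators on power series -/

section Subst

open MvPowerSeries
open scoped MvPowerSeries.WithPiTopology

variable {R : Type*} [CommRing R] {α β : Type*}

theorem continuous_pderiv [TopologicalSpace R] [ContinuousMul R] (i : α) :
    Continuous (pderiv R i : MvPowerSeries α R → MvPowerSeries α R) := by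
  refine continuous_pi fun n => ?_
  have : (fun f : MvPowerSeries α R => (pderiv R i f : (α →₀ ℕ) → R) n) =
      fun f => coeff (n + Finsupp.single i 1) f * ((n i : R) + 1) := by
    funext f
    exact coeff_pderiv f n
  rw [this]
  exact (WithPiTopology.continuous_coeff R _).mul continuous_const

/-- The chain rule. -/
theorem pderiv_subst [Fintype α] {a : α → MvPowerSeries β R} (ha : HasSubst a) (b : β)
    (f : MvPowerSeries α R) :
    pderiv R b (substAlgHom ha f) =
      ∑ i, pderiv R b (a i) * substAlgHom ha (pderiv R i f) := by
  -- The discrete topology on the coefficients makes polynomials dense in the power series.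
  let : UniformSpace R := ⊥
  have : DiscreteUniformity R := ⟨rfl⟩
  have hs : Continuous (substAlgHom ha : MvPowerSeries α R → MvPowerSeries β R) := by
    rw [coe_substAlgHom]
    exact continuous_subst ha
  have key : (fun f => pderiv R b (substAlgHom ha f)) =
      fun f => ∑ i, pderiv R b (a i) * substAlgHom ha (pderiv R i f) := by
    refine (WithPiTopology.denseRange_toMvPowerSeries (σ := α) (R := R)).equalizer
      ((continuous_pderiv b).comp hs)
      (continuous_finsetSum _ fun i _ => continuous_const.mul (hs.comp (continuous_pderiv i))) ?_
    funext p
    simp only [Function.comp_apply]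
    induction p using MvPolynomial.induction_on with
    | C r =>
      have h1 : substAlgHom ha (C r : MvPowerSeries α R) = C r :=
        (substAlgHom ha).commutes r
      simp only [MvPolynomial.coe_C, h1, pderiv_C, map_zero, mul_zero, Finset.sum_const_zero]
    | add p q hp hq =>
      simp only [map_add, mul_add, Finset.sum_add_distrib,
        MvPolynomial.coe_add] at hp hq ⊢
      rw [hp, hq]
    | mul_X p i hp =>
      rw [MvPolynomial.coe_mul, MvPolynomial.coe_X, map_mul, substAlgHom_X,
        Derivation.leibniz, hp]
      simp only [Derivation.leibniz, smul_eq_mul, map_add, map_mul, substAlgHom_X, mul_add,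
        Finset.sum_add_distrib, Finset.mul_sum]
      congr 1
      · classical
        rw [Finset.sum_eq_single i]
        · rw [pderiv_X_self, map_one]; ring
        · intro j _ hj
          rw [pderiv_X_of_ne hj.symm, map_zero]; ring
        · simp
      · exact Finset.sum_congr rfl fun j _ => by ring
  exact congrFun key f

theorem pderiv_comm (a b : α) (f : MvPowerSeries α R) :
    pderiv R a (pderiv R b f) = pderiv R b (pderiv R a f) := by
  classical
  ext n
  rw [coeff_pderiv, coeff_pderiv, coeff_pderiv, coeff_pderiv,
    add_right_comm n (Finsupp.single a 1)]
  simp only [Finsupp.add_apply]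
  by_cases h : a = b
  · rw [h]
  · rw [Finsupp.single_eq_of_ne h, Finsupp.single_eq_of_ne (Ne.symm h)]
    push_cast
    ring

end Subst

open MvPowerSeries

variable {α β γ : Type*} [Fintype α] [Fintype β] [Fintype γ] {E E' E'' : Type*} [AddCommGroup E]
  [AddCommGroup E'] [AddCommGroup E''] [Module ℂ E] [Module ℂ E'] [Module ℂ E'']

/-- A vector as a linear form in the variables indexed by a basis. -/
def lin (e : Module.Basis α ℂ E) : E →ₗ[ℂ] MvPowerSeries α ℂ :=
  ∑ a, (e.coord a).smulRight (X a)

theorem lin_apply (e : Module.Basis α ℂ E) (v : E) : lin e v = ∑ a, e.repr v a • X a := by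
  simp [lin]

@[simp] theorem lin_basis (e : Module.Basis α ℂ E) (a : α) : lin e (e a) = X a := by
  classical
  rw [lin_apply, Finset.sum_eq_single a]
  · simp
  · intro b _ hb
    rw [e.repr_self, Finsupp.single_eq_of_ne hb, zero_smul]
  · simp

theorem constantCoeff_lin (e : Module.Basis α ℂ E) (v : E) : constantCoeff (lin e v) = 0 := by
  rw [lin_apply, map_sum]
  exact Finset.sum_eq_zero fun a _ => by simp [smul_eq_C_mul]

/-- The derivation `∂_ℓ` with `∂_ℓ v = ℓ v` for every vector `v`. -/
def dirDeriv (e : Module.Basis α ℂ E) (l : E →ₗ[ℂ] ℂ) :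
    Derivation ℂ (MvPowerSeries α ℂ) (MvPowerSeries α ℂ) :=
  ∑ a, l (e a) • pderiv ℂ a

theorem dirDeriv_apply (e : Module.Basis α ℂ E) (l : E →ₗ[ℂ] ℂ) (f : MvPowerSeries α ℂ) :
    dirDeriv e l f = ∑ a, l (e a) • pderiv ℂ a f := by
  have h := map_sum (Derivation.coeFnAddMonoidHom (R := ℂ) (A := MvPowerSeries α ℂ)
    (M := MvPowerSeries α ℂ)) (fun a => l (e a) • pderiv ℂ a) Finset.univ
  refine (congrFun h f).trans ?_
  rw [Finset.sum_apply]
  rfl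

theorem sum_smul_dirDeriv {κ : Type*} [Fintype κ] (e : Module.Basis α ℂ E) (r : κ → ℂ)
    (l : κ → E →ₗ[ℂ] ℂ) (f : MvPowerSeries α ℂ) :
    ∑ b, r b • dirDeriv e (l b) f = dirDeriv e (∑ b, r b • l b) f := by
  simp only [dirDeriv_apply, Finset.smul_sum, smul_smul, LinearMap.sum_apply, LinearMap.smul_apply,
    Finset.sum_smul, smul_eq_mul]
  rw [Finset.sum_comm]

theorem dirDeriv_add (e : Module.Basis α ℂ E) (l l' : E →ₗ[ℂ] ℂ) (f : MvPowerSeries α ℂ) :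
    dirDeriv e (l + l') f = dirDeriv e l f + dirDeriv e l' f := by
  simp only [dirDeriv_apply, LinearMap.add_apply, add_smul, Finset.sum_add_distrib]

theorem dirDeriv_zero (e : Module.Basis α ℂ E) : dirDeriv e 0 = 0 := by
  simp [dirDeriv]

theorem sum_repr_smul_bilin (e : Module.Basis α ℂ E) (Q : E →ₗ[ℂ] E →ₗ[ℂ] ℂ) (v : E) :
    ∑ a, e.repr v a • Q (e a) = Q v := by
  conv_rhs => rw [← e.sum_repr v, map_sum]
  simp only [map_smul]

theorem pderiv_lin (e : Module.Basis α ℂ E) (a : α) (v : E) :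
    pderiv ℂ a (lin e v) = C (e.repr v a) := by
  classical
  rw [lin_apply, map_sum, Finset.sum_eq_single a]
  · rw [(pderiv ℂ a).map_smul, pderiv_X_self, smul_eq_C_mul, mul_one]
  · intro b _ hb
    rw [(pderiv ℂ a).map_smul, pderiv_X_of_ne hb, smul_zero]
  · simp

theorem dirDeriv_lin (e : Module.Basis α ℂ E) (l : E →ₗ[ℂ] ℂ) (v : E) :
    dirDeriv e l (lin e v) = C (l v) := by
  rw [dirDeriv_apply]
  simp only [pderiv_lin]
  conv_rhs => rw [← e.sum_repr v, map_sum, map_sum]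
  refine Finset.sum_congr rfl fun a _ => ?_
  rw [map_smul, smul_eq_C_mul, ← map_mul, smul_eq_mul, mul_comm]

theorem hasSubst_lin (e : Module.Basis α ℂ E) (e' : Module.Basis β ℂ E') (L : E →ₗ[ℂ] E') :
    HasSubst fun a => lin e' (L (e a)) :=
  hasSubst_of_constantCoeff_zero fun _ => constantCoeff_lin _ _

/-- The substitution `v ↦ L v` of linear forms. -/
def linSubst (e : Module.Basis α ℂ E) (e' : Module.Basis β ℂ E') (L : E →ₗ[ℂ] E') :
    MvPowerSeries α ℂ →ₐ[ℂ] MvPowerSeries β ℂ :=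
  substAlgHom (hasSubst_lin e e' L)

@[simp] theorem linSubst_X (e : Module.Basis α ℂ E) (e' : Module.Basis β ℂ E') (L : E →ₗ[ℂ] E')
    (a : α) : linSubst e e' L (X a) = lin e' (L (e a)) :=
  substAlgHom_X _ _

@[simp] theorem linSubst_lin (e : Module.Basis α ℂ E) (e' : Module.Basis β ℂ E') (L : E →ₗ[ℂ] E')
    (v : E) : linSubst e e' L (lin e v) = lin e' (L v) := by
  rw [lin_apply, map_sum]
  conv_rhs => rw [← e.sum_repr v, map_sum, map_sum]
  refine Finset.sum_congr rfl fun a _ => ?_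
  rw [map_smul, linSubst_X, map_smul, map_smul]

theorem linSubst_id (e : Module.Basis α ℂ E) : linSubst e e LinearMap.id = AlgHom.id ℂ _ := by
  refine AlgHom.ext fun f => ?_
  unfold linSubst
  rw [substAlgHom_apply]
  have : (fun a => lin e ((LinearMap.id : E →ₗ[ℂ] E) (e a))) = X := by
    funext a
    simp
  rw [this, subst_self]
  rfl

theorem linSubst_linSubst (e : Module.Basis α ℂ E) (e' : Module.Basis β ℂ E')
    (e'' : Module.Basis γ ℂ E'') (L : E →ₗ[ℂ] E') (L' : E' →ₗ[ℂ] E'') (f : MvPowerSeries α ℂ) :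
    linSubst e' e'' L' (linSubst e e' L f) = linSubst e e'' (L' ∘ₗ L) f := by
  have h := substAlgHom_comp_substAlgHom_apply (R := ℂ) (hasSubst_lin e e' L)
    (hasSubst_lin e' e'' L') f
  refine h.trans ?_
  unfold linSubst
  rw [substAlgHom_apply, substAlgHom_apply]
  congr 1
  funext a
  have h2 := linSubst_lin e' e'' L' (L (e a))
  unfold linSubst at h2
  exact h2

theorem pderiv_linSubst (e : Module.Basis α ℂ E) (e' : Module.Basis β ℂ E') (L : E →ₗ[ℂ] E')
    (b : β) (f : MvPowerSeries α ℂ) :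
    pderiv ℂ b (linSubst e e' L f) =
      ∑ a, e'.repr (L (e a)) b • linSubst e e' L (pderiv ℂ a f) := by
  unfold linSubst
  rw [pderiv_subst]
  refine Finset.sum_congr rfl fun a _ => ?_
  rw [pderiv_lin, smul_eq_C_mul]

theorem dirDeriv_linSubst (e : Module.Basis α ℂ E) (e' : Module.Basis β ℂ E') (L : E →ₗ[ℂ] E')
    (l : E' →ₗ[ℂ] ℂ) (f : MvPowerSeries α ℂ) :
    dirDeriv e' l (linSubst e e' L f) = linSubst e e' L (dirDeriv e (l ∘ₗ L) f) := by
  simp only [dirDeriv_apply, pderiv_linSubst, map_sum, map_smul, Finset.smul_sum, smul_smul]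
  rw [Finset.sum_comm]
  refine Finset.sum_congr rfl fun a _ => ?_
  rw [← Finset.sum_smul]
  congr 1
  conv_rhs => rw [LinearMap.comp_apply, ← e'.sum_repr (L (e a)), map_sum]
  exact Finset.sum_congr rfl fun b _ => by rw [map_smul, smul_eq_mul, mul_comm]

/-- The second order operator `∑ a b, Q(e_a, e_b) ∂_a ∂_b` of a bilinear form `Q`. -/
def quadOp (e : Module.Basis α ℂ E) (Q : E →ₗ[ℂ] E →ₗ[ℂ] ℂ) :
    Module.End ℂ (MvPowerSeries α ℂ) :=
  ∑ a, ∑ b, Q (e a) (e b) • ((pderiv ℂ a).toLinearMap ∘ₗ (pderiv ℂ b).toLinearMap)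

theorem quadOp_apply (e : Module.Basis α ℂ E) (Q : E →ₗ[ℂ] E →ₗ[ℂ] ℂ) (f : MvPowerSeries α ℂ) :
    quadOp e Q f = ∑ a, ∑ b, Q (e a) (e b) • pderiv ℂ a (pderiv ℂ b f) := by
  simp [quadOp, LinearMap.sum_apply]

theorem quadOp_eq_dirDeriv (e : Module.Basis α ℂ E) (Q : E →ₗ[ℂ] E →ₗ[ℂ] ℂ)
    (f : MvPowerSeries α ℂ) :
    quadOp e Q f = ∑ a, pderiv ℂ a (dirDeriv e (Q (e a)) f) := by
  simp [quadOp_apply, dirDeriv_apply]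

theorem quadOp_zero (e : Module.Basis α ℂ E) : quadOp e 0 = 0 := by
  simp [quadOp]

theorem quadOp_add (e : Module.Basis α ℂ E) (Q Q' : E →ₗ[ℂ] E →ₗ[ℂ] ℂ) :
    quadOp e (Q + Q') = quadOp e Q + quadOp e Q' := by
  simp only [quadOp, LinearMap.add_apply, add_smul, Finset.sum_add_distrib]

theorem quadOp_flip (e : Module.Basis α ℂ E) (Q : E →ₗ[ℂ] E →ₗ[ℂ] ℂ) :
    quadOp e Q.flip = quadOp e Q := by
  refine LinearMap.ext fun f => ?_
  rw [quadOp_apply, quadOp_apply, Finset.sum_comm]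
  simp only [LinearMap.flip_apply]
  exact Finset.sum_congr rfl fun a _ => Finset.sum_congr rfl fun b _ => by rw [pderiv_comm]

/-- `quadOp e Q` depends on the quadratic form `v ↦ Q(v, v)` only. -/
theorem quadOp_congr (e : Module.Basis α ℂ E) {Q Q' : E →ₗ[ℂ] E →ₗ[ℂ] ℂ}
    (h : ∀ v, Q v v = Q' v v) : quadOp e Q = quadOp e Q' := by
  have h1 : Q + Q.flip = Q' + Q'.flip := by
    refine LinearMap.ext₂ fun u v => ?_
    have h2 := h (u + v)
    simp only [map_add, LinearMap.add_apply, LinearMap.flip_apply] at h2 ⊢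
    linear_combination h2 - h u - h v
  have h2 := congrArg (quadOp e) h1
  rw [quadOp_add, quadOp_add, quadOp_flip, quadOp_flip, ← two_smul ℂ, ← two_smul ℂ] at h2
  exact smul_right_injective _ (two_ne_zero' ℂ) h2

theorem commute_quadOp (e : Module.Basis α ℂ E) (Q Q' : E →ₗ[ℂ] E →ₗ[ℂ] ℂ) :
    Commute (quadOp e Q) (quadOp e Q') := by
  refine Commute.sum_left _ _ _ fun a _ => Commute.sum_left _ _ _ fun b _ =>
    Commute.sum_right _ _ _ fun c _ => Commute.sum_right _ _ _ fun d _ =>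
    Commute.smul_left (Commute.smul_right ?_ _) _
  have h (a b : α) : Commute ((pderiv ℂ a).toLinearMap : Module.End ℂ (MvPowerSeries α ℂ))
      (pderiv ℂ b).toLinearMap := LinearMap.ext fun f => pderiv_comm a b f
  exact ((h a c).mul_right (h a d)).mul_left ((h b c).mul_right (h b d))

theorem commute_quadOp_dirDeriv (e : Module.Basis α ℂ E) (Q : E →ₗ[ℂ] E →ₗ[ℂ] ℂ)
    (l : E →ₗ[ℂ] ℂ) : Commute (quadOp e Q) (dirDeriv e l).toLinearMap := by
  have h (a b : α) : Commute ((pderiv ℂ a).toLinearMap : Module.End ℂ (MvPowerSeries α ℂ))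
      (pderiv ℂ b).toLinearMap := LinearMap.ext fun f => pderiv_comm a b f
  have hl : (dirDeriv e l).toLinearMap = ∑ a, l (e a) • (pderiv ℂ a).toLinearMap := by
    refine LinearMap.ext fun f => ?_
    rw [LinearMap.sum_apply]
    exact dirDeriv_apply e l f
  rw [hl]
  unfold quadOp
  refine Commute.sum_left _ _ _ fun a _ => ?_
  refine Commute.sum_left _ _ _ fun b _ => ?_
  refine Commute.sum_right _ _ _ fun c _ => ?_
  have h1 := (h a c).mul_left (h b c)
  have h2 := h1.smul_left (Q (e a) (e b))
  exact h2.smul_right (l (e c))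

theorem quadOp_linSubst (e : Module.Basis α ℂ E) (e' : Module.Basis β ℂ E') (L : E →ₗ[ℂ] E')
    (Q : E' →ₗ[ℂ] E' →ₗ[ℂ] ℂ) (f : MvPowerSeries α ℂ) :
    quadOp e' Q (linSubst e e' L f) = linSubst e e' L (quadOp e (Q.compl₁₂ L L) f) := by
  simp only [quadOp_eq_dirDeriv, dirDeriv_linSubst, pderiv_linSubst, map_sum]
  rw [Finset.sum_comm]
  refine Finset.sum_congr rfl fun a _ => ?_
  simp only [← map_smul, ← map_sum]
  have h1 : ∀ b, e'.repr (L (e a)) b • pderiv ℂ a (dirDeriv e (Q (e' b) ∘ₗ L) f) =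
      pderiv ℂ a (e'.repr (L (e a)) b • dirDeriv e (Q (e' b) ∘ₗ L) f) :=
    fun b => ((pderiv ℂ a).map_smul _ _).symm
  simp only [h1, ← map_sum, sum_smul_dirDeriv]
  have h2 : ∑ b, e'.repr (L (e a)) b • (Q (e' b) ∘ₗ L) = Q.compl₁₂ L L (e a) := by
    refine LinearMap.ext fun v => ?_
    have h3 := LinearMap.congr_fun (sum_repr_smul_bilin e' Q (L (e a))) (L v)
    simpa [LinearMap.sum_apply] using h3
  rw [h2]

/-- The commutator of a second order operator with the multiplication by a linear form is a
derivative. -/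
theorem quadOp_lin_mul (e : Module.Basis α ℂ E) (Q : E →ₗ[ℂ] E →ₗ[ℂ] ℂ) (w : E)
    (f : MvPowerSeries α ℂ) :
    quadOp e Q (lin e w * f) = lin e w * quadOp e Q f + dirDeriv e (Q w + Q.flip w) f := by
  have h1 : ∀ a, pderiv ℂ a (dirDeriv e (Q (e a)) (lin e w * f)) =
      lin e w * pderiv ℂ a (dirDeriv e (Q (e a)) f) +
        (Q (e a) w • pderiv ℂ a f + e.repr w a • dirDeriv e (Q (e a)) f) := by
    intro a
    simp only [Derivation.leibniz, smul_eq_mul, map_add, dirDeriv_lin, pderiv_lin, pderiv_C,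
      mul_zero, smul_eq_C_mul]
    ring
  simp only [quadOp_eq_dirDeriv, h1, Finset.sum_add_distrib, Finset.mul_sum]
  congr 1
  rw [sum_smul_dirDeriv, sum_repr_smul_bilin, dirDeriv_add, add_comm]
  congr 1
  rw [dirDeriv_apply]
  rfl

theorem rename_eq_linSubst (e : Module.Basis α ℂ E) (e' : Module.Basis β ℂ E') {L : E →ₗ[ℂ] E'}
    (r : α → β) (h : ∀ a, L (e a) = e' (r a)) : rename (R := ℂ) r = linSubst e e' L := by
  refine AlgHom.ext fun p => ?_
  unfold linSubst
  rw [rename_eq_subst, substAlgHom_apply]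
  refine congrArg (fun a => subst a p) (funext fun a => ?_)
  rw [h, lin_basis]
  rfl

/-! ### Gaussian operators -/

/-- The operator `f ↦ (exp (ħ Q(∂, ∂)) f) ∘ L`. On formal exponentials of linear forms it is
`exp v ↦ exp (ħ Q(v, v)) exp (L v)`; all the maps of the Hochschild complex have this shape. -/
def gauss (e : Module.Basis α ℂ E) (e' : Module.Basis β ℂ E') (L : E →ₗ[ℂ] E')
    (Q : E →ₗ[ℂ] E →ₗ[ℂ] ℂ) :
    Laurent (MvPowerSeries α ℂ) →ₗ[LaurentSeries ℂ] Laurent (MvPowerSeries β ℂ) :=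
  Laurent.map (linSubst e e' L).toLinearMap ∘ₗ Laurent.expOp (quadOp e Q)

theorem gauss_apply (e : Module.Basis α ℂ E) (e' : Module.Basis β ℂ E') (L : E →ₗ[ℂ] E')
    (Q : E →ₗ[ℂ] E →ₗ[ℂ] ℂ) (f : Laurent (MvPowerSeries α ℂ)) :
    gauss e e' L Q f =
      Laurent.map (linSubst e e' L).toLinearMap (Laurent.expOp (quadOp e Q) f) :=
  rfl

theorem gauss_zero_apply (e : Module.Basis α ℂ E) (e' : Module.Basis β ℂ E') (L : E →ₗ[ℂ] E')
    (f : Laurent (MvPowerSeries α ℂ)) :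
    gauss e e' L 0 f = Laurent.map (linSubst e e' L).toLinearMap f := by
  rw [gauss_apply, quadOp_zero, Laurent.expOp_zero]

theorem map_rename_eq_gauss (e : Module.Basis α ℂ E) (e' : Module.Basis β ℂ E') {L : E →ₗ[ℂ] E'}
    (r : α → β) (h : ∀ a, L (e a) = e' (r a)) (f : Laurent (MvPowerSeries α ℂ)) :
    Laurent.map (rename (R := ℂ) r).toLinearMap f = gauss e e' L 0 f := by
  rw [gauss_zero_apply, rename_eq_linSubst e e' r h]

theorem gauss_congr (e : Module.Basis α ℂ E) (e' : Module.Basis β ℂ E') {L L' : E →ₗ[ℂ] E'}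
    {Q Q' : E →ₗ[ℂ] E →ₗ[ℂ] ℂ} (hL : ∀ v, L v = L' v) (hQ : ∀ v, Q v v = Q' v v) :
    gauss e e' L Q = gauss e e' L' Q' := by
  unfold gauss
  rw [LinearMap.ext hL, quadOp_congr e hQ]

/-- Gaussian operators compose like maps of exponentials. -/
theorem gauss_gauss (e : Module.Basis α ℂ E) (e' : Module.Basis β ℂ E')
    (e'' : Module.Basis γ ℂ E'') (L : E →ₗ[ℂ] E') (Q : E →ₗ[ℂ] E →ₗ[ℂ] ℂ) (L' : E' →ₗ[ℂ] E'')
    (Q' : E' →ₗ[ℂ] E' →ₗ[ℂ] ℂ) (f : Laurent (MvPowerSeries α ℂ)) :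
    gauss e' e'' L' Q' (gauss e e' L Q f) = gauss e e'' (L' ∘ₗ L) (Q'.compl₁₂ L L + Q) f := by
  simp only [gauss_apply]
  rw [← Laurent.map_expOp (D := quadOp e (Q'.compl₁₂ L L)) (D' := quadOp e' Q')
    (LinearMap.ext fun f => (quadOp_linSubst e e' L Q' f).symm),
    Laurent.expOp_expOp (commute_quadOp e _ _), Laurent.map_map, ← quadOp_add]
  congr 1
  exact congrArg _ (LinearMap.ext fun f => linSubst_linSubst e e' e'' L L' f)

theorem gauss_id (e : Module.Basis α ℂ E) {L : E →ₗ[ℂ] E} {Q : E →ₗ[ℂ] E →ₗ[ℂ] ℂ}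
    (hL : ∀ v, L v = v) (hQ : ∀ v, Q v v = 0) (f : Laurent (MvPowerSeries α ℂ)) :
    gauss e e L Q f = f := by
  rw [gauss_congr e e (L' := LinearMap.id) (Q' := 0) hL hQ, gauss_zero_apply, linSubst_id]
  rfl

/-- Two compositions of Gaussian operators agree as soon as they agree on exponentials. -/
theorem gauss_gauss_eq {β' : Type*} [Fintype β'] {F : Type*} [AddCommGroup F] [Module ℂ F]
    (e : Module.Basis α ℂ E) (e' : Module.Basis β ℂ E') (e₁ : Module.Basis β' ℂ F)
    (e'' : Module.Basis γ ℂ E'') {L : E →ₗ[ℂ] E'} {Q : E →ₗ[ℂ] E →ₗ[ℂ] ℂ} {L' : E' →ₗ[ℂ] E''}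
    {Q' : E' →ₗ[ℂ] E' →ₗ[ℂ] ℂ} {M : E →ₗ[ℂ] F} {R : E →ₗ[ℂ] E →ₗ[ℂ] ℂ} {M' : F →ₗ[ℂ] E''}
    {R' : F →ₗ[ℂ] F →ₗ[ℂ] ℂ} (hL : ∀ v, L' (L v) = M' (M v))
    (hQ : ∀ v, Q' (L v) (L v) + Q v v = R' (M v) (M v) + R v v)
    (f : Laurent (MvPowerSeries α ℂ)) :
    gauss e' e'' L' Q' (gauss e e' L Q f) = gauss e₁ e'' M' R' (gauss e e₁ M R f) := by
  rw [gauss_gauss, gauss_gauss]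
  exact LinearMap.congr_fun (gauss_congr e e'' hL hQ) f

/-- The operator `f ↦ w f + ħ ∂_ℓ f`. -/
def heis (e : Module.Basis α ℂ E) (w : E) (l : E →ₗ[ℂ] ℂ) :
    Laurent (MvPowerSeries α ℂ) →ₗ[LaurentSeries ℂ] Laurent (MvPowerSeries α ℂ) :=
  Laurent.map (LinearMap.mulLeft ℂ (lin e w)) +
    Laurent.hbar • Laurent.map (dirDeriv e l).toLinearMap

theorem heis_apply (e : Module.Basis α ℂ E) (w : E) (l : E →ₗ[ℂ] ℂ)
    (f : Laurent (MvPowerSeries α ℂ)) :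
    heis e w l f = Laurent.map (LinearMap.mulLeft ℂ (lin e w)) f +
      Laurent.hbar • Laurent.map (dirDeriv e l).toLinearMap f :=
  rfl

theorem heis_add_right (e : Module.Basis α ℂ E) (w : E) (l l' : E →ₗ[ℂ] ℂ)
    (f : Laurent (MvPowerSeries α ℂ)) :
    heis e w (l + l') f =
      heis e w l f + Laurent.hbar • Laurent.map (dirDeriv e l').toLinearMap f := by
  rw [heis_apply, heis_apply, add_assoc, ← smul_add]
  congr 2
  exact Laurent.ext_coeff fun k => dirDeriv_add e l l' _

/-- The commutation of a Gaussian operator with a Heisenberg operator: the infinitesimal form of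
its covariance under translations of exponentials. -/
theorem gauss_heis (e : Module.Basis α ℂ E) (e' : Module.Basis β ℂ E') {L : E →ₗ[ℂ] E'}
    {Q : E →ₗ[ℂ] E →ₗ[ℂ] ℂ} {w : E} {l : E →ₗ[ℂ] ℂ} {w' : E'} {l' : E' →ₗ[ℂ] ℂ}
    (hw : L w = w') (hl : ∀ v, Q w v + Q v w + l v = l' (L v))
    (f : Laurent (MvPowerSeries α ℂ)) :
    gauss e e' L Q (heis e w l f) = heis e' w' l' (gauss e e' L Q f) := by
  have hl' : Q w + Q.flip w + l = l' ∘ₗ L := LinearMap.ext hl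
  have h1 : ∀ f, Laurent.expOp (quadOp e Q) (heis e w l f) =
      heis e w (l + (Q w + Q.flip w)) (Laurent.expOp (quadOp e Q) f) := by
    intro f
    rw [heis_add_right, heis_apply, heis_apply, map_add, map_smul,
      Laurent.expOp_map_of_commutator (D := quadOp e Q) (m := LinearMap.mulLeft ℂ (lin e w))
      (c := (dirDeriv e (Q w + Q.flip w)).toLinearMap)
      (LinearMap.ext fun f => quadOp_lin_mul e Q w f) (commute_quadOp_dirDeriv e Q _),
      Laurent.map_expOp (f := (dirDeriv e l).toLinearMap) (D' := quadOp e Q)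
      (commute_quadOp_dirDeriv e Q l).symm]
    exact add_right_comm _ _ _
  rw [gauss_apply, h1, add_comm l, hl', heis_apply, map_add, map_smul, heis_apply, gauss_apply,
    Laurent.map_map, Laurent.map_map, Laurent.map_map, Laurent.map_map, ← hw]
  refine congrArg₂ (fun T U => T + Laurent.hbar • U)
    (congrArg (fun T => Laurent.map T _) (LinearMap.ext fun f => ?_))
    (congrArg (fun T => Laurent.map T _) (LinearMap.ext fun f => ?_))
  · simp
  · exact (dirDeriv_linSubst e e' L l' _).symm

/-! ### The Hochschild faces as Gaussian operators -/

section Slots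

variable {V : Type*} [AddCommGroup V] [Module ℂ V] {ι : Type*} [Fintype ι] {σ τ : Type*}
  [Fintype σ] [Fintype τ]

/-- The basis of `V^σ` dual to the variables of `SlotSeries σ ι`. -/
def slotBasis (y : Module.Basis ι ℂ V) (σ : Type*) [Fintype σ] :
    Module.Basis (σ × ι) ℂ (σ → V) :=
  (Pi.basis fun _ : σ => y).reindex (Equiv.sigmaEquivProd σ ι)

theorem slotBasis_apply [DecidableEq σ] (y : Module.Basis ι ℂ V) (p : σ × ι) :
    slotBasis y σ p = Pi.single p.1 (y p.2) := by
  classical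
  obtain ⟨s, i⟩ := p
  rw [slotBasis, Module.Basis.reindex_apply, Equiv.sigmaEquivProd_symm_apply, Pi.basis_apply]

@[simp] theorem slotBasis_repr (y : Module.Basis ι ℂ V) (v : σ → V) (p : σ × ι) :
    (slotBasis y σ).repr v p = y.repr (v p.1) p.2 := by
  obtain ⟨s, i⟩ := p
  rw [slotBasis, Module.Basis.repr_reindex_apply, Equiv.sigmaEquivProd_symm_apply, Pi.basis_repr]

theorem lin_single [DecidableEq σ] (y : Module.Basis ι ℂ V) (s : σ) (v : V) :
    lin (slotBasis y σ) (Pi.single s v) = linearForm y s v := by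
  rw [lin_apply, Fintype.sum_prod_type, Finset.sum_eq_single s]
  · simp [linearForm]
  · intro t _ ht
    simp [Pi.single_eq_of_ne ht]
  · simp

variable [DecidableEq τ]

/-- The map `V^σ → V^τ` which adds up the vectors in slots with the same image. -/
def pushSlots (V : Type*) [AddCommGroup V] [Module ℂ V] (f : σ → τ) : (σ → V) →ₗ[ℂ] (τ → V) :=
  LinearMap.pi fun t => ∑ s, if f s = t then LinearMap.proj s else 0

theorem pushSlots_apply (f : σ → τ) (v : σ → V) (t : τ) :
    pushSlots V f v t = ∑ s, if f s = t then v s else 0 := by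
  simp only [pushSlots, LinearMap.pi_apply, LinearMap.sum_apply]
  exact Finset.sum_congr rfl fun s _ => by split_ifs <;> rfl

theorem pushSlots_single [DecidableEq σ] (f : σ → τ) (s : σ) (v : V) :
    pushSlots V f (Pi.single s v) = Pi.single (f s) v := by
  funext t
  rw [pushSlots_apply, Finset.sum_eq_single s]
  · by_cases h : f s = t
    · subst h; simp
    · rw [if_neg h, Pi.single_eq_of_ne (Ne.symm h)]
  · intro s' _ hs'
    rw [Pi.single_eq_of_ne hs', ite_self]
  · simp

theorem rename_slots_eq_linSubst (y : Module.Basis ι ℂ V) (f : σ → τ) :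
    (rename (R := ℂ) (Prod.map f (id : ι → ι))) =
      linSubst (slotBasis y σ) (slotBasis y τ) (pushSlots V f) := by
  classical
  refine rename_eq_linSubst _ _ _ fun a => ?_
  rw [slotBasis_apply, pushSlots_single, slotBasis_apply]
  rfl

/-- The bilinear form `½ B(v_s, w_t)` on `V^σ`. -/
def slotForm (B : V →ₗ[ℂ] V →ₗ[ℂ] ℂ) (s t : σ) : (σ → V) →ₗ[ℂ] (σ → V) →ₗ[ℂ] ℂ :=
  (1 / 2 : ℂ) • B.compl₁₂ (LinearMap.proj s) (LinearMap.proj t)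

theorem slotForm_apply (B : V →ₗ[ℂ] V →ₗ[ℂ] ℂ) (s t : σ) (v w : σ → V) :
    slotForm B s t v w = 1 / 2 * B (v s) (w t) := rfl

theorem bidiff_eq_quadOp (B : V →ₗ[ℂ] V →ₗ[ℂ] ℂ) (y : Module.Basis ι ℂ V) (s t : σ) :
    bidiff B y s t = quadOp (slotBasis y σ) (slotForm B s t) := by
  classical
  unfold quadOp bidiff
  have h : ∀ a b : σ × ι, slotForm B s t (slotBasis y σ a) (slotBasis y σ b) =
      if a.1 = s then if b.1 = t then 1 / 2 * B (y a.2) (y b.2) else 0 else 0 := by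
    intro a b
    rw [slotForm_apply, slotBasis_apply, slotBasis_apply]
    split_ifs with h1 h2
    · rw [← h1, ← h2, Pi.single_eq_same, Pi.single_eq_same]
    · rw [Pi.single_eq_of_ne (Ne.symm h2), map_zero, mul_zero]
    · rw [Pi.single_eq_of_ne (Ne.symm h1), map_zero, LinearMap.zero_apply, mul_zero]
  simp only [h, Fintype.sum_prod_type, Finset.smul_sum]
  rw [Finset.sum_eq_single s _ (by simp)]
  · refine Finset.sum_congr rfl fun i _ => ?_
    rw [Finset.sum_eq_single t _ (by simp)]
    · refine Finset.sum_congr rfl fun j _ => ?_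
      rw [if_pos rfl, if_pos rfl, mul_smul]
    · intro t' _ ht'
      simp [ht']
  · intro s' _ hs'
    simp [hs']

theorem contract_eq_gauss (B : V →ₗ[ℂ] V →ₗ[ℂ] ℂ) (y : Module.Basis ι ℂ V) (s t : σ)
    (f : σ → τ) :
    contract B y s t f =
      gauss (slotBasis y σ) (slotBasis y τ) (pushSlots V f) (slotForm B s t) := by
  unfold contract gauss renameSlots
  rw [bidiff_eq_quadOp, rename_slots_eq_linSubst y f]

/-- The map of `V^σ` which is `g` in the slot `t` and the identity in the other slots. -/
def actSlot (g : V ≃ₗ[ℂ] V) [DecidableEq σ] (t : σ) : (σ → V) →ₗ[ℂ] (σ → V) :=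
  LinearMap.pi fun s => if s = t then g.toLinearMap ∘ₗ LinearMap.proj s else LinearMap.proj s

theorem actSlot_apply (g : V ≃ₗ[ℂ] V) [DecidableEq σ] (t : σ) (v : σ → V) (s : σ) :
    actSlot g t v s = if s = t then g (v s) else v s := by
  simp only [actSlot, LinearMap.pi_apply]
  split_ifs <;> rfl

theorem lin_actSlot (g : V ≃ₗ[ℂ] V) (y : Module.Basis ι ℂ V) [DecidableEq σ] (t : σ)
    (p : σ × ι) :
    lin (slotBasis y σ) (actSlot g t (slotBasis y σ p)) = actVar g y t p := by
  have h : actSlot g t (slotBasis y σ p) =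
      Pi.single p.1 (if p.1 = t then g (y p.2) else y p.2) := by
    funext s
    rw [actSlot_apply, slotBasis_apply]
    by_cases hs : s = p.1
    · subst hs
      simp
    · simp [Pi.single_eq_of_ne hs]
  rw [h, lin_single]
  unfold actVar
  split_ifs with h1
  · rw [h1]
  · rw [← lin_single, ← slotBasis_apply, lin_basis]

theorem act_eq_gauss (g : V ≃ₗ[ℂ] V) (y : Module.Basis ι ℂ V) [DecidableEq σ] (t : σ) :
    act g y t = gauss (slotBasis y σ) (slotBasis y σ) (actSlot g t) 0 := by
  have key : (substAlgHom (R := ℂ) (hasSubst_actVar g y t) : _ →ₐ[ℂ] _) =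
      linSubst (slotBasis y σ) (slotBasis y σ) (actSlot g t) := by
    refine AlgHom.ext fun p => ?_
    unfold linSubst
    rw [substAlgHom_apply, substAlgHom_apply]
    exact congrArg (fun a => subst a p) (funext fun p => (lin_actSlot g y t p).symm)
  refine LinearMap.ext fun a => ?_
  rw [gauss_zero_apply, ← key]
  rfl

end Slots

theorem pushSlots_predAbove {V : Type*} [AddCommGroup V] [Module ℂ V] {n : ℕ} (p : Fin (n + 1))
    (v : Fin (n + 2) → V) (r : Fin (n + 1)) :
    pushSlots V p.predAbove v r =
      (if p = r then v p.castSucc else 0) + v (p.castSucc.succAbove r) := by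
  rw [pushSlots_apply, Fin.sum_univ_succAbove _ p.castSucc, Fin.predAbove_castSucc_self]
  congr 1
  rw [Finset.sum_eq_single r]
  · rw [Fin.predAbove_succAbove, if_pos rfl]
  · intro t _ ht
    rw [Fin.predAbove_succAbove, if_neg ht]
  · simp

theorem pushSlots_lastCases {V : Type*} [AddCommGroup V] [Module ℂ V] {n : ℕ}
    (v : Fin (n + 2) → V) (r : Fin (n + 1)) :
    pushSlots V (Fin.lastCases (motive := fun _ => Fin (n + 1)) 0 id) v r =
      v r.castSucc + if (0 : Fin (n + 1)) = r then v (Fin.last (n + 1)) else 0 := by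
  rw [pushSlots_apply, Fin.sum_univ_castSucc, Fin.lastCases_last]
  congr 1
  rw [Finset.sum_eq_single r]
  · rw [Fin.lastCases_castSucc, id, if_pos rfl]
  · intro t _ ht
    rw [Fin.lastCases_castSucc, id, if_neg ht]
  · simp

/-! ### The homogeneous complex -/

/-- The composition of two alternating sums of face maps vanishes. -/
theorem alternating_sum_comp {K M M' M'' : Type*} [CommRing K] [AddCommGroup M]
    [AddCommGroup M'] [AddCommGroup M''] [Module K M] [Module K M'] [Module K M''] {n : ℕ}
    (d : Fin (n + 2) → M →ₗ[K] M') (d' : Fin (n + 1) → M' →ₗ[K] M'') (f : M)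
    (h : ∀ i j, d' (j.predAbove i) (d (i.succAbove j) f) = d' j (d i f)) :
    ∑ j : Fin (n + 1), (-1 : K) ^ (j : ℕ) •
      d' j (∑ i : Fin (n + 2), (-1 : K) ^ (i : ℕ) • d i f) = 0 := by
  simp only [map_sum, map_smul, Finset.smul_sum, smul_smul, ← pow_add]
  rw [Finset.sum_comm, ← Finset.sum_product', Finset.univ_product_univ]
  -- The two ways of omitting the same two entries cancel.
  refine Finset.sum_involution (fun p _ => (p.1.succAbove p.2, p.2.predAbove p.1)) ?_ ?_ ?_ ?_
  · rintro ⟨i, j⟩ -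
    dsimp only
    rw [h, ← add_smul, add_comm (j : ℕ), add_comm (j.predAbove i : ℕ),
      Fin.neg_one_pow_succAbove_add_predAbove, add_neg_cancel, zero_smul]
  · rintro ⟨i, j⟩ - - h
    exact Fin.succAbove_ne i j (congrArg Prod.fst h)
  · exact fun _ _ => Finset.mem_univ _
  · rintro ⟨i, j⟩ -
    exact Prod.ext (Fin.succAbove_succAbove_predAbove i j) (Fin.predAbove_predAbove_succAbove i j)

section Homogeneous

variable {V : Type*} [AddCommGroup V] [Module ℂ V] {ι κ : Type*} [Fintype ι] [Fintype κ]

/-- The basis of `V^{q+1} × V` dual to the variables of `Big κ q`. -/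
def bigBasis (e e' : Module.Basis κ ℂ V) (q : ℕ) :
    Module.Basis ((Fin (q + 1) × κ) ⊕ κ) ℂ ((Fin (q + 1) → V) × V) :=
  (slotBasis e (Fin (q + 1))).prod e'

/-- The chains of the homogeneous complex: Laurent series in `ħ` of power series in `q + 1`
collections of variables `u_0, …, u_q` and in one further collection `x`. -/
abbrev Big (κ : Type*) (q : ℕ) : Type _ :=
  Laurent (MvPowerSeries ((Fin (q + 1) × κ) ⊕ κ) ℂ)

/-- `(u, x) ↦ (u ∘ θ, x)`. -/
def pullMap (V : Type*) [AddCommGroup V] [Module ℂ V] {p q : ℕ} (θ : Fin (p + 1) → Fin (q + 1)) :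
    ((Fin (q + 1) → V) × V) →ₗ[ℂ] ((Fin (p + 1) → V) × V) :=
  (LinearMap.funLeft ℂ V θ).prodMap LinearMap.id

theorem pullMap_apply {p q : ℕ} (θ : Fin (p + 1) → Fin (q + 1)) (v : (Fin (q + 1) → V) × V) :
    pullMap V θ v = (v.1 ∘ θ, v.2) := rfl

/-- The map of homogeneous chains induced by `θ`, which is `exp (u, x) ↦ exp (u ∘ θ, x)`. -/
def pull (e e' : Module.Basis κ ℂ V) {p q : ℕ} (θ : Fin (p + 1) → Fin (q + 1)) :
    Big κ q →ₗ[LaurentSeries ℂ] Big κ p :=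
  gauss (bigBasis e e' q) (bigBasis e e' p) (pullMap V θ) 0

theorem pull_pull (e e' : Module.Basis κ ℂ V) {p q r : ℕ} (θ : Fin (p + 1) → Fin (q + 1))
    (η : Fin (q + 1) → Fin (r + 1)) (f : Big κ r) :
    pull e e' θ (pull e e' η f) = pull e e' (η ∘ θ) f := by
  unfold pull
  rw [gauss_gauss]
  exact LinearMap.congr_fun (gauss_congr _ _ (fun v => rfl) fun v => by simp) f

/-- The differential of the homogeneous complex, the alternating sum of the maps which omit one
of the `u_i`. -/
def bigDiff (e e' : Module.Basis κ ℂ V) (q : ℕ) : Big κ (q + 1) →ₗ[LaurentSeries ℂ] Big κ q :=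
  ∑ i : Fin (q + 2), (-1 : LaurentSeries ℂ) ^ (i : ℕ) • pull e e' i.succAbove

theorem bigDiff_apply (e e' : Module.Basis κ ℂ V) (q : ℕ) (f : Big κ (q + 1)) :
    bigDiff e e' q f =
      ∑ i : Fin (q + 2), (-1 : LaurentSeries ℂ) ^ (i : ℕ) • pull e e' i.succAbove f := by
  simp [bigDiff, LinearMap.sum_apply]

theorem bigDiff_bigDiff (e e' : Module.Basis κ ℂ V) (q : ℕ) (f : Big κ (q + 2)) :
    bigDiff e e' q (bigDiff e e' (q + 1) f) = 0 := by
  simp only [bigDiff_apply]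
  refine alternating_sum_comp (fun i => pull e e' i.succAbove) (fun i => pull e e' i.succAbove) f
    fun i j => ?_
  rw [pull_pull, pull_pull]
  exact congrArg (fun θ => pull e e' θ f)
    (funext fun k => Fin.succAbove_succAbove_succAbove_predAbove i j k)

/-! ### From homogeneous chains to Hochschild chains -/

/-- The linear part of `toChain`: `(u, x) ↦ (λ x + g u_0 - u_q, u_1 - u_0, …, u_q - u_{q-1})`. -/
def toChainMap (g : V ≃ₗ[ℂ] V) (lam : V →ₗ[ℂ] V) (q : ℕ) :
    ((Fin (q + 1) → V) × V) →ₗ[ℂ] (Fin (q + 1) → V) where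
  toFun v := Fin.cons (lam v.2 + g (v.1 0) - v.1 (Fin.last q))
    fun i : Fin q => v.1 i.succ - v.1 i.castSucc
  map_add' v w := by
    funext r
    refine Fin.cases ?_ (fun i => ?_) r
    · simp only [Fin.cons_zero, Pi.add_apply, Prod.snd_add, Prod.fst_add, map_add]
      abel
    · simp only [Fin.cons_succ, Pi.add_apply, Prod.fst_add]
      abel
  map_smul' c v := by
    funext r
    refine Fin.cases ?_ (fun i => ?_) r
    · simp only [Fin.cons_zero, Pi.smul_apply, Prod.smul_snd, Prod.smul_fst, map_smul,
        RingHom.id_apply, smul_sub, smul_add]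
    · simp only [Fin.cons_succ, Pi.smul_apply, Prod.smul_fst, RingHom.id_apply, smul_sub]

theorem toChainMap_zero (g : V ≃ₗ[ℂ] V) (lam : V →ₗ[ℂ] V) (q : ℕ) (v : (Fin (q + 1) → V) × V) :
    toChainMap g lam q v 0 = lam v.2 + g (v.1 0) - v.1 (Fin.last q) := rfl

theorem toChainMap_succ (g : V ≃ₗ[ℂ] V) (lam : V →ₗ[ℂ] V) (q : ℕ) (v : (Fin (q + 1) → V) × V)
    (i : Fin q) : toChainMap g lam q v i.succ = v.1 i.succ - v.1 i.castSucc := rfl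

/-- The quadratic part of `toChain`, the bilinear form with the quadratic form
`½ (- B(u_q, λ x) + B(λ x - u_q, g u_0) - ∑ i, B(u_i, u_{i+1}) - B(x, g x))`. -/
def toChainForm (B : V →ₗ[ℂ] V →ₗ[ℂ] ℂ) (g : V ≃ₗ[ℂ] V) (lam : V →ₗ[ℂ] V) (q : ℕ) :
    ((Fin (q + 1) → V) × V) →ₗ[ℂ] ((Fin (q + 1) → V) × V) →ₗ[ℂ] ℂ :=
  let u : Fin (q + 1) → ((Fin (q + 1) → V) × V) →ₗ[ℂ] V := fun s =>
    LinearMap.proj s ∘ₗ LinearMap.fst ℂ (Fin (q + 1) → V) V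
  let x : ((Fin (q + 1) → V) × V) →ₗ[ℂ] V := LinearMap.snd ℂ (Fin (q + 1) → V) V
  (1 / 2 : ℂ) • (-B.compl₁₂ (u (Fin.last q)) (lam ∘ₗ x)
    + B.compl₁₂ (lam ∘ₗ x - u (Fin.last q)) (g.toLinearMap ∘ₗ u 0)
    - ∑ i : Fin q, B.compl₁₂ (u i.castSucc) (u i.succ)
    - B.compl₁₂ x (g.toLinearMap ∘ₗ x))

theorem toChainForm_apply (B : V →ₗ[ℂ] V →ₗ[ℂ] ℂ) (g : V ≃ₗ[ℂ] V) (lam : V →ₗ[ℂ] V) (q : ℕ)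
    (v w : (Fin (q + 1) → V) × V) :
    toChainForm B g lam q v w = 1 / 2 * (-B (v.1 (Fin.last q)) (lam w.2)
      + B (lam v.2 - v.1 (Fin.last q)) (g (w.1 0))
      - ∑ i : Fin q, B (v.1 i.castSucc) (w.1 i.succ) - B v.2 (g w.2)) := by
  simp [toChainForm, LinearMap.sum_apply]

/-- The map from homogeneous chains to Hochschild chains. On exponentials it is
`exp (u, x) ↦ (w g) ⊗ a_1 ⊗ ⋯ ⊗ a_q` with `a_i` proportional to `e^{u_i - u_{i-1}}` and `w` to
`e^{λ x + g u_0 - u_q}`; the phase is chosen so that omitting one of the `u_i` corresponds to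
multiplying the neighbouring factors. For `λ = 1 - g + p` with the projection `p` onto the fixed
subspace, `a_i = e^{- u_{i-1}} ∘ e^{u_i}` and
`w = e^{- u_q} ∘ e^{x - p x} ∘ e^{p x} ∘ e^{- g (x - p x)} ∘ e^{g u_0}`. -/
def toChain (B : V →ₗ[ℂ] V →ₗ[ℂ] ℂ) (g : V ≃ₗ[ℂ] V) (lam : V →ₗ[ℂ] V) (e e' : Module.Basis κ ℂ V)
    (y : Module.Basis ι ℂ V) (q : ℕ) : Big κ q →ₗ[LaurentSeries ℂ] Chain ι q :=
  gauss (bigBasis e e' q) (slotBasis y (Fin (q + 1))) (toChainMap g lam q) (toChainForm B g lam q)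

variable {B : V →ₗ[ℂ] V →ₗ[ℂ] ℂ} {g : V ≃ₗ[ℂ] V} (lam : V →ₗ[ℂ] V) (e e' : Module.Basis κ ℂ V)
  (y : Module.Basis ι ℂ V)

/-- Omitting `u_0` corresponds to the product `w ∘ g a_1`. -/
theorem toChain_pull_zero (hB : B.IsAlt) (hgB : ∀ u v, B (g u) (g v) = B u v) (q : ℕ)
    (f : Big κ (q + 1)) :
    contract B y (0 : Fin (q + 2)) 1 (Fin.predAbove 0)
        (act g y 1 (toChain B g lam e e' y (q + 1) f))
      = toChain B g lam e e' y q (pull e e' (Fin.succAbove 0) f) := by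
  rw [contract_eq_gauss, act_eq_gauss]
  unfold toChain pull
  rw [gauss_gauss (e' := slotBasis y (Fin (q + 2)))]
  refine gauss_gauss_eq _ _ _ _ (fun v => ?_) (fun v => ?_) f
  · have h0 := toChainMap_zero g lam (q + 1) v
    have h1 := toChainMap_succ g lam (q + 1) v 0
    funext r
    rw [LinearMap.comp_apply, pushSlots_predAbove, actSlot_apply, actSlot_apply]
    refine Fin.cases ?_ (fun i => ?_) r
    · simp only [Fin.castSucc_zero, Fin.zero_succAbove, if_true, h0,
        toChainMap_zero, pullMap_apply, Function.comp_apply, Fin.succ_zero_eq_one,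
        Fin.zero_ne_one, if_false, Fin.succ_last]
      rw [← Fin.succ_zero_eq_one, toChainMap_succ]
      simp only [Fin.castSucc_zero, map_sub]
      abel
    · have h2 : (i.succ.succ : Fin (q + 2)) ≠ 1 := fun h => by simp [Fin.ext_iff] at h
      rw [if_neg (Fin.succ_ne_zero i).symm, zero_add, Fin.castSucc_zero, Fin.zero_succAbove,
        if_neg h2, toChainMap_succ, toChainMap_succ]
      simp [pullMap_apply]
  · simp only [toChainForm_apply, LinearMap.compl₁₂_apply, slotForm_apply,
      LinearMap.zero_apply, add_zero, actSlot_apply, Fin.sum_univ_succ, Fin.zero_ne_one,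
      if_false, if_true, toChainMap_zero, pullMap_apply, Function.comp_apply, Fin.zero_succAbove]
    rw [← Fin.succ_zero_eq_one, toChainMap_succ]
    simp only [map_add, map_sub, LinearMap.add_apply, LinearMap.sub_apply, hgB, hB.self_eq_zero,
      Fin.castSucc_zero, Fin.succ_last, Fin.succ_castSucc]
    ring

theorem succAbove_castSucc_eq {q : ℕ} (i j : Fin q) (h : j ≠ i) :
    i.succ.castSucc.succAbove j.castSucc = (i.castSucc.succAbove j).castSucc := by
  ext
  have h' : (j : ℕ) ≠ i := fun hh => h (Fin.ext hh)
  simp only [Fin.succAbove, Fin.lt_def, Fin.val_castSucc, Fin.val_succ]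
  split_ifs <;> simp <;> omega

theorem succAbove_castSucc_self {q : ℕ} (i : Fin q) :
    i.succ.castSucc.succAbove i.castSucc = i.castSucc.castSucc := by
  ext
  simp [Fin.succAbove, Fin.lt_def]

/-- The change of a sum over the steps of a path when one interior point is omitted. -/
theorem path_sum (B : V →ₗ[ℂ] V →ₗ[ℂ] ℂ) {q : ℕ} (u : Fin (q + 2) → V) (i : Fin q) :
    ∑ j : Fin (q + 1), B (u j.castSucc) (u j.succ) =
      ∑ j : Fin q, B (u (i.succ.castSucc.succAbove j.castSucc))
        (u (i.succ.castSucc.succAbove j.succ)) +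
      (B (u i.castSucc.castSucc) (u i.succ.castSucc) + B (u i.succ.castSucc) (u i.succ.succ) -
        B (u i.castSucc.castSucc) (u i.succ.succ)) := by
  have h1 : ∀ j : Fin q, i.succ.castSucc.succAbove j.succ = (i.castSucc.succAbove j).succ := by
    intro j
    rw [← Fin.succ_castSucc, Fin.succ_succAbove_succ]
  rw [Fin.sum_univ_succAbove _ i.castSucc, Fin.succ_castSucc, add_comm, ← sub_eq_iff_eq_add',
    add_sub_right_comm, ← Finset.sum_sub_distrib, Finset.sum_eq_single i]
  · rw [h1, succAbove_castSucc_self, Fin.succAbove_castSucc_self]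
    ring
  · intro j _ hj
    rw [h1, succAbove_castSucc_eq i j hj, sub_self]
  · simp

/-- Omitting `u_{i+1}` for `0 ≤ i < q` corresponds to the product `a_{i+1} ∘ a_{i+2}`. -/
theorem toChain_pull_succ (hB : B.IsAlt) (q : ℕ) (i : Fin q) (f : Big κ (q + 1)) :
    contract B y i.succ.castSucc i.succ.succ (Fin.predAbove i.succ)
        (toChain B g lam e e' y (q + 1) f)
      = toChain B g lam e e' y q (pull e e' (Fin.succAbove i.succ.castSucc) f) := by
  rw [contract_eq_gauss]
  unfold toChain pull
  have hi0 : (0 : Fin (q + 2)) < i.succ.castSucc := Fin.castSucc_pos (Fin.succ_pos i)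
  have hs0 : i.succ.castSucc.succAbove 0 = 0 := Fin.succAbove_ne_zero_zero hi0.ne'
  have hsl : i.succ.castSucc.succAbove (Fin.last q) = Fin.last (q + 1) :=
    (Fin.succAbove_of_le_castSucc _ _ (Fin.castSucc_le_castSucc_iff.mpr (Fin.le_last _)))
  refine gauss_gauss_eq _ _ _ _ (fun v => ?_) (fun v => ?_) f
  · funext r
    rw [pushSlots_predAbove]
    refine Fin.cases ?_ (fun j => ?_) r
    · rw [if_neg (Fin.succ_ne_zero i), zero_add, hs0, toChainMap_zero, toChainMap_zero]
      simp only [pullMap_apply, Function.comp_apply, hs0, hsl]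
    · rw [← Fin.succ_castSucc, Fin.succ_succAbove_succ, toChainMap_succ, toChainMap_succ,
        toChainMap_succ]
      simp only [pullMap_apply, Function.comp_apply, Fin.succ_inj]
      rw [← Fin.succ_succAbove_succ, Fin.succ_castSucc]
      by_cases hij : i = j
      · subst hij
        rw [if_pos rfl, succAbove_castSucc_self]
        simp only [Fin.succAbove_castSucc_self]
        abel
      · rw [if_neg hij, succAbove_castSucc_eq i j (Ne.symm hij), zero_add]
  · simp only [toChainForm_apply, slotForm_apply, LinearMap.zero_apply, add_zero, pullMap_apply,
      Function.comp_apply, hs0, hsl]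
    have h := path_sum B v.1 i
    rw [h, ← Fin.succ_castSucc, toChainMap_succ, toChainMap_succ]
    simp only [map_sub, LinearMap.sub_apply, hB.self_eq_zero, Fin.succ_castSucc]
    ring

/-- Omitting the last of the `u_i` corresponds to the product `a_{q+1} ∘ w`. -/
theorem toChain_pull_last (hB : B.IsAlt) (q : ℕ) (f : Big κ (q + 1)) :
    contract B y (Fin.last (q + 1)) 0 (Fin.lastCases 0 id) (toChain B g lam e e' y (q + 1) f)
      = toChain B g lam e e' y q (pull e e' (Fin.succAbove (Fin.last (q + 1))) f) := by
  rw [contract_eq_gauss]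
  unfold toChain pull
  refine gauss_gauss_eq _ _ _ _ (fun v => ?_) (fun v => ?_) f
  · funext r
    rw [pushSlots_lastCases]
    refine Fin.cases ?_ (fun j => ?_) r
    · rw [if_pos rfl, Fin.castSucc_zero, toChainMap_zero, ← Fin.succ_last, toChainMap_succ,
        toChainMap_zero]
      simp [pullMap_apply]
    · rw [if_neg (Fin.succ_ne_zero j).symm, add_zero, ← Fin.succ_castSucc, toChainMap_succ,
        toChainMap_succ]
      simp [pullMap_apply]
  · simp only [toChainForm_apply, slotForm_apply, LinearMap.zero_apply, add_zero, pullMap_apply,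
      Function.comp_apply, Fin.succAbove_last, Fin.sum_univ_castSucc, Fin.castSucc_zero]
    rw [toChainMap_zero, ← Fin.succ_last, toChainMap_succ]
    simp only [map_sub, map_add, LinearMap.sub_apply, hB.self_eq_zero, Fin.succ_castSucc]
    ring

/-- `toChain` is a chain map. -/
theorem differential_toChain (hB : B.IsAlt) (hgB : ∀ u v, B (g u) (g v) = B u v) (q : ℕ)
    (f : Big κ (q + 1)) :
    differential B g y q (toChain B g lam e e' y (q + 1) f) =
      toChain B g lam e e' y q (bigDiff e e' q f) := by
  have h (i : Fin q) := toChain_pull_succ lam e e' y hB q i f (g := g)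
  rw [bigDiff_apply, Fin.sum_univ_succ, Fin.sum_univ_castSucc, map_add, map_add, map_sum]
  simp only [map_smul, Fin.val_zero, pow_zero, one_smul, Fin.val_succ, Fin.val_castSucc,
    Fin.val_last, Fin.succ_castSucc, ← h]
  rw [← toChain_pull_zero lam e e' y hB hgB, Fin.succ_last, ← toChain_pull_last lam e e' y hB,
    ← add_assoc]
  simp [differential, LinearMap.sum_apply]

end Homogeneous

/-! ### Eliminating a regular element from a complex -/

section Elimination

variable {K : Type*} [Field K] {C : ℕ → Type*} [∀ q, AddCommGroup (C q)] [∀ q, Module K (C q)]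
  {κ : Type*}

/-- The cycles of degree `q` of the complex `C` modulo the subspaces `I`. -/
def relCycles (b : ∀ q, C (q + 1) →ₗ[K] C q) (I : ∀ q, Submodule K (C q)) :
    ∀ q, Submodule K (C q)
  | 0 => ⊤
  | q + 1 => (I q).comap (b q)

theorem relCycles_mono (b : ∀ q, C (q + 1) →ₗ[K] C q) {I J : ∀ q, Submodule K (C q)}
    (h : ∀ q, I q ≤ J q) : ∀ q, relCycles b I q ≤ relCycles b J q
  | 0 => le_rfl
  | q + 1 => Submodule.comap_mono (h q)

/-- The homology of the complex `C / I` is concentrated in degree `d`, where it is identified with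
`P` by `lam`, which sends an element of `P` to a cycle that represents it. For `a ∈ R`, the action
of the operator `Z a` on the homology is `t a`. -/
structure IsConcentrated (b : ∀ q, C (q + 1) →ₗ[K] C q) (I : ∀ q, Submodule K (C q))
    (Z : κ → ∀ q, C q →ₗ[K] C q) (R : Set κ) {P : Type*} [AddCommGroup P] [Module K P]
    (t : κ → P →ₗ[K] P) (d : ℕ) (lam : P →ₗ[K] C d) : Prop where
  mem : ∀ p, lam p ∈ relCycles b I d
  inj : ∀ p e, lam p - b d e ∈ I d → p = 0
  surj : ∀ c ∈ relCycles b I d, ∃ p e, c - lam p - b d e ∈ I d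
  exact : ∀ q, q ≠ d → ∀ c ∈ relCycles b I q, ∃ e, c - b q e ∈ I q
  equivariant : ∀ a ∈ R, ∀ p, ∃ e, Z a d (lam p) - lam (t a p) - b d e ∈ I d

variable {b : ∀ q, C (q + 1) →ₗ[K] C q} {I J : ∀ q, Submodule K (C q)}
  {Z : κ → ∀ q, C q →ₗ[K] C q} {R R' : Set κ} {P P' : Type*} [AddCommGroup P] [Module K P]
  [AddCommGroup P'] [Module K P'] {t : κ → P →ₗ[K] P} {t' : κ → P' →ₗ[K] P'} {d : ℕ}
  {lam : P →ₗ[K] C d}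

theorem mem_relCycles_of_regular (hZb : ∀ a q f, b q (Z a (q + 1) f) = Z a q (b q f))
    {a : κ} (hreg : ∀ q f, Z a q f ∈ I q → f ∈ I q) :
    ∀ {q : ℕ} {f : C q}, Z a q f ∈ relCycles b I q → f ∈ relCycles b I q
  | 0, _, _ => trivial
  | q + 1, f, h => hreg q _ (by
      have h' : b q (Z a (q + 1) f) ∈ I q := h
      rwa [hZb] at h')

theorem boundary_mem_relCycles (hbb : ∀ q f, b q (b (q + 1) f) = 0) :
    ∀ {q : ℕ} (e : C (q + 1)), b q e ∈ relCycles b I q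
  | 0, _ => trivial
  | q + 1, e => by
      change b q (b (q + 1) e) ∈ I q
      rw [hbb]
      exact zero_mem _

theorem le_relCycles (hbI : ∀ q, ∀ f ∈ I (q + 1), b q f ∈ I q) : ∀ q, I q ≤ relCycles b I q
  | 0 => le_top
  | q + 1 => hbI q

/-- A cycle modulo `J = I + Z_a C` is a cycle modulo `I` up to an element of `J`, provided that the
cycles `e` modulo `I` of one degree less for which `Z_a e` is a boundary are boundaries. -/
theorem exists_sub_mem_relCycles (hbb : ∀ q f, b q (b (q + 1) f) = 0)
    (hbI : ∀ q, ∀ f ∈ I (q + 1), b q f ∈ I q)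
    (hZb : ∀ a q f, b q (Z a (q + 1) f) = Z a q (b q f))
    (hZI : ∀ a q, ∀ f ∈ I q, Z a q f ∈ I q)
    {a : κ} (hreg : ∀ q f, Z a q f ∈ I q → f ∈ I q)
    (hJ : ∀ q f, f ∈ J q ↔ ∃ e, f - Z a q e ∈ I q) :
    ∀ (q : ℕ) (_ : ∀ k, q = k + 1 → ∀ e ∈ relCycles b I k, (∃ c, b k c - Z a k e ∈ I k) →
      ∃ e', e - b k e' ∈ I k) {c : C q} (_ : c ∈ relCycles b J q),
      ∃ f, c - Z a q f ∈ relCycles b I q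
  | 0, _, _, _ => ⟨0, trivial⟩
  | q + 1, hk, c, hc => by
      obtain ⟨e, he⟩ := (hJ q _).mp hc
      have h1 : e ∈ relCycles b I q := by
        refine mem_relCycles_of_regular hZb hreg ?_
        have h2 := sub_mem (boundary_mem_relCycles hbb c (I := I)) (le_relCycles hbI q he)
        rwa [sub_sub_cancel] at h2
      obtain ⟨e', he'⟩ := hk q rfl e h1 ⟨c, he⟩
      refine ⟨e', ?_⟩
      change b q (c - Z a (q + 1) e') ∈ I q
      rw [map_sub, hZb]
      have h3 := add_mem he (hZI a q _ he')
      rw [map_sub] at h3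
      convert h3 using 1
      abel

/-- Elimination of `Z_a` when it acts injectively on the homology: the homology becomes the
cokernel, which is represented by a complement `P'` of the image. -/
theorem IsConcentrated.step_injective (h : IsConcentrated b I Z R t d lam)
    (hbb : ∀ q f, b q (b (q + 1) f) = 0)
    (hbI : ∀ q, ∀ f ∈ I (q + 1), b q f ∈ I q)
    (hZb : ∀ a q f, b q (Z a (q + 1) f) = Z a q (b q f))
    (hZI : ∀ a q, ∀ f ∈ I q, Z a q f ∈ I q)
    {a : κ} (ha : a ∈ R) (hR : R' ⊆ R) (hreg : ∀ q f, Z a q f ∈ I q → f ∈ I q)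
    (hJ : ∀ q f, f ∈ J q ↔ ∃ e, f - Z a q e ∈ I q)
    (j : P' →ₗ[K] P) (hjt : ∀ a ∈ R', ∀ p, j (t' a p) = t a (j p))
    (hinj : ∀ p, t a p = 0 → p = 0) (hdisj : ∀ p p', j p' = t a p → p' = 0)
    (hspan : ∀ p, ∃ p' p'', p = j p' + t a p'') :
    IsConcentrated b J Z R' t' d (lam ∘ₗ j) := by
  have hIJ : ∀ q, I q ≤ J q := fun q f hf => (hJ q f).mpr ⟨0, by simpa using hf⟩
  have hZJ : ∀ q f, Z a q f ∈ J q := fun q f => (hJ q _).mpr ⟨f, by simp⟩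
  have key : ∀ (q k : ℕ), q = k + 1 → ∀ e ∈ relCycles b I k,
      (∃ c, b k c - Z a k e ∈ I k) → ∃ e', e - b k e' ∈ I k := by
    rintro q k - e he ⟨c, hc⟩
    by_cases hkd : k = d
    · subst hkd
      obtain ⟨p, e₁, h1⟩ := h.surj e he
      obtain ⟨e₂, h2⟩ := h.equivariant a ha p
      have h3 : t a p = 0 := by
        refine h.inj _ (c - Z a (k + 1) e₁ - e₂) ?_
        have h4 := sub_mem (sub_mem (neg_mem hc) (hZI a k _ h1)) h2
        convert h4 using 1
        simp only [map_sub, hZb]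
        abel
      have h5 := hinj p h3
      rw [h5, map_zero, sub_zero] at h1
      exact ⟨e₁, h1⟩
    · exact h.exact k hkd e he
  have lemA := fun q => @exists_sub_mem_relCycles K _ C _ _ κ b I J Z hbb hbI hZb hZI a hreg hJ q
    (key q)
  refine ⟨fun p => relCycles_mono b hIJ _ (h.mem _), ?_, ?_, ?_, ?_⟩
  · intro p' e he
    obtain ⟨f, hf⟩ := (hJ d _).mp he
    have h1 : f ∈ relCycles b I d := by
      refine mem_relCycles_of_regular hZb hreg ?_
      have h2 := sub_mem (sub_mem (h.mem (j p')) (boundary_mem_relCycles hbb e (I := I)))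
        (le_relCycles hbI d hf)
      convert h2 using 1
      simp
    obtain ⟨p, e₁, h3⟩ := h.surj f h1
    obtain ⟨e₂, h4⟩ := h.equivariant a ha p
    have h5 : j p' - t a p = 0 := by
      refine h.inj _ (e + Z a (d + 1) e₁ + e₂) ?_
      have h6 := add_mem (add_mem hf (hZI a d _ h3)) h4
      convert h6 using 1
      simp only [map_sub, map_add, hZb, LinearMap.comp_apply]
      abel
    exact hdisj p p' (sub_eq_zero.mp h5)
  · intro c hc
    obtain ⟨f, hf⟩ := lemA d hc
    obtain ⟨p, e, he⟩ := h.surj _ hf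
    obtain ⟨p', p'', hp⟩ := hspan p
    obtain ⟨e₂, h4⟩ := h.equivariant a ha p''
    refine ⟨p', e - e₂, ?_⟩
    have h6 := add_mem (sub_mem (hIJ d he) (hIJ d h4)) (add_mem (hZJ d f) (hZJ d (lam p'')))
    convert h6 using 1
    simp only [hp, map_sub, map_add, LinearMap.comp_apply]
    abel
  · intro q hq c hc
    obtain ⟨f, hf⟩ := lemA q hc
    obtain ⟨e, he⟩ := h.exact q hq _ hf
    refine ⟨e, ?_⟩
    have h6 := add_mem (hIJ q he) (hZJ q f)
    convert h6 using 1
    abel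
  · intro a' ha' p
    obtain ⟨e, he⟩ := h.equivariant a' (hR ha') (j p)
    refine ⟨e, hIJ d ?_⟩
    rw [LinearMap.comp_apply, LinearMap.comp_apply, hjt a' ha']
    exact he

/-- Elimination of `Z_a` when it acts surjectively on the homology: the homology becomes the kernel
`P'`, in the next degree. -/
theorem IsConcentrated.step_surjective (h : IsConcentrated b I Z R t d lam)
    (hbb : ∀ q f, b q (b (q + 1) f) = 0)
    (hbI : ∀ q, ∀ f ∈ I (q + 1), b q f ∈ I q)
    (hZb : ∀ a q f, b q (Z a (q + 1) f) = Z a q (b q f))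
    (hZI : ∀ a q, ∀ f ∈ I q, Z a q f ∈ I q)
    (hZZ : ∀ a a' q f, Z a q (Z a' q f) = Z a' q (Z a q f))
    {a : κ} (ha : a ∈ R) (hR : R' ⊆ R) (hreg : ∀ q f, Z a q f ∈ I q → f ∈ I q)
    (hJ : ∀ q f, f ∈ J q ↔ ∃ e, f - Z a q e ∈ I q)
    (j : P' →ₗ[K] P) (hjt : ∀ a ∈ R', ∀ p, j (t' a p) = t a (j p))
    (hj : ∀ p', j p' = 0 → p' = 0) (hker : ∀ p, t a p = 0 ↔ ∃ p', j p' = p)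
    (hsurj : ∀ p, ∃ p', t a p' = p) :
    ∃ lam' : P' →ₗ[K] C (d + 1), IsConcentrated b J Z R' t' (d + 1) lam' := by
  have hIJ : ∀ q, I q ≤ J q := fun q f hf => (hJ q f).mpr ⟨0, by simpa using hf⟩
  have hZJ : ∀ q f, Z a q f ∈ J q := fun q f => (hJ q _).mpr ⟨f, by simp⟩
  obtain ⟨lam', hlam'⟩ : ∃ lam' : P' →ₗ[K] C (d + 1),
      ∀ p, Z a d (lam (j p)) - b d (lam' p) ∈ I d := by
    set φ : C (d + 1) →ₗ[K] C d ⧸ I d := (I d).mkQ ∘ₗ b d with hφ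
    set ψ : P' →ₗ[K] C d ⧸ I d := (I d).mkQ ∘ₗ Z a d ∘ₗ lam ∘ₗ j with hψ
    have hψφ : ∀ p, ψ p ∈ LinearMap.range φ := by
      intro p
      obtain ⟨e, he⟩ := h.equivariant a ha (j p)
      rw [(hker (j p)).mpr ⟨p, rfl⟩, map_zero, sub_zero] at he
      exact ⟨e, ((Submodule.Quotient.eq _).mpr he).symm⟩
    obtain ⟨s, hs⟩ := φ.rangeRestrict.exists_rightInverse_of_surjective φ.range_rangeRestrict
    refine ⟨s ∘ₗ ψ.codRestrict _ hψφ, fun p => (Submodule.Quotient.eq _).mp ?_⟩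
    have h1 := congrArg Subtype.val (LinearMap.congr_fun hs (ψ.codRestrict _ hψφ p))
    exact h1.symm
  -- A cycle `e` with `Z_a e` a boundary is represented by an element of `P'`.
  have key : ∀ e ∈ relCycles b I d, (∃ c, b d c - Z a d e ∈ I d) →
      ∃ p' e', e - lam (j p') - b d e' ∈ I d := by
    rintro e he ⟨c, hc⟩
    obtain ⟨p, e₁, h1⟩ := h.surj e he
    obtain ⟨e₂, h2⟩ := h.equivariant a ha p
    have h3 : t a p = 0 := by
      refine h.inj _ (c - Z a (d + 1) e₁ - e₂) ?_
      have h4 := sub_mem (sub_mem (neg_mem hc) (hZI a d _ h1)) h2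
      convert h4 using 1
      simp only [map_sub, hZb]
      abel
    obtain ⟨p', hp'⟩ := (hker p).mp h3
    exact ⟨p', e₁, by rwa [hp']⟩
  have lemA : ∀ q, q ≠ d + 1 → ∀ c ∈ relCycles b J q, ∃ f, c - Z a q f ∈ relCycles b I q := by
    intro q hq c hc
    refine exists_sub_mem_relCycles hbb hbI hZb hZI hreg hJ q ?_ hc
    rintro k hk e he -
    exact h.exact k (fun hkd => hq (by rw [hk, hkd])) e he
  refine ⟨lam', ⟨?_, ?_, ?_, ?_, ?_⟩⟩
  · intro p
    change b d (lam' p) ∈ J d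
    have h1 := sub_mem (hZJ d (lam (j p))) (hIJ d (hlam' p))
    rwa [sub_sub_cancel] at h1
  · intro p e he
    obtain ⟨f, hf⟩ := (hJ _ _).mp he
    refine hj p (h.inj _ f (hreg d _ ?_))
    have h1 := add_mem (hbI d _ hf) (hlam' p)
    convert h1 using 1
    simp only [map_sub, hbb, hZb]
    abel
  · intro c hc
    obtain ⟨e, he⟩ := (hJ d _).mp hc
    have h1 : e ∈ relCycles b I d := by
      refine mem_relCycles_of_regular hZb hreg ?_
      have h2 := sub_mem (boundary_mem_relCycles hbb c (I := I)) (le_relCycles hbI d he)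
      rwa [sub_sub_cancel] at h2
    obtain ⟨p', f, hf⟩ := key e h1 ⟨c, he⟩
    have h2 : c - lam' p' - Z a (d + 1) f ∈ relCycles b I (d + 1) := by
      change b d _ ∈ I d
      have h3 := add_mem (add_mem he (hZI a d _ hf)) (hlam' p')
      convert h3 using 1
      simp only [map_sub, hZb]
      abel
    obtain ⟨e', he'⟩ := h.exact (d + 1) (by omega) _ h2
    refine ⟨p', e', ?_⟩
    have h3 := add_mem (hIJ _ he') (hZJ _ f)
    convert h3 using 1
    abel
  · intro q hq c hc
    obtain ⟨f, hf⟩ := lemA q hq c hc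
    by_cases hqd : q = d
    · subst hqd
      obtain ⟨p, e, he⟩ := h.surj _ hf
      obtain ⟨p'', hp''⟩ := hsurj p
      obtain ⟨e₂, h4⟩ := h.equivariant a ha p''
      refine ⟨e - e₂, ?_⟩
      have h6 := add_mem (sub_mem (hIJ q he) (hIJ q h4)) (add_mem (hZJ q f) (hZJ q (lam p'')))
      convert h6 using 1
      rw [hp'']
      simp only [map_sub]
      abel
    · obtain ⟨e, he⟩ := h.exact q hqd _ hf
      refine ⟨e, ?_⟩
      have h6 := add_mem (hIJ q he) (hZJ q f)
      convert h6 using 1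
      abel
  · intro a' ha' p
    obtain ⟨f, hf⟩ := h.equivariant a' (hR ha') (j p)
    have h2 : Z a' (d + 1) (lam' p) - lam' (t' a' p) - Z a (d + 1) f ∈ relCycles b I (d + 1) := by
      change b d _ ∈ I d
      have h3 := add_mem (sub_mem (hlam' (t' a' p)) (hZI a' d _ (hlam' p))) (hZI a d _ hf)
      convert h3 using 1
      simp only [map_sub, hZb, hjt a' ha', hZZ a' a]
      abel
    obtain ⟨e', he'⟩ := h.exact (d + 1) (by omega) _ h2
    refine ⟨e', ?_⟩
    have h3 := add_mem (hIJ _ he') (hZJ _ f)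
    convert h3 using 1
    abel

end Elimination

/-! ### Subspaces defined by vanishing coefficients -/

section Vanish

variable {α : Type*}

/-- The series all of whose coefficients at exponents in `S` vanish. -/
def vanish (S : Set (α →₀ ℕ)) : Submodule (LaurentSeries ℂ) (Laurent (MvPowerSeries α ℂ)) :=
  LinearMap.ker (Laurent.map (LinearMap.pi fun n : S => coeff (R := ℂ) n.1))

theorem mem_vanish {S : Set (α →₀ ℕ)} {f : Laurent (MvPowerSeries α ℂ)} :
    f ∈ vanish S ↔ ∀ k, ∀ n ∈ S, coeff n (f.coeff k) = 0 := by
  constructor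
  · intro h k n hn
    have h1 := congrArg (fun g => Laurent.coeff g k) (LinearMap.mem_ker.mp h)
    exact congrFun h1 ⟨n, hn⟩
  · intro h
    exact Laurent.ext_coeff fun k => funext fun n => h k n.1 n.2

theorem vanish_anti {S T : Set (α →₀ ℕ)} (h : S ⊆ T) : vanish T ≤ vanish S :=
  fun _ hf => mem_vanish.mpr fun k n hn => mem_vanish.mp hf k n (h hn)

theorem coeff_X_mul_eq (a : α) (f : MvPowerSeries α ℂ) (n : α →₀ ℕ) :
    coeff (n + Finsupp.single a 1) (X a * f) = coeff n f := by
  rw [X, add_comm, coeff_add_monomial_mul, one_mul]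

theorem coeff_X_mul_of_eq_zero {a : α} (f : MvPowerSeries α ℂ) {n : α →₀ ℕ} (hn : n a = 0) :
    coeff n (X a * f) = 0 := by
  classical
  rw [X, coeff_monomial_mul, if_neg]
  intro h
  have := h a
  simp [hn] at this

theorem eq_add_single {a : α} {n : α →₀ ℕ} (hn : n a ≠ 0) :
    n = (n - Finsupp.single a 1) + Finsupp.single a 1 := by
  refine (tsub_add_cancel_of_le ?_).symm
  rw [Finsupp.single_le_iff]
  omega

/-- Division by the variable `X a`, ignoring the terms which do not contain it. -/
def divX (a : α) : MvPowerSeries α ℂ →ₗ[ℂ] MvPowerSeries α ℂ :=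
  LinearMap.pi fun n => coeff (n + Finsupp.single a 1)

theorem coeff_divX (a : α) (f : MvPowerSeries α ℂ) (n : α →₀ ℕ) :
    coeff n (divX a f) = coeff (n + Finsupp.single a 1) f := rfl

/-- The antiderivative in the variable `X a` without terms of degree `0` in it. -/
def intX (a : α) : MvPowerSeries α ℂ →ₗ[ℂ] MvPowerSeries α ℂ :=
  LinearMap.pi fun n => if n a = 0 then 0 else
    (n a : ℂ)⁻¹ • coeff (n - Finsupp.single a 1)

theorem coeff_intX (a : α) (f : MvPowerSeries α ℂ) (n : α →₀ ℕ) :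
    coeff n (intX a f) =
      if n a = 0 then 0 else (n a : ℂ)⁻¹ * coeff (n - Finsupp.single a 1) f := by
  change (if n a = 0 then 0 else (n a : ℂ)⁻¹ • coeff (n - Finsupp.single a 1) :
    MvPowerSeries α ℂ →ₗ[ℂ] ℂ) f = _
  split_ifs <;> rfl

theorem pderiv_intX (a : α) (f : MvPowerSeries α ℂ) : pderiv ℂ a (intX a f) = f := by
  ext n
  rw [coeff_pderiv, coeff_intX, if_neg (by simp), add_tsub_cancel_right, Finsupp.add_apply,
    Finsupp.single_eq_same]
  have : ((n a : ℂ) + 1) ≠ 0 := by exact_mod_cast (n a).succ_ne_zero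
  push_cast
  field_simp

/-- Multiplication by the variable `X a`. -/
def mulX (a : α) : Laurent (MvPowerSeries α ℂ) →ₗ[LaurentSeries ℂ] Laurent (MvPowerSeries α ℂ) :=
  Laurent.map (LinearMap.mulLeft ℂ (X a))

theorem coeff_mulX (a : α) (f : Laurent (MvPowerSeries α ℂ)) (k : ℤ) :
    (mulX a f).coeff k = X a * f.coeff k := rfl

theorem mulX_comm (a b : α) (f : Laurent (MvPowerSeries α ℂ)) :
    mulX a (mulX b f) = mulX b (mulX a f) :=
  Laurent.ext_coeff fun k => by
    simp only [coeff_mulX]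
    ring

theorem mem_vanish_of_mulX {S : Set (α →₀ ℕ)} {a : α}
    (hS : ∀ n ∈ S, n + Finsupp.single a 1 ∈ S) {f : Laurent (MvPowerSeries α ℂ)}
    (hf : mulX a f ∈ vanish S) : f ∈ vanish S := by
  rw [mem_vanish] at hf ⊢
  intro k n hn
  rw [← coeff_X_mul_eq a]
  exact hf k _ (hS n hn)

theorem mulX_mem_vanish {S : Set (α →₀ ℕ)} {a : α}
    (hS : ∀ n, n + Finsupp.single a 1 ∈ S → n ∈ S) {f : Laurent (MvPowerSeries α ℂ)}
    (hf : f ∈ vanish S) : mulX a f ∈ vanish S := by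
  rw [mem_vanish] at hf ⊢
  intro k n hn
  rw [coeff_mulX]
  by_cases h0 : n a = 0
  · exact coeff_X_mul_of_eq_zero _ h0
  · rw [eq_add_single h0] at hn ⊢
    rw [coeff_X_mul_eq]
    exact hf k _ (hS _ hn)

theorem sub_mulX_divX_mem_vanish {S T : Set (α →₀ ℕ)} {a : α}
    (hT : ∀ n ∈ T, n a = 0 → n ∈ S) {f : Laurent (MvPowerSeries α ℂ)} (hf : f ∈ vanish S) :
    f - mulX a (Laurent.map (divX a) f) ∈ vanish T := by
  rw [mem_vanish] at hf ⊢
  intro k n hn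
  rw [Laurent.coeff_sub, coeff_mulX, Laurent.coeff_map, map_sub]
  by_cases h0 : n a = 0
  · rw [coeff_X_mul_of_eq_zero _ h0, sub_zero]
    exact hf k n (hT n hn h0)
  · rw [eq_add_single h0, coeff_X_mul_eq, coeff_divX, sub_self]

/-- Membership in the subspace which also ignores the terms divisible by `X a`. -/
theorem mem_vanish_iff_exists {S T : Set (α →₀ ℕ)} {a : α}
    (hS : ∀ n, n ∈ S ↔ n ∈ T ∧ n a = 0) (f : Laurent (MvPowerSeries α ℂ)) :
    f ∈ vanish S ↔ ∃ e, f - mulX a e ∈ vanish T := by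
  constructor
  · exact fun hf => ⟨_, sub_mulX_divX_mem_vanish (fun n hn h0 => (hS n).mpr ⟨hn, h0⟩) hf⟩
  · rintro ⟨e, he⟩
    rw [mem_vanish] at he ⊢
    intro k n hn
    have h1 := he k n ((hS n).mp hn).1
    rwa [Laurent.coeff_sub, coeff_mulX, map_sub, coeff_X_mul_of_eq_zero _ ((hS n).mp hn).2,
      sub_zero] at h1

theorem eq_embDomain_inr {β : Type*} {n : α ⊕ β →₀ ℕ} (hn : ∀ a, n (Sum.inl a) = 0) :
    n = (n.comapDomain Sum.inr (Sum.inr_injective.injOn)).embDomain Function.Embedding.inr := by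
  ext s
  rcases s with a | b
  · rw [Finsupp.embDomain_of_notMem_range _ _ _ (by simp)]
    exact hn a
  · exact (Finsupp.embDomain_apply_self (Function.Embedding.inr : β ↪ α ⊕ β)
      (n.comapDomain Sum.inr (Sum.inr_injective.injOn)) b).symm

end Vanish

/-! ### Straightening the operators `Z_a` -/

section GaussEquiv

variable {α β : Type*} [Fintype α] [Fintype β] {E E' : Type*} [AddCommGroup E]
  [AddCommGroup E'] [Module ℂ E] [Module ℂ E']

theorem exists_gauss_inverse (e : Module.Basis α ℂ E) (e' : Module.Basis β ℂ E') {L : E →ₗ[ℂ] E'}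
    (hL : Function.Bijective L) (Q : E →ₗ[ℂ] E →ₗ[ℂ] ℂ) :
    ∃ (L' : E' →ₗ[ℂ] E) (Q' : E' →ₗ[ℂ] E' →ₗ[ℂ] ℂ), (∀ v, L (L' v) = v) ∧
      (∀ f, gauss e' e L' Q' (gauss e e' L Q f) = f) ∧
      ∀ f, gauss e e' L Q (gauss e' e L' Q' f) = f := by
  set M := LinearEquiv.ofBijective L hL with hM
  have h1 : ∀ v, M.symm (L v) = v := fun v => M.symm_apply_apply v
  have h2 : ∀ v, L (M.symm v) = v := fun v => M.apply_symm_apply v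
  set Q' : E' →ₗ[ℂ] E' →ₗ[ℂ] ℂ := -Q.compl₁₂ M.symm.toLinearMap M.symm.toLinearMap with hQ'
  refine ⟨M.symm.toLinearMap, Q', h2, fun f => ?_, fun f => ?_⟩
  · rw [gauss_gauss]
    exact gauss_id e (fun v => h1 v) (fun v => by simp [hQ', h1]) f
  · rw [gauss_gauss]
    exact gauss_id e' (fun v => h2 v) (fun v => by simp [hQ']) f

theorem gauss_bijective (e : Module.Basis α ℂ E) (e' : Module.Basis β ℂ E') {L : E →ₗ[ℂ] E'}
    (hL : Function.Bijective L) (Q : E →ₗ[ℂ] E →ₗ[ℂ] ℂ) : Function.Bijective (gauss e e' L Q) := by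
  obtain ⟨L', Q', -, h1, h2⟩ := exists_gauss_inverse e e' hL Q
  exact Function.bijective_iff_has_inverse.mpr ⟨gauss e' e L' Q', h1, h2⟩

theorem heis_basis_zero (e : Module.Basis α ℂ E) (a : α) (f : Laurent (MvPowerSeries α ℂ)) :
    heis e (e a) 0 f = mulX a f := by
  rw [heis_apply, dirDeriv_zero, lin_basis]
  exact add_eq_left.mpr (smul_zero _)

/-- Setting a group of variables equal to zero. -/
theorem coeff_gauss_snd (e : Module.Basis α ℂ E) (e' : Module.Basis β ℂ E')
    (f : Laurent (MvPowerSeries (α ⊕ β) ℂ)) (k : ℤ) (n : β →₀ ℕ) :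
    coeff n ((gauss (e.prod e') e' (LinearMap.snd ℂ E E') 0 f).coeff k) =
      coeff (n.embDomain Function.Embedding.inr) (f.coeff k) := by
  classical
  set D := gauss (e.prod e') e' (LinearMap.snd ℂ E E') 0 with hD
  set inc := gauss e' (e.prod e') (LinearMap.inr ℂ E E') 0 with hinc
  have hinc' : ∀ f, inc f = Laurent.map
      (rename (R := ℂ) (Sum.inr : β → α ⊕ β)).toLinearMap f := by
    exact fun f => (map_rename_eq_gauss _ _ Sum.inr (fun b => by simp) f).symm
  have hDX : ∀ a f, D (mulX (Sum.inl a) f) = 0 := by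
    intro a f
    have h1 : (e.prod e') (Sum.inl a) = (e a, 0) := by simp
    have h2 := gauss_heis (e.prod e') e' (L := LinearMap.snd ℂ E E') (Q := 0)
      (w := (e.prod e') (Sum.inl a)) (l := 0) (w' := 0) (l' := 0) (by rw [h1]; rfl)
      (fun v => by simp) f
    rw [← heis_basis_zero (e.prod e'), hD, h2, heis_apply, map_zero, dirDeriv_zero]
    exact Laurent.ext_coeff fun k => by
      rw [Laurent.coeff_add, Laurent.coeff_hbar_smul]
      simp
  have hDN : ∀ (S : Finset α) (f : Laurent (MvPowerSeries (α ⊕ β) ℂ)),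
      f ∈ vanish {n | ∀ a ∈ S, n (Sum.inl a) = 0} → D f = 0 := by
    intro S
    induction S using Finset.induction_on with
    | empty =>
      intro f hf
      have : f = 0 := Laurent.ext_coeff fun k => MvPowerSeries.ext fun n => by
        rw [mem_vanish.mp hf k n (by simp)]
        simp
      rw [this, map_zero]
    | insert a S _ ih =>
      intro f hf
      obtain ⟨g, hg⟩ := (mem_vanish_iff_exists (a := Sum.inl a)
        (T := {n | ∀ a ∈ S, n (Sum.inl a) = 0}) (fun n => by simp [and_comm]) f).mp hf
      have h1 := ih _ hg
      rwa [map_sub, hDX, sub_zero] at h1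
  set f₀ : Laurent (MvPowerSeries β ℂ) :=
    Laurent.map (killCompl (R := ℂ) (Function.Embedding.inr : β ↪ α ⊕ β)).toLinearMap f with hf₀
  have h1 : f - inc f₀ ∈ vanish {n : α ⊕ β →₀ ℕ | ∀ a ∈ Finset.univ, n (Sum.inl a) = 0} := by
    refine mem_vanish.mpr fun k n hn => ?_
    rw [hinc', Laurent.coeff_sub, map_sub, eq_embDomain_inr fun a => hn a (Finset.mem_univ a)]
    rw [Laurent.coeff_map, hf₀, Laurent.coeff_map]
    have h2 := coeff_embDomain_rename (R := ℂ) (Function.Embedding.inr : β ↪ α ⊕ β)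
      (killCompl (R := ℂ) Function.Embedding.inr (f.coeff k))
      (n.comapDomain Sum.inr (Sum.inr_injective.injOn))
    rw [sub_eq_zero]
    refine Eq.trans ?_ h2.symm
    rw [coeff_killCompl]
  have h2 := hDN _ _ h1
  have h3 : D (inc f₀) = f₀ := by
    rw [hD, hinc, gauss_gauss]
    exact gauss_id e' (fun v => rfl) (fun v => by simp) f₀
  rw [map_sub, h3, sub_eq_zero] at h2
  rw [h2, hf₀, Laurent.coeff_map]
  exact coeff_killCompl _ _

theorem gauss_snd_surjective (e : Module.Basis α ℂ E) (e' : Module.Basis β ℂ E') :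
    Function.Surjective (gauss (e.prod e') e' (LinearMap.snd ℂ E E') 0) := by
  intro f
  refine ⟨gauss e' (e.prod e') (LinearMap.inr ℂ E E') 0 f, ?_⟩
  rw [gauss_gauss]
  exact gauss_id e' (fun v => rfl) (fun v => by simp) f

end GaussEquiv

/-- Coordinates adapted to the decomposition of `V` into the fixed subspace of `g` and its
complement: the projection onto the fixed subspace, a basis `e` whose part indexed by `φ` spans
the fixed subspace and whose part indexed by `ν` spans the complement, and a second basis `e'`
which has the same part indexed by `ν`, and whose part indexed by `φ` is dual to that of `e` with
respect to `B`. -/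
structure Frame {V : Type*} [AddCommGroup V] [Module ℂ V] (B : V →ₗ[ℂ] V →ₗ[ℂ] ℂ) (g : V ≃ₗ[ℂ] V)
    (ν φ : Type*) where
  /-- The projection onto the fixed subspace which commutes with `g`. -/
  proj : V →ₗ[ℂ] V
  /-- The basis for the variables `u_i`. -/
  e : Module.Basis (ν ⊕ φ) ℂ V
  /-- The basis for the variables `x`. -/
  e' : Module.Basis (ν ⊕ φ) ℂ V
  map_proj : ∀ v, g (proj v) = proj v
  proj_map : ∀ v, proj (g v) = proj v
  proj_eq : ∀ v, g v = v → proj v = v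
  proj_inl : ∀ i, proj (e (Sum.inl i)) = 0
  map_inr : ∀ i, g (e (Sum.inr i)) = e (Sum.inr i)
  e'_inl : ∀ i, e' (Sum.inl i) = e (Sum.inl i)
  coord_inr : ∀ i v, e'.coord (Sum.inr i) v = B (e (Sum.inr i)) v

namespace Frame

variable {V : Type*} [AddCommGroup V] [Module ℂ V] {B : V →ₗ[ℂ] V →ₗ[ℂ] ℂ} {g : V ≃ₗ[ℂ] V}
  {ν φ ι : Type*} [Fintype ν] [Fintype φ] [Fintype ι] (F : Frame B g ν φ)
  (y : Module.Basis ι ℂ V)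

/-- The automorphism `1 - g + p` of `V`. -/
def lam : V →ₗ[ℂ] V := LinearMap.id - g.toLinearMap + F.proj

theorem lam_apply (v : V) : F.lam v = v - g v + F.proj v := rfl

theorem lam_injective : Function.Injective F.lam := by
  refine (injective_iff_map_eq_zero _).mpr fun v hv => ?_
  rw [lam_apply] at hv
  have h1 := congrArg F.proj hv
  rw [map_add, map_sub, F.proj_map, sub_self, zero_add, map_zero,
    F.proj_eq _ (F.map_proj v)] at h1
  rw [h1, add_zero, sub_eq_zero] at hv
  rw [← F.proj_eq v hv.symm, h1]

theorem lam_surjective : Function.Surjective F.lam := by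
  have : FiniteDimensional ℂ V := Module.Basis.finiteDimensional_of_finite F.e
  exact LinearMap.injective_iff_surjective.mp F.lam_injective

/-- The decomposition of `V` is orthogonal. -/
theorem apply_proj_eq_zero (hgB : ∀ u v, B (g u) (g v) = B u v) {v : V} (hv : F.proj v = 0)
    (w : V) : B v (F.proj w) = 0 := by
  obtain ⟨u, rfl⟩ := F.lam_surjective v
  rw [lam_apply, map_add, map_sub, F.proj_map, sub_self, zero_add, F.proj_eq _ (F.map_proj u)] at hv
  rw [lam_apply, hv, add_zero, map_sub, LinearMap.sub_apply, sub_eq_zero]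
  conv_rhs => rw [← F.map_proj w, hgB]

/-- The shift of the variable `x` in the translation symmetry of homogeneous chains along `e_a`. -/
def shift : ν ⊕ φ → V := Sum.elim (fun i => F.e (Sum.inl i)) 0

/-- The derivative part of the translation symmetry of homogeneous chains along `e_a`. -/
def phase : ν ⊕ φ → V →ₗ[ℂ] ℂ := Sum.elim 0 fun j => F.e'.coord (Sum.inr j)

theorem lam_shift (a : ν ⊕ φ) : F.lam (F.shift a) = F.e a - g (F.e a) := by
  rw [lam_apply]
  rcases a with i | j
  · simp [shift, F.proj_inl]
  · simp [shift, F.map_inr]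

/-- The operator `Z_a = ∑ s, u_s^a + t_a` on homogeneous chains, where `t_a` is multiplication by
`x^a` for `a ∈ ν` and `ħ ∂/∂x^a` for `a ∈ φ`. -/
def Z (a : ν ⊕ φ) (q : ℕ) : Big (ν ⊕ φ) q →ₗ[LaurentSeries ℂ] Big (ν ⊕ φ) q :=
  heis (bigBasis F.e F.e' q) (fun _ => F.e a, F.shift a) (F.phase a ∘ₗ LinearMap.snd ℂ _ _)

/-- The differential of the homogeneous complex. -/
def diff (q : ℕ) : Big (ν ⊕ φ) (q + 1) →ₗ[LaurentSeries ℂ] Big (ν ⊕ φ) q := bigDiff F.e F.e' q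

theorem diff_diff (q : ℕ) (f : Big (ν ⊕ φ) (q + 2)) : F.diff q (F.diff (q + 1) f) = 0 :=
  bigDiff_bigDiff F.e F.e' q f

theorem pull_Z {p q : ℕ} (θ : Fin (p + 1) → Fin (q + 1)) (a : ν ⊕ φ) (f : Big (ν ⊕ φ) q) :
    pull F.e F.e' θ (F.Z a q f) = F.Z a p (pull F.e F.e' θ f) :=
  gauss_heis _ _ rfl (fun v => by simp [pullMap_apply]) f

theorem diff_Z (a : ν ⊕ φ) (q : ℕ) (f : Big (ν ⊕ φ) (q + 1)) :
    F.diff q (F.Z a (q + 1) f) = F.Z a q (F.diff q f) := by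
  unfold diff
  rw [bigDiff_apply, bigDiff_apply, map_sum]
  exact Finset.sum_congr rfl fun i _ => by rw [pull_Z, map_smul]

/-- The basis for the coordinates in which the `Z_a` are multiplications by variables. -/
def straightBasis (q : ℕ) :
    Module.Basis ((ν ⊕ φ) ⊕ (Fin (q + 1) × ι)) ℂ (V × (Fin (q + 1) → V)) :=
  F.e.prod (slotBasis y (Fin (q + 1)))

/-- The linear part of the straightening map, which keeps `u_0` next to the image in Hochschild
chains. -/
def straightMap (q : ℕ) : ((Fin (q + 1) → V) × V) →ₗ[ℂ] (V × (Fin (q + 1) → V)) :=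
  (LinearMap.proj 0 ∘ₗ LinearMap.fst ℂ (Fin (q + 1) → V) V).prod (toChainMap g F.lam q)

theorem straightMap_apply (q : ℕ) (v : (Fin (q + 1) → V) × V) :
    F.straightMap q v = (v.1 0, toChainMap g F.lam q v) := rfl

theorem straightMap_injective (q : ℕ) : Function.Injective (F.straightMap q) := by
  refine (injective_iff_map_eq_zero _).mpr fun v hv => ?_
  rw [straightMap_apply, Prod.mk_eq_zero] at hv
  have h1 : ∀ i, v.1 i = 0 := by
    intro i
    induction i using Fin.induction with
    | zero => exact hv.1
    | succ i ih =>
      have h2 := congrFun hv.2 i.succ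
      rw [toChainMap_succ, ih, sub_zero] at h2
      exact h2
  have h2 := congrFun hv.2 0
  rw [toChainMap_zero, h1, h1, map_zero, add_zero, sub_zero] at h2
  exact Prod.ext (funext h1) ((injective_iff_map_eq_zero _).mp F.lam_injective _ h2)

theorem straightMap_bijective (q : ℕ) : Function.Bijective (F.straightMap q) := by
  have : FiniteDimensional ℂ V := Module.Basis.finiteDimensional_of_finite F.e
  refine ⟨F.straightMap_injective q, ?_⟩
  refine (LinearMap.injective_iff_surjective_of_finrank_eq_finrank ?_).mp
    (F.straightMap_injective q)
  rw [Module.finrank_prod, Module.finrank_prod, add_comm]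

/-- The straightening isomorphism, which turns the `Z_a` into multiplications by variables. -/
def straight (q : ℕ) : Big (ν ⊕ φ) q →ₗ[LaurentSeries ℂ]
    Laurent (MvPowerSeries ((ν ⊕ φ) ⊕ (Fin (q + 1) × ι)) ℂ) :=
  gauss (bigBasis F.e F.e' q) (F.straightBasis y q) (F.straightMap q) (toChainForm B g F.lam q)

theorem straight_bijective (q : ℕ) : Function.Bijective (F.straight y q) :=
  gauss_bijective _ _ (F.straightMap_bijective q) _

theorem toChain_eq_gauss_straight (q : ℕ) (f : Big (ν ⊕ φ) q) :
    toChain B g F.lam F.e F.e' y q f =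
      gauss (F.straightBasis y q) (slotBasis y (Fin (q + 1))) (LinearMap.snd ℂ V _) 0
        (F.straight y q f) := by
  unfold straight toChain
  rw [gauss_gauss]
  exact LinearMap.congr_fun (gauss_congr _ _ (fun v => rfl) fun v => by simp) f

theorem coeff_toChain (q : ℕ) (f : Big (ν ⊕ φ) q) (k : ℤ) (n : Fin (q + 1) × ι →₀ ℕ) :
    coeff n ((toChain B g F.lam F.e F.e' y q f).coeff k) =
      coeff (n.embDomain Function.Embedding.inr) ((F.straight y q f).coeff k) := by
  rw [toChain_eq_gauss_straight]
  exact coeff_gauss_snd _ _ _ _ _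

theorem toChain_surjective (q : ℕ) : Function.Surjective (toChain B g F.lam F.e F.e' y q) := by
  intro f
  obtain ⟨f₁, h₁⟩ := gauss_snd_surjective F.e (slotBasis y (Fin (q + 1))) f
  obtain ⟨f₂, h₂⟩ := (F.straight_bijective y q).surjective f₁
  refine ⟨f₂, ?_⟩
  rw [toChain_eq_gauss_straight, h₂]
  exact h₁

/-- The phase of `straight` is such that it turns `Z_a` into the multiplication by a variable. -/
theorem straight_Z (hB : B.IsAlt) (hgB : ∀ u v, B (g u) (g v) = B u v) (a : ν ⊕ φ) (q : ℕ)
    (f : Big (ν ⊕ φ) q) :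
    F.straight y q (F.Z a q f) = mulX (Sum.inl a) (F.straight y q f) := by
  have hw : F.straightMap q (fun _ => F.e a, F.shift a) = F.straightBasis y q (Sum.inl a) := by
    have h1 : F.straightBasis y q (Sum.inl a) = (F.e a, 0) := by simp [straightBasis]
    rw [h1, straightMap_apply]
    refine Prod.ext rfl (funext fun r => ?_)
    refine Fin.cases ?_ (fun i => ?_) r
    · change toChainMap g F.lam q (fun _ => F.e a, F.shift a) 0 = 0
      rw [toChainMap_zero, lam_shift]
      simp
    · change toChainMap g F.lam q (fun _ => F.e a, F.shift a) i.succ = 0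
      rw [toChainMap_succ]
      simp
  rw [← heis_basis_zero (F.straightBasis y q)]
  refine gauss_heis _ _ hw (fun v => ?_) f
  have hanti : ∀ u v, B u v = -B v u := fun u v => (hB.neg v u).symm
  -- The terms along the path `u_0, …, u_q` telescope.
  have hpath : ∑ i : Fin q, B (F.e a) (v.1 i.succ) + ∑ i : Fin q, B (v.1 i.castSucc) (F.e a) =
      B (F.e a) (v.1 (Fin.last q)) - B (F.e a) (v.1 0) := by
    have h1 := (Fin.sum_univ_succ fun i => B (F.e a) (v.1 i)).symm.trans
      (Fin.sum_univ_castSucc fun i => B (F.e a) (v.1 i))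
    have h2 : ∑ i : Fin q, B (v.1 i.castSucc) (F.e a) =
        -∑ i : Fin q, B (F.e a) (v.1 i.castSucc) := by
      rw [← Finset.sum_neg_distrib]
      exact Finset.sum_congr rfl fun i _ => hanti _ _
    rw [h2]
    linear_combination h1
  have hphase : F.phase a v.2 = B (F.e a - F.shift a) v.2 := by
    rcases a with i | j
    · simp [phase, shift]
    · simp [phase, shift, F.coord_inr]
  have hfix : ∀ u w, B (F.proj u) (g w) = B (F.proj u) w := fun u w => by
    conv_lhs => rw [← F.map_proj, hgB]
  have hproj : F.proj (F.e a) = F.e a - F.shift a := by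
    rcases a with i | j
    · simp [shift, F.proj_inl]
    · simp [shift, F.proj_eq _ (F.map_inr j)]
  have hps : F.proj (F.shift a) = 0 := by
    rcases a with i | j
    · simp [shift, F.proj_inl]
    · simp [shift]
  have hs : g (F.shift a) = F.shift a - F.e a + g (F.e a) := by
    have h := F.lam_shift a
    rw [lam_apply, hps, add_zero] at h
    rw [sub_add, ← h, sub_sub_cancel]
  have h1 := hfix (F.e a) v.2
  have h2 := hfix v.2 (F.e a)
  have h3 := F.apply_proj_eq_zero hgB hps v.2
  have h5 := hanti (F.proj v.2) (F.e a)
  have h6 := hanti v.2 (F.shift a)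
  have h7 := hanti (v.1 (Fin.last q)) (F.e a)
  rw [toChainForm_apply, toChainForm_apply, F.lam_shift, hs, lam_apply, LinearMap.comp_apply,
    LinearMap.snd_apply, hphase, LinearMap.zero_apply]
  rw [hproj] at h1
  simp only [map_sub, map_add, LinearMap.sub_apply, LinearMap.add_apply, hgB] at h1 ⊢
  have h8 : B (F.e a) (F.proj v.2) = B (F.e a) v.2 - B (F.shift a) v.2 := by
    have h9 := F.apply_proj_eq_zero hgB (v := v.2 - F.proj v.2)
      (by rw [map_sub, F.proj_eq _ (F.map_proj v.2), sub_self]) (F.e a)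
    rw [hanti, hproj] at h9
    simp only [map_sub, LinearMap.sub_apply] at h9
    linear_combination h3 + h9
  linear_combination (-1/2 : ℂ) * hpath + (1/2 : ℂ) * h1 + (1/2 : ℂ) * h2 + (1/2 : ℂ) * h5 -
    (1/2 : ℂ) * h6 - (1/2 : ℂ) * h7 - h8

end Frame

theorem dirDeriv_coord {α : Type*} [Fintype α] {E : Type*} [AddCommGroup E] [Module ℂ E]
    (e : Module.Basis α ℂ E) (a : α) (f : MvPowerSeries α ℂ) :
    dirDeriv e (e.coord a) f = pderiv ℂ a f := by
  classical
  rw [dirDeriv_apply, Finset.sum_eq_single a]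
  · rw [e.coord_apply, e.repr_self, Finsupp.single_eq_same, one_smul]
  · intro b _ hb
    rw [e.coord_apply, e.repr_self, Finsupp.single_eq_of_ne hb.symm, zero_smul]
  · simp

theorem neg_one_pow_succ_smul {K M : Type*} [CommRing K] [AddCommGroup M] [Module K M] (n : ℕ)
    (x : M) : (-1 : K) ^ (n + 1) • x = -((-1 : K) ^ n • x) := by
  rw [pow_succ, mul_neg_one, neg_smul]

namespace Laurent

variable {A : Type*} [AddCommGroup A] [Module ℂ A]

theorem coeff_smul_const (r : LaurentSeries ℂ) (a : A) (k : ℤ) :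
    (r • const a).coeff k = r.coeff k • a := by
  have h0 : HahnSeries.support (Γ := ℤ) (R := A) (const a) ⊆ {0} := HahnSeries.support_single_subset
  rw [coeff_smul r (const a) (Set.isPWO_singleton 0) h0]
  have h1 : ∀ x ∈ Finset.VAddAntidiagonal k (Set.VAddAntidiagonal.finite_of_isPWO
      r.isPWO_support (Set.isPWO_singleton (0 : ℤ)) k), x = (k, 0) := by
    rintro ⟨i, j⟩ hx
    rw [Finset.mem_vaddAntidiagonal] at hx
    obtain ⟨-, h2, h3⟩ := hx
    have h2' : j = 0 := h2
    have h3' : i + j = k := h3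
    rw [h2', add_zero] at h3'
    rw [h2', h3']
  rw [Finset.sum_eq_single (k, (0 : ℤ)) (fun x hx hne => absurd (h1 x hx) hne)]
  · rw [coeff_const, if_pos rfl]
  · intro hx
    rw [Finset.mem_vaddAntidiagonal] at hx
    have : r.coeff k = 0 := by
      by_contra h
      exact hx ⟨h, rfl, add_zero k⟩
    rw [this, zero_smul]

end Laurent

namespace Frame

variable {V : Type*} [AddCommGroup V] [Module ℂ V] {B : V →ₗ[ℂ] V →ₗ[ℂ] ℂ} {g : V ≃ₗ[ℂ] V}
  {ν φ ι : Type*} [Fintype ν] [Fintype φ] [Fintype ι] [DecidableEq ν] [DecidableEq φ]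
  (F : Frame B g ν φ) (y : Module.Basis ι ℂ V)

/-! ### Subspaces of the homogeneous complex -/

/-- The sum of the images of the operators `Z_a`, `a ∈ S`, and of the chains which in the straight
coordinates have no terms with an exponent in `T`. -/
def rel (T : ∀ q, Set ((ν ⊕ φ) ⊕ (Fin (q + 1) × ι) →₀ ℕ)) (S : Finset (ν ⊕ φ)) (q : ℕ) :
    Submodule (LaurentSeries ℂ) (Big (ν ⊕ φ) q) :=
  (vanish {n | n ∈ T q ∧ ∀ a ∈ S, n (Sum.inl a) = 0}).comap (F.straight y q)

variable {y} {T : ∀ q, Set ((ν ⊕ φ) ⊕ (Fin (q + 1) × ι) →₀ ℕ)}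

variable (hB : B.IsAlt) (hgB : ∀ u v, B (g u) (g v) = B u v)
  (hT : ∀ q n a, n + Finsupp.single (Sum.inl a) 1 ∈ T q ↔ n ∈ T q)

include hB hgB in
theorem Z_Z (a a' : ν ⊕ φ) (q : ℕ) (f : Big (ν ⊕ φ) q) :
    F.Z a q (F.Z a' q f) = F.Z a' q (F.Z a q f) := by
  refine (F.straight_bijective F.e q).injective ?_
  rw [F.straight_Z F.e hB hgB, F.straight_Z F.e hB hgB, F.straight_Z F.e hB hgB,
    F.straight_Z F.e hB hgB, mulX_comm]

include hB hgB hT in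
/-- `Z_a` is injective modulo the images of the other `Z_b`. -/
theorem rel_regular {S : Finset (ν ⊕ φ)} {a : ν ⊕ φ} (ha : a ∉ S) (q : ℕ) (f : Big (ν ⊕ φ) q)
    (hf : F.Z a q f ∈ F.rel y T S q) : f ∈ F.rel y T S q := by
  unfold rel at hf ⊢
  rw [Submodule.mem_comap, F.straight_Z y hB hgB] at hf
  refine mem_vanish_of_mulX (S := {n | n ∈ T q ∧ ∀ a ∈ S, n (Sum.inl a) = 0})
    (fun n hn => ⟨(hT q n a).mpr hn.1, fun b hb => ?_⟩) hf
  have hab : (Sum.inl b : (ν ⊕ φ) ⊕ (Fin (q + 1) × ι)) ≠ Sum.inl a := fun h =>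
    ha (Sum.inl_injective h ▸ hb)
  rw [Finsupp.add_apply, hn.2 b hb, Finsupp.single_eq_of_ne hab, add_zero]

include hB hgB hT in
theorem Z_mem_rel (S : Finset (ν ⊕ φ)) (a : ν ⊕ φ) (q : ℕ) (f : Big (ν ⊕ φ) q)
    (hf : f ∈ F.rel y T S q) : F.Z a q f ∈ F.rel y T S q := by
  unfold rel at hf ⊢
  rw [Submodule.mem_comap, F.straight_Z y hB hgB]
  refine mulX_mem_vanish (S := {n | n ∈ T q ∧ ∀ a ∈ S, n (Sum.inl a) = 0})
    (fun n hn => ⟨(hT q n a).mp hn.1, fun b hb => ?_⟩) hf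
  have h := hn.2 b hb
  rw [Finsupp.add_apply] at h
  omega

include hB hgB in
theorem mem_rel_insert (S : Finset (ν ⊕ φ)) (a : ν ⊕ φ) (q : ℕ) (f : Big (ν ⊕ φ) q) :
    f ∈ F.rel y T (insert a S) q ↔ ∃ e, f - F.Z a q e ∈ F.rel y T S q := by
  unfold rel
  rw [Submodule.mem_comap, mem_vanish_iff_exists (a := Sum.inl a)
    (T := {n | n ∈ T q ∧ ∀ a ∈ S, n (Sum.inl a) = 0})
    (fun n => by simp only [Finset.forall_mem_insert, Set.mem_ofPred_eq]; tauto)]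
  constructor
  · rintro ⟨e, he⟩
    obtain ⟨e, rfl⟩ := (F.straight_bijective y q).surjective e
    exact ⟨e, by rwa [Submodule.mem_comap, map_sub, F.straight_Z y hB hgB]⟩
  · rintro ⟨e, he⟩
    exact ⟨_, by rwa [Submodule.mem_comap, map_sub, F.straight_Z y hB hgB] at he⟩

include hB hgB in
theorem diff_mem_rel (hb : ∀ q, ∀ f ∈ F.rel y T ∅ (q + 1), F.diff q f ∈ F.rel y T ∅ q)
    (S : Finset (ν ⊕ φ)) : ∀ q, ∀ f ∈ F.rel y T S (q + 1), F.diff q f ∈ F.rel y T S q := by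
  induction S using Finset.induction_on with
  | empty => exact hb
  | insert a S _ ih =>
    intro q f hf
    obtain ⟨e, he⟩ := (F.mem_rel_insert hB hgB S a (q + 1) f).mp hf
    refine (F.mem_rel_insert hB hgB S a q _).mpr ⟨F.diff q e, ?_⟩
    rw [← diff_Z, ← map_sub]
    exact ih q _ he

variable (y) in
theorem rel_univ_empty (q : ℕ) : F.rel y (fun _ => Set.univ) ∅ q = ⊥ := by
  refine (Submodule.eq_bot_iff _).mpr fun f hf => ?_
  refine (injective_iff_map_eq_zero _).mp (F.straight_bijective y q).injective f ?_
  refine Laurent.ext_coeff fun k => MvPowerSeries.ext fun n => ?_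
  exact mem_vanish.mp hf k n ⟨trivial, by simp⟩

variable (y) in
theorem diff_mem_rel_univ (hB : B.IsAlt) (hgB : ∀ u v, B (g u) (g v) = B u v) (S : Finset (ν ⊕ φ)) :
    ∀ q, ∀ f ∈ F.rel y (fun _ => Set.univ) S (q + 1),
      F.diff q f ∈ F.rel y (fun _ => Set.univ) S q := by
  refine F.diff_mem_rel hB hgB (fun q f hf => ?_) S
  rw [rel_univ_empty, Submodule.mem_bot] at hf ⊢
  rw [hf, map_zero]

variable (y) in
/-- The kernel of `toChain` is spanned by the images of all `Z_a`. -/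
theorem toChain_eq_zero_iff (q : ℕ) (f : Big (ν ⊕ φ) q) :
    toChain B g F.lam F.e F.e' y q f = 0 ↔
      f ∈ F.rel y (fun _ => Set.univ) Finset.univ q := by
  constructor
  · intro h
    refine mem_vanish.mpr fun k n hn => ?_
    rw [eq_embDomain_inr fun a => hn.2 a (Finset.mem_univ a), ← F.coeff_toChain, h]
    exact map_zero _
  · intro h
    refine Laurent.ext_coeff fun k => MvPowerSeries.ext fun n => ?_
    rw [F.coeff_toChain]
    refine (mem_vanish.mp h k _ ⟨trivial, fun a _ => ?_⟩).trans (map_zero _).symm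
    exact Finsupp.embDomain_of_notMem_range _ _ _ (by simp)

/-! ### The homology of the homogeneous complex -/

/-- The action of `Z_a` on the homology of the homogeneous complex. -/
def trans (a : ν ⊕ φ) :
    Laurent (MvPowerSeries (ν ⊕ φ) ℂ) →ₗ[LaurentSeries ℂ] Laurent (MvPowerSeries (ν ⊕ φ) ℂ) :=
  heis F.e' (F.shift a) (F.phase a)

theorem trans_inl (i : ν) (f : Laurent (MvPowerSeries (ν ⊕ φ) ℂ)) :
    F.trans (Sum.inl i) f = mulX (Sum.inl i) f := by
  have h : F.trans (Sum.inl i) = heis F.e' (F.e' (Sum.inl i)) 0 := by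
    unfold trans shift phase
    rw [F.e'_inl]
    rfl
  rw [h, heis_basis_zero]

theorem trans_inr (j : φ) (f : Laurent (MvPowerSeries (ν ⊕ φ) ℂ)) :
    F.trans (Sum.inr j) f =
      Laurent.hbar • Laurent.map (pderiv ℂ (Sum.inr j)).toLinearMap f := by
  have h : F.trans (Sum.inr j) = heis F.e' 0 (F.e'.coord (Sum.inr j)) := rfl
  rw [h, heis_apply]
  refine Laurent.ext_coeff fun k => ?_
  rw [Laurent.coeff_add, Laurent.coeff_hbar_smul, Laurent.coeff_hbar_smul]
  simp [dirDeriv_coord]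

/-- The homogeneous chains of degree `0` which do not depend on `u_0`. -/
def inclX : Laurent (MvPowerSeries (ν ⊕ φ) ℂ) →ₗ[LaurentSeries ℂ] Big (ν ⊕ φ) 0 :=
  gauss F.e' (bigBasis F.e F.e' 0) (LinearMap.inr ℂ _ _) 0

/-- Setting all `u_i` equal to zero. -/
def evalX (q : ℕ) : Big (ν ⊕ φ) q →ₗ[LaurentSeries ℂ] Laurent (MvPowerSeries (ν ⊕ φ) ℂ) :=
  gauss (bigBasis F.e F.e' q) F.e' (LinearMap.snd ℂ _ _) 0

/-- `(u, x) ↦ ((0, u), x)`. -/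
def coneMap (V : Type*) [AddCommGroup V] [Module ℂ V] (q : ℕ) :
    ((Fin (q + 1) → V) × V) →ₗ[ℂ] ((Fin (q + 2) → V) × V) :=
  LinearMap.prodMap
    (LinearMap.pi (Fin.cons 0 fun i => LinearMap.proj i)) LinearMap.id

theorem coneMap_apply (q : ℕ) (v : (Fin (q + 1) → V) × V) :
    coneMap V q v = (Fin.cons 0 v.1, v.2) := by
  refine Prod.ext (funext fun i => ?_) rfl
  refine Fin.cases ?_ (fun i => ?_) i <;> simp [coneMap]

/-- The contracting homotopy, which inserts `u_0 = 0`. -/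
def cone (q : ℕ) : Big (ν ⊕ φ) q →ₗ[LaurentSeries ℂ] Big (ν ⊕ φ) (q + 1) :=
  gauss (bigBasis F.e F.e' q) (bigBasis F.e F.e' (q + 1)) (coneMap V q) 0

theorem evalX_inclX (f : Laurent (MvPowerSeries (ν ⊕ φ) ℂ)) : F.evalX 0 (F.inclX f) = f := by
  unfold evalX inclX
  rw [gauss_gauss]
  exact gauss_id _ (fun v => rfl) (fun v => by simp) f

theorem evalX_pull {p q : ℕ} (θ : Fin (p + 1) → Fin (q + 1)) (f : Big (ν ⊕ φ) q) :
    F.evalX p (pull F.e F.e' θ f) = F.evalX q f := by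
  unfold evalX pull
  rw [gauss_gauss]
  exact LinearMap.congr_fun (gauss_congr _ _ (fun v => rfl) fun v => by simp) f

theorem pull_zero_cone (q : ℕ) (f : Big (ν ⊕ φ) q) :
    pull F.e F.e' (Fin.succAbove 0) (F.cone q f) = f := by
  unfold cone pull
  rw [gauss_gauss]
  refine gauss_id _ (fun v => ?_) (fun v => by simp) f
  rw [LinearMap.comp_apply, coneMap_apply, pullMap_apply]
  exact Prod.ext (funext fun i => by simp) rfl

theorem pull_succ_cone (q : ℕ) (i : Fin (q + 2)) (f : Big (ν ⊕ φ) (q + 1)) :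
    pull F.e F.e' (Fin.succAbove i.succ) (F.cone (q + 1) f) =
      F.cone q (pull F.e F.e' i.succAbove f) := by
  unfold cone pull
  rw [gauss_gauss, gauss_gauss]
  refine LinearMap.congr_fun (gauss_congr _ _ (fun v => ?_) fun v => by simp) f
  rw [LinearMap.comp_apply, LinearMap.comp_apply, coneMap_apply, coneMap_apply, pullMap_apply,
    pullMap_apply]
  refine Prod.ext (funext fun j => ?_) rfl
  refine Fin.cases ?_ (fun j => ?_) j <;> simp

theorem pull_one_cone (f : Big (ν ⊕ φ) 0) :
    pull F.e F.e' (Fin.succAbove 1) (F.cone 0 f) = F.inclX (F.evalX 0 f) := by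
  unfold cone pull inclX evalX
  rw [gauss_gauss, gauss_gauss]
  refine LinearMap.congr_fun (gauss_congr _ _ (fun v => ?_) fun v => by simp) f
  rw [LinearMap.comp_apply, LinearMap.comp_apply, coneMap_apply, pullMap_apply]
  refine Prod.ext (funext fun j => ?_) rfl
  rw [Fin.eq_zero j]
  rfl

theorem diff_cone_zero (f : Big (ν ⊕ φ) 0) :
    F.diff 0 (F.cone 0 f) = f - F.inclX (F.evalX 0 f) := by
  unfold diff
  rw [bigDiff_apply, Fin.sum_univ_two, pull_zero_cone, pull_one_cone]
  simp [sub_eq_add_neg]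

theorem diff_cone_succ (q : ℕ) (f : Big (ν ⊕ φ) (q + 1)) :
    F.diff (q + 1) (F.cone (q + 1) f) = f - F.cone q (F.diff q f) := by
  unfold diff
  rw [bigDiff_apply, bigDiff_apply, Fin.sum_univ_succ, pull_zero_cone, map_sum,
    sub_eq_add_neg, ← Finset.sum_neg_distrib]
  congr 1
  · simp
  · refine Finset.sum_congr rfl fun i _ => ?_
    rw [pull_succ_cone, map_smul, Fin.val_succ, neg_one_pow_succ_smul]

theorem evalX_diff (f : Big (ν ⊕ φ) 1) : F.evalX 0 (F.diff 0 f) = 0 := by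
  unfold diff
  rw [bigDiff_apply, Fin.sum_univ_two, map_add, map_smul, map_smul, evalX_pull, evalX_pull]
  simp

theorem evalX_Z (a : ν ⊕ φ) (q : ℕ) (f : Big (ν ⊕ φ) q) :
    F.evalX q (F.Z a q f) = F.trans a (F.evalX q f) :=
  gauss_heis _ _ rfl (fun v => by simp) f

/-- The homology of the homogeneous complex is the space of series in `x`, in degree `0`. -/
theorem isConcentrated_bot : IsConcentrated (C := Big (ν ⊕ φ)) F.diff (fun _ => ⊥) F.Z Set.univ
    F.trans 0 F.inclX where
  mem _ := trivial
  inj p e h := by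
    rw [Submodule.mem_bot] at h
    have h1 := congrArg (F.evalX 0) h
    rwa [map_sub, evalX_diff, evalX_inclX, sub_zero, map_zero] at h1
  surj c _ := ⟨F.evalX 0 c, F.cone 0 c, by
    rw [diff_cone_zero, sub_self]
    exact zero_mem _⟩
  exact := by
    rintro (_ | q) hq c hc
    · exact absurd rfl hq
    · refine ⟨F.cone (q + 1) c, ?_⟩
      have hc' : F.diff q c = 0 := hc
      rw [diff_cone_succ, hc', map_zero, sub_zero, sub_self]
      exact zero_mem _
  equivariant a _ p := by
    refine ⟨F.cone 0 (F.Z a 0 (F.inclX p)), ?_⟩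
    rw [diff_cone_zero, evalX_Z, evalX_inclX, sub_self]
    exact zero_mem _

end Frame

namespace Frame

variable {V : Type*} [AddCommGroup V] [Module ℂ V] {B : V →ₗ[ℂ] V →ₗ[ℂ] ℂ} {g : V ≃ₗ[ℂ] V}
  {ν φ ι : Type*} [Fintype ν] [Fintype φ] [Fintype ι] [DecidableEq ν] [DecidableEq φ]
  (F : Frame B g ν φ) (y : Module.Basis ι ℂ V)

/-- The series which do not contain the variables in `S`. -/
def free (S : Finset (ν ⊕ φ)) :
    Submodule (LaurentSeries ℂ) (Laurent (MvPowerSeries (ν ⊕ φ) ℂ)) :=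
  vanish {n | ∃ a ∈ S, n a ≠ 0}

theorem free_anti {S S' : Finset (ν ⊕ φ)} (h : S ⊆ S') : free S' ≤ free S :=
  vanish_anti fun _ ⟨a, ha, hn⟩ => ⟨a, h ha, hn⟩

theorem trans_mem_free {S : Finset (ν ⊕ φ)} {a : ν ⊕ φ} (ha : a ∉ S)
    {f : Laurent (MvPowerSeries (ν ⊕ φ) ℂ)} (hf : f ∈ free S) : F.trans a f ∈ free S := by
  have hne : ∀ b ∈ S, b ≠ a := fun b hb h => ha (h ▸ hb)
  rcases a with i | j
  · rw [trans_inl]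
    refine mulX_mem_vanish (S := {n | ∃ a ∈ S, n a ≠ 0}) ?_ hf
    rintro n ⟨b, hb, hn⟩
    rw [Finsupp.add_apply, Finsupp.single_eq_of_ne (hne b hb), add_zero] at hn
    exact ⟨b, hb, hn⟩
  · rw [trans_inr]
    refine Submodule.smul_mem _ _ (mem_vanish.mpr fun k n hn => ?_)
    obtain ⟨b, hb, hn⟩ := hn
    rw [Laurent.coeff_map]
    refine (coeff_pderiv _ _).trans ?_
    rw [mem_vanish.mp hf k _ ⟨b, hb, ?_⟩, zero_mul]
    rw [Finsupp.add_apply]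
    omega

/-- The action of `Z_a`, `a ∉ S`, on the homology of the quotient of the homogeneous complex by the
images of the `Z_b`, `b ∈ S`. -/
def transOn (S : Finset (ν ⊕ φ)) (a : ν ⊕ φ) : free S →ₗ[LaurentSeries ℂ] free S :=
  if ha : a ∉ S then (F.trans a).restrict fun _ hf => F.trans_mem_free ha hf else 0

theorem transOn_apply {S : Finset (ν ⊕ φ)} {a : ν ⊕ φ} (ha : a ∉ S) (f : free S) :
    (F.transOn S a f : Laurent (MvPowerSeries (ν ⊕ φ) ℂ)) = F.trans a f := by
  rw [transOn, dif_pos ha]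
  rfl

/-- The homology of the homogeneous complex modulo the images of the operators `Z_a`, `a ∈ S`, is
the space of series in the variables `x^a`, `a ∉ S`, in a degree which grows by one with every
`a ∈ φ`: multiplication by `x^a` is injective and its cokernel consists of the series without `x^a`,
while `ħ ∂/∂x^a` is surjective and its kernel consists of the series without `x^a`. -/
theorem exists_isConcentrated (hB : B.IsAlt) (hgB : ∀ u v, B (g u) (g v) = B u v)
    (S : Finset (ν ⊕ φ)) :
    ∃ (d : ℕ) (_ : d = S.toRight.card) (lam : free S →ₗ[LaurentSeries ℂ] Big (ν ⊕ φ) d),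
      IsConcentrated (K := LaurentSeries ℂ) (C := Big (ν ⊕ φ)) (P := free S) F.diff
        (F.rel y (fun _ => Set.univ) S) F.Z {a | a ∉ S} (F.transOn S) d lam := by
  induction S using Finset.induction_on with
  | empty =>
    refine ⟨0, rfl, F.inclX ∘ₗ (free ∅).subtype, ?_⟩
    have h := F.isConcentrated_bot
    have h0 : F.rel y (fun _ => Set.univ) ∅ = fun _ => ⊥ := funext (F.rel_univ_empty y)
    have hfree : ∀ f, f ∈ free (∅ : Finset (ν ⊕ φ)) := fun f =>
      mem_vanish.mpr fun k n hn => by simp at hn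
    rw [h0]
    refine ⟨fun p => trivial, fun p e he => ?_, fun c hc => ?_, h.exact, fun a ha p => ?_⟩
    · exact Subtype.ext (h.inj p e he)
    · obtain ⟨p, e, he⟩ := h.surj c hc
      exact ⟨⟨p, hfree p⟩, e, he⟩
    · obtain ⟨e, he⟩ := h.equivariant a trivial p
      refine ⟨e, ?_⟩
      rw [LinearMap.comp_apply, LinearMap.comp_apply, Submodule.subtype_apply,
        Submodule.subtype_apply, F.transOn_apply ha]
      exact he
  | insert a S ha ih =>
    obtain ⟨d, hd, lam, h⟩ := ih
    have hT : ∀ (q : ℕ) (n : (ν ⊕ φ) ⊕ (Fin (q + 1) × ι) →₀ ℕ) (a : ν ⊕ φ),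
        n + Finsupp.single (Sum.inl a) 1 ∈ (Set.univ : Set ((ν ⊕ φ) ⊕ (Fin (q + 1) × ι) →₀ ℕ)) ↔
          n ∈ Set.univ := fun _ _ _ => Iff.rfl
    have hR : {b | b ∉ insert a S} ⊆ {b | b ∉ S} := fun b hb h => hb (Finset.mem_insert_of_mem h)
    have hle : free (insert a S) ≤ free S := free_anti (Finset.subset_insert a S)
    have hjt : ∀ b ∈ {b | b ∉ insert a S}, ∀ p, Submodule.inclusion hle
        (F.transOn (insert a S) b p) = F.transOn S b (Submodule.inclusion hle p) := by
      intro b hb p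
      refine Subtype.ext ?_
      rw [F.transOn_apply (hR hb), Submodule.coe_inclusion, F.transOn_apply hb,
        Submodule.coe_inclusion]
    have hmem : ∀ {f : Laurent (MvPowerSeries (ν ⊕ φ) ℂ)}, f ∈ free S →
        (∀ k n, n a ≠ 0 → coeff n (f.coeff k) = 0) → f ∈ free (insert a S) := by
      intro f hf h
      refine mem_vanish.mpr fun k n hn => ?_
      obtain ⟨b, hb, hn⟩ := hn
      obtain rfl | hb := Finset.mem_insert.mp hb
      · exact h k n hn
      · exact mem_vanish.mp hf k n ⟨b, hb, hn⟩
    have hneS : ∀ b ∈ S, b ≠ a := fun b hb h => ha (h ▸ hb)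
    rcases a with i | j
    · refine ⟨d, ?_, _, h.step_injective F.diff_diff (F.diff_mem_rel_univ y hB hgB S) F.diff_Z
        (F.Z_mem_rel hB hgB hT S) ha hR (F.rel_regular hB hgB hT ha)
        (F.mem_rel_insert hB hgB S _) (Submodule.inclusion hle) hjt ?_ ?_ ?_⟩
      · rw [hd]
        congr 1
        ext; simp
      · intro p hp
        have hp' := congrArg Subtype.val hp
        rw [F.transOn_apply ha, trans_inl] at hp'
        refine Subtype.ext (Laurent.ext_coeff fun k => MvPowerSeries.ext fun n => ?_)
        rw [← coeff_X_mul_eq (Sum.inl i), ← coeff_mulX, hp']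
        simp
      · intro p p' hp
        have hp' := congrArg Subtype.val hp
        rw [F.transOn_apply ha, trans_inl, Submodule.coe_inclusion] at hp'
        refine Subtype.ext (Laurent.ext_coeff fun k => MvPowerSeries.ext fun n => ?_)
        by_cases h0 : n (Sum.inl i) = 0
        · rw [hp', coeff_mulX, coeff_X_mul_of_eq_zero _ h0]
          simp
        · rw [mem_vanish.mp p'.2 k n ⟨_, Finset.mem_insert_self _ _, h0⟩]
          simp
      · intro p
        have h1 : Laurent.map (divX (Sum.inl i)) (p : Laurent (MvPowerSeries (ν ⊕ φ) ℂ)) ∈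
            free S := by
          refine mem_vanish.mpr fun k n hn => ?_
          obtain ⟨b, hb, hn⟩ := hn
          rw [Laurent.coeff_map, coeff_divX]
          refine mem_vanish.mp p.2 k _ ⟨b, hb, ?_⟩
          rw [Finsupp.add_apply]
          omega
        have h2 : (p : Laurent (MvPowerSeries (ν ⊕ φ) ℂ)) -
            mulX (Sum.inl i) (Laurent.map (divX (Sum.inl i)) p.1) ∈
              free (insert (Sum.inl i) S) := by
          refine hmem (sub_mem p.2 ?_) ?_
          · rw [← trans_inl F]
            exact F.trans_mem_free ha h1
          · intro k n hn
            rw [Laurent.coeff_sub, map_sub, coeff_mulX, Laurent.coeff_map, eq_add_single hn,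
              coeff_X_mul_eq, coeff_divX, sub_self]
        refine ⟨⟨_, h2⟩, ⟨_, h1⟩, Subtype.ext ?_⟩
        rw [Submodule.coe_add, Submodule.coe_inclusion, F.transOn_apply ha, trans_inl]
        simp
    · have hker : ∀ p, F.transOn S (Sum.inr j) p = 0 ↔ ∃ p', Submodule.inclusion hle p' = p := by
        intro p
        constructor
        · intro hp
          have hp' := congrArg Subtype.val hp
          rw [F.transOn_apply ha, trans_inr] at hp'
          have hp'' := (smul_eq_zero.mp hp').resolve_left Laurent.hbar_ne_zero
          refine ⟨⟨p, hmem p.2 fun k n hn => ?_⟩, rfl⟩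
          have h2 := congrArg (fun f => coeff (n - Finsupp.single (Sum.inr j) 1) f)
            (congrArg (fun f => Laurent.coeff f k) hp'')
          simp only [Laurent.coeff_map, Laurent.coeff_zero, map_zero] at h2
          have h3 := (coeff_pderiv _ _).symm.trans h2
          rw [← eq_add_single hn] at h3
          exact (mul_eq_zero.mp h3).resolve_right (Nat.cast_add_one_ne_zero _)
        · rintro ⟨p', rfl⟩
          refine Subtype.ext ?_
          rw [F.transOn_apply ha, trans_inr, Submodule.coe_inclusion]
          refine Eq.trans ?_ (smul_zero Laurent.hbar)
          congr 1
          refine Laurent.ext_coeff fun k => MvPowerSeries.ext fun n => ?_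
          rw [Laurent.coeff_map]
          refine (coeff_pderiv _ _).trans ?_
          rw [mem_vanish.mp p'.2 k _ ⟨_, Finset.mem_insert_self _ _, by simp⟩, zero_mul]
          simp
      have hsurj : ∀ p, ∃ p', F.transOn S (Sum.inr j) p' = p := by
        intro p
        have h1 : Laurent.map (intX (Sum.inr j)) (p : Laurent (MvPowerSeries (ν ⊕ φ) ℂ)) ∈
            free S := by
          refine mem_vanish.mpr fun k n hn => ?_
          obtain ⟨b, hb, hn⟩ := hn
          rw [Laurent.coeff_map, coeff_intX]
          split_ifs
          · rfl
          · refine mul_eq_zero_of_right _ (mem_vanish.mp p.2 k _ ⟨b, hb, ?_⟩)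
            rw [Finsupp.tsub_apply, Finsupp.single_eq_of_ne (hneS b hb), tsub_zero]
            exact hn
        refine ⟨⟨_, Submodule.smul_mem _ Laurent.hbar⁻¹ h1⟩, Subtype.ext ?_⟩
        rw [F.transOn_apply ha, trans_inr, map_smul, smul_inv_smul₀ Laurent.hbar_ne_zero]
        refine Laurent.ext_coeff fun k => ?_
        exact pderiv_intX _ _
      obtain ⟨lam', h'⟩ := h.step_surjective F.diff_diff (F.diff_mem_rel_univ y hB hgB S) F.diff_Z
        (F.Z_mem_rel hB hgB hT S) (F.Z_Z hB hgB) ha hR (F.rel_regular hB hgB hT ha)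
        (F.mem_rel_insert hB hgB S _) (Submodule.inclusion hle) hjt
        (fun p hp => Submodule.inclusion_injective hle (hp.trans (map_zero _).symm)) hker hsurj
      refine ⟨d + 1, ?_, lam', h'⟩
      have h1 : (insert (Sum.inr j) S).toRight = insert j S.toRight := by
        ext; simp
      rw [h1, Finset.card_insert_of_notMem (by simpa using ha), hd]

/-- The series without any variable are the constants. -/
def freeUniv : LaurentSeries ℂ ≃ₗ[LaurentSeries ℂ] free (Finset.univ : Finset (ν ⊕ φ)) :=
  LinearEquiv.ofBijective
    ((LinearMap.toSpanSingleton (LaurentSeries ℂ) _ (Laurent.const 1)).codRestrict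
      (free (Finset.univ : Finset (ν ⊕ φ))) fun r => mem_vanish.mpr fun k n hn => by
        obtain ⟨a, -, hn⟩ := hn
        classical
        rw [LinearMap.toSpanSingleton_apply, Laurent.coeff_smul_const, map_smul, coeff_one,
          if_neg (fun h => hn (by rw [h]; rfl)), smul_zero])
    (by
      constructor
      · refine (injective_iff_map_eq_zero _).mpr fun r hr => ?_
        have h1 : r • Laurent.const (1 : MvPowerSeries (ν ⊕ φ) ℂ) = 0 := congrArg Subtype.val hr
        refine HahnSeries.ext (funext fun k => ?_)
        have h2 := congrArg (fun f => constantCoeff (Laurent.coeff f k)) h1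
        simp only [Laurent.coeff_smul_const] at h2
        rw [smul_eq_C_mul, map_mul, constantCoeff_C, map_one, mul_one] at h2
        exact h2
      · intro f
        refine ⟨HahnSeries.map (Γ := ℤ) f.1
          (constantCoeff (R := ℂ) (σ := ν ⊕ φ)), Subtype.ext ?_⟩
        refine Laurent.ext_coeff fun k => MvPowerSeries.ext fun n => ?_
        classical
        refine (congrArg (coeff n) (Laurent.coeff_smul_const _ _ k)).trans ?_
        rw [map_smul, coeff_one]
        split_ifs with h
        · subst h
          simp only [smul_eq_mul, mul_one]
          rfl
        · rw [smul_zero]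
          obtain ⟨a, ha⟩ := Finsupp.ne_iff.mp h
          exact (mem_vanish.mp f.2 k n ⟨a, Finset.mem_univ a, ha⟩).symm)

end Frame

/-! ### Hochschild homology -/

/-- A map onto cycles which is bijective on classes identifies its source with the homology. -/
theorem nonempty_subquotient_equiv {R M P : Type*} [Ring R] [AddCommGroup M] [Module R M]
    [AddCommGroup P] [Module R P] {P' : Type*} [AddCommGroup P'] [Module R P']
    {Z N : Submodule R M} (f : P →ₗ[R] M) (e : P ≃ₗ[R] P') (hf : ∀ p, f p ∈ Z)
    (hinj : ∀ p, f p ∈ N → p = 0) (hsurj : ∀ c ∈ Z, ∃ p, c - f p ∈ N) :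
    Nonempty (Subquotient Z N ≃ₗ[R] P') := by
  set m : P →ₗ[R] Subquotient Z N := (N.submoduleOf Z).mkQ ∘ₗ f.codRestrict Z hf with hm
  refine ⟨(LinearEquiv.ofBijective m ⟨?_, ?_⟩).symm ≪≫ₗ e⟩
  · refine (injective_iff_map_eq_zero _).mpr fun p hp => hinj p ?_
    exact (Submodule.Quotient.mk_eq_zero (N.submoduleOf Z)).mp hp
  · intro c
    obtain ⟨⟨c, hc⟩, rfl⟩ := Submodule.Quotient.mk_surjective _ c
    obtain ⟨p, hp⟩ := hsurj c hc
    exact ⟨p, ((Submodule.Quotient.eq (N.submoduleOf Z)).mpr hp).symm⟩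

namespace Frame

variable {V : Type*} [AddCommGroup V] [Module ℂ V] {B : V →ₗ[ℂ] V →ₗ[ℂ] ℂ} {g : V ≃ₗ[ℂ] V}
  {ν φ ι : Type*} [Fintype ν] [Fintype φ] [Fintype ι] [DecidableEq ν] [DecidableEq φ]
  (F : Frame B g ν φ) (y : Module.Basis ι ℂ V)
  (hB : B.IsAlt) (hgB : ∀ u v, B (g u) (g v) = B u v)

include hB hgB in
theorem differential_toChain (q : ℕ) (f : Big (ν ⊕ φ) (q + 1)) :
    differential B g y q (toChain B g F.lam F.e F.e' y (q + 1) f) =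
      toChain B g F.lam F.e F.e' y q (F.diff q f) :=
  FormalWeyl.differential_toChain F.lam F.e F.e' y hB hgB q f

include hB hgB in
theorem toChain_mem_cycles_iff : ∀ (q : ℕ) (f : Big (ν ⊕ φ) q),
    toChain B g F.lam F.e F.e' y q f ∈ cycles B g y q ↔
      f ∈ relCycles F.diff (F.rel y (fun _ => Set.univ) Finset.univ) q
  | 0, _ => ⟨fun _ => trivial, fun _ => trivial⟩
  | q + 1, f => by
    refine Iff.trans ?_ (F.toChain_eq_zero_iff y q (F.diff q f))
    rw [← F.differential_toChain y hB hgB]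
    rfl

include hB hgB in
theorem toChain_mem_boundaries_iff (q : ℕ) (f : Big (ν ⊕ φ) q) :
    toChain B g F.lam F.e F.e' y q f ∈ boundaries B g y q ↔
      ∃ e, f - F.diff q e ∈ F.rel y (fun _ => Set.univ) Finset.univ q := by
  constructor
  · rintro ⟨c, hc⟩
    obtain ⟨e, rfl⟩ := F.toChain_surjective y (q + 1) c
    refine ⟨e, (F.toChain_eq_zero_iff y q _).mp ?_⟩
    rw [map_sub, ← hc, F.differential_toChain y hB hgB, sub_self]
  · rintro ⟨e, he⟩
    refine ⟨toChain B g F.lam F.e F.e' y (q + 1) e, ?_⟩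
    have h := (F.toChain_eq_zero_iff y q _).mpr he
    rw [map_sub, sub_eq_zero] at h
    rw [F.differential_toChain y hB hgB, h]

theorem card_toRight_univ :
    (Finset.univ : Finset (ν ⊕ φ)).toRight.card = Fintype.card φ := by
  rw [← Finset.card_univ]
  congr 1
  ext
  simp

include F hB hgB in
theorem subsingleton_HH (q : ℕ) (hq : q ≠ Fintype.card φ) : Subsingleton (HH B g y q) := by
  obtain ⟨d, hd, lam, h⟩ := F.exists_isConcentrated y hB hgB Finset.univ
  have hd' : d = Fintype.card φ := hd.trans card_toRight_univ
  refine Submodule.Quotient.subsingleton_iff.mpr (eq_top_iff.mpr fun c _ => ?_)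
  obtain ⟨c, hc⟩ := c
  obtain ⟨f, rfl⟩ := F.toChain_surjective y q c
  exact (F.toChain_mem_boundaries_iff y hB hgB q f).mpr
    (h.exact q (fun h => hq (h.trans hd')) f ((F.toChain_mem_cycles_iff y hB hgB q f).mp hc))

include F hB hgB in
theorem nonempty_HH_equiv :
    Nonempty (HH B g y (Fintype.card φ) ≃ₗ[LaurentSeries ℂ] LaurentSeries ℂ) := by
  obtain ⟨d, hd, lam, h⟩ := F.exists_isConcentrated y hB hgB Finset.univ
  have hd' : d = Fintype.card φ := hd.trans card_toRight_univ
  subst hd'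
  set P := toChain B g F.lam F.e F.e' y (Fintype.card φ) with hP
  have hmem : ∀ p, P (lam p) ∈ cycles B g y (Fintype.card φ) := fun p =>
    (F.toChain_mem_cycles_iff y hB hgB _ (lam p)).mpr (h.mem p)
  have hinj : ∀ p, P (lam p) ∈ boundaries B g y (Fintype.card φ) → p = 0 := by
    intro p hp
    obtain ⟨e, he⟩ := (F.toChain_mem_boundaries_iff y hB hgB _ (lam p)).mp hp
    exact h.inj p e he
  have hsurj : ∀ c ∈ cycles B g y (Fintype.card φ), ∃ p,
      c - P (lam p) ∈ boundaries B g y (Fintype.card φ) := by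
    intro c hc
    obtain ⟨f, rfl⟩ := F.toChain_surjective y _ c
    obtain ⟨p, e, he⟩ := h.surj f ((F.toChain_mem_cycles_iff y hB hgB _ f).mp hc)
    have h1 := (F.toChain_mem_boundaries_iff y hB hgB _ (f - lam p)).mpr ⟨e, he⟩
    rw [map_sub] at h1
    exact ⟨p, h1⟩
  exact nonempty_subquotient_equiv (R := LaurentSeries ℂ)
    (P := free (Finset.univ : Finset (ν ⊕ φ))) (P ∘ₗ lam) freeUniv.symm hmem hinj hsurj

end Frame

/-! ### Degenerate chains -/

section Vanish

variable {α β : Type*}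

open scoped Classical in
/-- The part of a power series with exponents in `S`. -/
def restrictTo (S : Set (α →₀ ℕ)) : MvPowerSeries α ℂ →ₗ[ℂ] MvPowerSeries α ℂ :=
  LinearMap.pi fun n => if n ∈ S then coeff n else 0

open scoped Classical in
theorem coeff_restrictTo (S : Set (α →₀ ℕ)) (f : MvPowerSeries α ℂ) (n : α →₀ ℕ) :
    coeff n (restrictTo S f) = if n ∈ S then coeff n f else 0 := by
  change (if n ∈ S then coeff n else 0 : MvPowerSeries α ℂ →ₗ[ℂ] ℂ) f = _
  split_ifs <;> rfl

theorem vanish_inter_le (S T : Set (α →₀ ℕ)) : vanish (S ∩ T) ≤ vanish S ⊔ vanish T := by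
  intro f hf
  refine Submodule.mem_sup.mpr ⟨f - Laurent.map (restrictTo S) f, mem_vanish.mpr fun k n hn => ?_,
    Laurent.map (restrictTo S) f, mem_vanish.mpr fun k n hn => ?_, sub_add_cancel _ _⟩
  · rw [Laurent.coeff_sub, map_sub, Laurent.coeff_map, coeff_restrictTo, if_pos hn, sub_self]
  · rw [Laurent.coeff_map, coeff_restrictTo]
    split_ifs with h
    · exact mem_vanish.mp hf k n ⟨h, hn⟩
    · rfl

/-- A series without terms whose exponents lie in all the `S j` is a sum of series, one for each
`j`, without terms whose exponents lie in `S j`. -/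
theorem vanish_forall {J : Type*} [Finite J] (S : J → Set (α →₀ ℕ)) :
    vanish {n | ∀ j, n ∈ S j} = ⨆ j, vanish (S j) := by
  classical
  have := Fintype.ofFinite J
  refine le_antisymm ?_ (iSup_le fun j => vanish_anti fun n hn => hn j)
  have h : ∀ s : Finset J, vanish {n | ∀ j ∈ s, n ∈ S j} ≤ ⨆ j, vanish (S j) := by
    intro s
    induction s using Finset.induction_on with
    | empty =>
      intro f hf
      have : f = 0 := Laurent.ext_coeff fun k => MvPowerSeries.ext fun n => by
        rw [mem_vanish.mp hf k n (by simp)]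
        simp
      rw [this]
      exact zero_mem _
    | insert a s _ ih =>
      refine (vanish_anti ?_).trans ((vanish_inter_le (S a) {n | ∀ j ∈ s, n ∈ S j}).trans
        (sup_le (le_iSup (fun j => vanish (S j)) a) ih))
      rintro n ⟨h1, h2⟩ j hj
      obtain rfl | hj := Finset.mem_insert.mp hj
      · exact h1
      · exact h2 j hj
  refine (vanish_anti ?_).trans (h Finset.univ)
  exact fun n hn j => hn j (Finset.mem_univ j)

theorem range_map_rename [Finite α] (e : α ↪ β) :
    LinearMap.range (Laurent.map (rename (R := ℂ) e).toLinearMap) =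
      vanish {n | ∃ b ∉ Set.range e, n b ≠ 0} := by
  classical
  ext f
  constructor
  · rintro ⟨f, rfl⟩
    refine mem_vanish.mpr fun k n ⟨b, hb, hn⟩ => ?_
    rw [Laurent.coeff_map]
    refine coeff_rename_eq_zero (f := e) (f.coeff k) ?_
    rintro ⟨m, rfl⟩
    exact hn (Finsupp.mapDomain_of_notMem_range _ _ hb)
  · intro hf
    refine ⟨Laurent.map (killCompl (R := ℂ) e).toLinearMap f,
      Laurent.ext_coeff fun k => MvPowerSeries.ext fun n => ?_⟩
    rw [Laurent.coeff_map, Laurent.coeff_map]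
    by_cases hn : ∃ b ∉ Set.range e, n b ≠ 0
    · rw [mem_vanish.mp hf k n hn]
      refine coeff_rename_eq_zero (f := e) _ ?_
      rintro ⟨m, rfl⟩
      obtain ⟨b, hb, hn⟩ := hn
      exact hn (Finsupp.mapDomain_of_notMem_range _ _ hb)
    · push Not at hn
      have hn' : n = (n.comapDomain e e.injective.injOn).embDomain e := by
        ext b
        by_cases hb : b ∈ Set.range e
        · obtain ⟨a, rfl⟩ := hb
          exact (Finsupp.embDomain_apply_self e (n.comapDomain e e.injective.injOn) a).symm
        · rw [hn b hb, Finsupp.embDomain_of_notMem_range _ _ _ hb]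
      rw [hn']
      refine (coeff_embDomain_rename e _ _).trans ?_
      exact coeff_killCompl _ _

/-- The degenerate chains are those without terms which contain a variable of each of the slots
`1, …, q`. -/
theorem degenerate_eq_vanish (ι : Type*) [Fintype ι] : ∀ q : ℕ, degenerate ι q =
    vanish {n : Fin (q + 1) × ι →₀ ℕ | ∀ j : Fin q, ∃ i, n (j.succ, i) ≠ 0}
  | 0 => by
    refine ((Submodule.eq_bot_iff _).mpr fun f hf => ?_).symm
    refine Laurent.ext_coeff fun k => MvPowerSeries.ext fun n => ?_
    rw [mem_vanish.mp hf k n fun j => j.elim0]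
    simp
  | q + 1 => by
    have h := vanish_forall fun (j : Fin (q + 1)) => {n : Fin (q + 2) × ι →₀ ℕ |
      ∃ i, n (j.succ, i) ≠ 0}
    refine Eq.trans (iSup_congr fun j => ?_) h.symm
    refine (range_map_rename ⟨Prod.map (Fin.succAbove j.succ) (id : ι → ι),
      Fin.succAbove_right_injective.prodMap Function.injective_id⟩).trans ?_
    congr 1
    ext n
    constructor
    · rintro ⟨⟨s, i⟩, hs, hn⟩
      refine ⟨i, ?_⟩
      obtain rfl | h := eq_or_ne s j.succ
      · exact hn
      · obtain ⟨r, rfl⟩ := Fin.exists_succAbove_eq h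
        exact absurd ⟨(r, i), rfl⟩ hs
    · rintro ⟨i, hn⟩
      refine ⟨(j.succ, i), ?_, hn⟩
      rintro ⟨⟨r, i'⟩, hr⟩
      exact Fin.succAbove_ne _ _ (congrArg Prod.fst hr)

end Vanish

section GaussVanish

variable {α β : Type*} [Fintype α] [Fintype β] {E E' : Type*} [AddCommGroup E]
  [AddCommGroup E'] [Module ℂ E] [Module ℂ E']

/-- The image of a Gaussian operator does not contain the variables transversal to the image of its
linear part. -/
theorem gauss_mem_vanish (e : Module.Basis α ℂ E) (e' : Module.Basis β ℂ E') {L : E →ₗ[ℂ] E'}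
    (Q : E →ₗ[ℂ] E →ₗ[ℂ] ℂ) {A : Set β} (hL : ∀ v, ∀ b ∈ A, e'.repr (L v) b = 0)
    (f : Laurent (MvPowerSeries α ℂ)) : gauss e e' L Q f ∈ vanish {n | ∃ b ∈ A, n b ≠ 0} := by
  refine mem_vanish.mpr fun k n ⟨b, hb, hn⟩ => ?_
  rw [gauss_apply, Laurent.coeff_map]
  set p := (Laurent.expOp (quadOp e Q) f).coeff k
  have h1 : pderiv ℂ b (linSubst e e' L p) = 0 := by
    rw [pderiv_linSubst]
    exact Finset.sum_eq_zero fun a _ => by rw [hL _ b hb, zero_smul]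
  have h2 := congrArg (coeff (n - Finsupp.single b 1)) h1
  rw [coeff_pderiv, ← eq_add_single hn, map_zero] at h2
  exact (mul_eq_zero.mp h2).resolve_right (Nat.cast_add_one_ne_zero _)

end GaussVanish

theorem exists_succAbove_pair {q : ℕ} {j : Fin (q + 1)} {i : Fin (q + 2)} (h : i ≠ j.castSucc)
    (h' : i ≠ j.succ) :
    ∃ k : Fin q, i.succAbove k.castSucc = j.castSucc ∧ i.succAbove k.succ = j.succ := by
  have h1 : (i : ℕ) ≠ j := fun hh => h (Fin.ext hh)
  have h2 : (i : ℕ) ≠ j + 1 := fun hh => h' (Fin.ext (by simpa using hh))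
  have hi := i.isLt
  have hj := j.isLt
  by_cases hij : (i : ℕ) < j
  · refine ⟨⟨j - 1, by omega⟩, Fin.ext ?_, Fin.ext ?_⟩ <;>
      simp only [Fin.succAbove, Fin.lt_def, Fin.val_castSucc, Fin.val_succ] <;> split_ifs <;>
      simp <;> omega
  · refine ⟨⟨j, by omega⟩, Fin.ext ?_, Fin.ext ?_⟩ <;>
      simp only [Fin.succAbove, Fin.lt_def, Fin.val_castSucc, Fin.val_succ] <;> split_ifs <;>
      simp <;> omega

namespace Frame

variable {V : Type*} [AddCommGroup V] [Module ℂ V] {B : V →ₗ[ℂ] V →ₗ[ℂ] ℂ} {g : V ≃ₗ[ℂ] V}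
  {ν φ ι : Type*} [Fintype ν] [Fintype φ] [Fintype ι] [DecidableEq ν] [DecidableEq φ]
  (F : Frame B g ν φ) (y : Module.Basis ι ℂ V)

/-- The exponents of the terms which contain a variable of each of the slots `1, …, q`. -/
def full (ν φ ι : Type*) (q : ℕ) : Set ((ν ⊕ φ) ⊕ (Fin (q + 1) × ι) →₀ ℕ) :=
  {n | ∀ j : Fin q, ∃ i, n (Sum.inr (j.succ, i)) ≠ 0}

/-- A chain which is induced by a map that takes the same value at two adjacent points is
degenerate. -/
theorem pull_mem_rel {p q : ℕ} {θ : Fin (p + 1) → Fin (q + 1)} {k : Fin p}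
    (hθ : θ k.succ = θ k.castSucc) (f : Big (ν ⊕ φ) q) :
    pull F.e F.e' θ f ∈ F.rel y (full ν φ ι) ∅ p := by
  refine Submodule.mem_comap.mpr ?_
  unfold straight pull
  rw [gauss_gauss]
  refine vanish_anti ?_ (gauss_mem_vanish _ _ _ (A := {s | ∃ i, s = Sum.inr (k.succ, i)}) ?_ f)
  · rintro n ⟨hn, -⟩
    obtain ⟨i, hi⟩ := hn k
    exact ⟨_, ⟨i, rfl⟩, hi⟩
  · rintro v _ ⟨i, rfl⟩
    unfold straightBasis
    rw [Module.Basis.prod_repr_inr, slotBasis_repr, LinearMap.comp_apply, straightMap_apply]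
    change y.repr (toChainMap g F.lam p (pullMap V θ v) k.succ) i = 0
    rw [toChainMap_succ, pullMap_apply]
    simp [hθ]

/-- A chain which in the straight coordinates does not contain the variables of the slot `j + 1` is
induced by the map `j.predAbove`, which takes the same value at `j` and `j + 1`. -/
theorem exists_pull_of_straight_mem {q : ℕ} (j : Fin (q + 1)) (f : Big (ν ⊕ φ) (q + 1))
    (hf : F.straight y (q + 1) f ∈ vanish {n | ∃ i, n (Sum.inr (j.succ, i)) ≠ 0}) :
    ∃ f', f = pull F.e F.e' (Fin.predAbove j) f' := by
  classical
  obtain ⟨L', Q', h1, h2, -⟩ := exists_gauss_inverse (bigBasis F.e F.e' (q + 1))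
    (F.straightBasis y (q + 1)) (F.straightMap_bijective (q + 1)) (toChainForm B g F.lam (q + 1))
  set r : (ν ⊕ φ) ⊕ (Fin (q + 1) × ι) ↪ (ν ⊕ φ) ⊕ (Fin (q + 2) × ι) :=
    ⟨Sum.map id (Prod.map (Fin.succAbove j.succ) id), Function.injective_id.sumMap
      (Fin.succAbove_right_injective.prodMap Function.injective_id)⟩ with hr
  set inc : V × (Fin (q + 1) → V) →ₗ[ℂ] V × (Fin (q + 2) → V) :=
    LinearMap.id.prodMap (pushSlots V (Fin.succAbove j.succ)) with hinc
  have h3 : F.straight y (q + 1) f ∈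
      LinearMap.range (Laurent.map (rename (R := ℂ) r).toLinearMap) := by
    rw [range_map_rename]
    refine vanish_anti ?_ hf
    rintro n ⟨s, hs, hn⟩
    rcases s with a | ⟨s, i⟩
    · exact absurd ⟨Sum.inl a, rfl⟩ hs
    · refine ⟨i, ?_⟩
      obtain rfl | h := eq_or_ne s j.succ
      · exact hn
      · obtain ⟨t, rfl⟩ := Fin.exists_succAbove_eq h
        exact absurd ⟨Sum.inr (t, i), rfl⟩ hs
  obtain ⟨g', hg'⟩ := h3
  rw [map_rename_eq_gauss (F.straightBasis y q) (F.straightBasis y (q + 1)) (L := inc)] at hg'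
  swap
  · rintro (a | ⟨s, i⟩)
    · simp [straightBasis, hinc, hr]
    · simp [straightBasis, hinc, hr, slotBasis_apply, pushSlots_single]
  refine ⟨pull F.e F.e' (Fin.succAbove j.succ) f, ?_⟩
  have hf' : f = gauss (F.straightBasis y q) (bigBasis F.e F.e' (q + 1)) (L' ∘ₗ inc)
      (Q'.compl₁₂ inc inc + 0) g' := by
    rw [← gauss_gauss (e' := F.straightBasis y (q + 1)), hg']
    exact (h2 f).symm
  rw [pull_pull]
  conv_rhs => rw [hf']
  unfold pull
  rw [gauss_gauss]
  rw [hf']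
  refine LinearMap.congr_fun (gauss_congr _ _ (fun v => ?_) fun v => by simp) g'
  -- The coordinate `u_{j+1} - u_j` of the points of the image vanishes.
  set w := (L' ∘ₗ inc) v with hw
  have h4 : w.1 j.succ = w.1 j.castSucc := by
    have h5 := h1 (inc v)
    have h6 : toChainMap g F.lam (q + 1) w j.succ = (inc v).2 j.succ :=
      congrFun (congrArg Prod.snd h5) j.succ
    have h7 : (inc v).2 j.succ = 0 := by
      change pushSlots V (Fin.succAbove j.succ) v.2 j.succ = 0
      rw [pushSlots_apply]
      exact Finset.sum_eq_zero fun s _ => if_neg (Fin.succAbove_ne _ _)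
    rw [h7, toChainMap_succ, sub_eq_zero] at h6
    exact h6
  rw [LinearMap.comp_apply, ← hw, pullMap_apply]
  refine Prod.ext (funext fun s => ?_) rfl
  change w.1 s = w.1 (Fin.succAbove j.succ (Fin.predAbove j s))
  obtain rfl | hs := eq_or_ne s j.succ
  · rw [h4, Fin.predAbove_succ_self, Fin.succAbove_succ_self]
  · rw [Fin.succ_succAbove_predAbove hs]

/-- The lifts of degenerate chains form a subcomplex: of the faces of a chain with `u_j = u_{j+1}`,
two cancel, and the others are degenerate again. -/
theorem diff_mem_rel_full (q : ℕ) (f : Big (ν ⊕ φ) (q + 1))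
    (hf : f ∈ F.rel y (full ν φ ι) ∅ (q + 1)) : F.diff q f ∈ F.rel y (full ν φ ι) ∅ q := by
  set E := LinearEquiv.ofBijective (F.straight y (q + 1)) (F.straight_bijective y (q + 1))
  have h : vanish {n : (ν ⊕ φ) ⊕ (Fin (q + 2) × ι) →₀ ℕ | ∀ j : Fin (q + 1),
      n ∈ {n | ∃ i, n (Sum.inr (j.succ, i)) ≠ 0}} ≤
      (F.rel y (full ν φ ι) ∅ q).comap (F.diff q ∘ₗ E.symm.toLinearMap) := by
    rw [vanish_forall]
    refine iSup_le fun j f' hf' => ?_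
    obtain ⟨f, rfl⟩ := E.surjective f'
    obtain ⟨f', h1⟩ := F.exists_pull_of_straight_mem y j f hf'
    rw [Submodule.mem_comap, LinearMap.comp_apply, LinearEquiv.coe_coe, E.symm_apply_apply, h1]
    unfold diff
    rw [bigDiff_apply]
    have hne : j.castSucc ≠ j.succ := (Fin.castSucc_lt_succ).ne
    rw [← Finset.add_sum_erase _ _ (Finset.mem_univ j.castSucc),
      ← Finset.add_sum_erase _ _ (Finset.mem_erase.mpr ⟨hne.symm, Finset.mem_univ j.succ⟩),
      ← add_assoc]
    have h2 : (Fin.predAbove j ∘ Fin.succAbove j.castSucc : Fin (q + 1) → Fin (q + 1)) =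
        Fin.predAbove j ∘ Fin.succAbove j.succ := by
      funext s
      refine (Fin.predAbove_succAbove j s).trans (Fin.succAbove_right_injective (p := j.succ) ?_)
      exact (Fin.succ_succAbove_predAbove (Fin.succAbove_ne _ _)).symm
    rw [pull_pull, pull_pull, h2, Fin.val_succ, neg_one_pow_succ_smul, Fin.val_castSucc,
      add_neg_cancel, zero_add]
    refine Submodule.sum_mem _ fun i hi => Submodule.smul_mem _ _ ?_
    rw [Finset.mem_erase, Finset.mem_erase] at hi
    obtain ⟨k, hk1, hk2⟩ := exists_succAbove_pair hi.2.1 hi.1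
    rw [pull_pull]
    refine F.pull_mem_rel y (k := k) ?_ f'
    rw [Function.comp_apply, Function.comp_apply, hk1, hk2]
    simp
  have hf' : E f ∈ vanish {n : (ν ⊕ φ) ⊕ (Fin (q + 2) × ι) →₀ ℕ | ∀ j : Fin (q + 1),
      n ∈ {n | ∃ i, n (Sum.inr (j.succ, i)) ≠ 0}} := by
    refine vanish_anti ?_ (Submodule.mem_comap.mp hf)
    exact fun n hn => ⟨hn, by simp⟩
  have h3 := h hf'
  rwa [Submodule.mem_comap, LinearMap.comp_apply, LinearEquiv.coe_coe, E.symm_apply_apply] at h3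

end Frame

/-! ### The determinant cycle -/

theorem neg_one_pow_smul_eq_zsmul {K M : Type*} [CommRing K] [AddCommGroup M] [Module K M]
    (n : ℕ) (x : M) : (-1 : K) ^ n • x = (-1 : ℤ) ^ n • x := by
  rcases n.even_or_odd with h | h
  · rw [h.neg_one_pow, h.neg_one_pow, one_smul, one_smul]
  · rw [h.neg_one_pow, h.neg_one_pow, neg_smul, neg_smul, one_smul, one_smul]

namespace Laurent

variable {A : Type*} [AddCommGroup A] [Module ℂ A]

/-- `const` as an additive map. -/
def constHom : A →+ Laurent A :=
  AddMonoidHom.mk' const fun a b => ext_coeff fun k => by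
    rw [coeff_add, coeff_const, coeff_const, coeff_const]
    split_ifs <;> simp

theorem const_sum {J : Type*} (s : Finset J) (f : J → A) :
    const (∑ j ∈ s, f j) = ∑ j ∈ s, const (f j) :=
  map_sum constHom f s

theorem const_zero : const (0 : A) = 0 := HahnSeries.single_eq_zero

theorem const_neg_one_pow_smul (n : ℕ) (a : A) :
    const ((-1 : ℤ) ^ n • a) = (-1 : LaurentSeries ℂ) ^ n • const a := by
  exact (map_zsmul constHom ((-1) ^ n) a).trans (neg_one_pow_smul_eq_zsmul n _).symm

end Laurent

theorem derivation_det_eq_zero {R A : Type*} [CommRing R] [CommRing A] [Algebra R A]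
    (D : Derivation R A A) {n : Type*} [Fintype n] [DecidableEq n] {M : Matrix n n A}
    (h : ∀ i j, D (M i j) = 0) : D M.det = 0 := by
  rw [Matrix.det_apply, map_sum]
  refine Finset.sum_eq_zero fun σ _ => ?_
  rw [Units.smul_def, map_zsmul]
  refine (congrArg _ (Finset.prod_induction _ (fun x => D x = 0) (fun x y hx hy => ?_) ?_
    fun i _ => h _ _)).trans (smul_zero _)
  · rw [D.leibniz, hx, hy, smul_zero, smul_zero, add_zero]
  · exact D.map_one_eq_zero

/-- Expansion of a determinant along the sum of all rows. -/
theorem det_eq_sum_colSum {R : Type*} [CommRing R] {k : ℕ}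
    (N : Matrix (Fin (k + 1)) (Fin (k + 1)) R) :
    N.det = ∑ j : Fin (k + 1), (-1 : ℤ) ^ (j : ℕ) •
      ((∑ s, N s j) * (N.submatrix Fin.succ j.succAbove).det) := by
  have h := Matrix.det_updateRow_sum N 0 fun _ => 1
  rw [one_smul] at h
  rw [← h, Matrix.det_succ_row_zero]
  refine Finset.sum_congr rfl fun j _ => ?_
  rw [Matrix.updateRow_self, zsmul_eq_mul]
  have h1 : (N.updateRow 0 (∑ k, (1 : R) • N k)).submatrix Fin.succ j.succAbove =
      N.submatrix Fin.succ j.succAbove := by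
    ext i j'
    simp [Matrix.updateRow_ne]
  rw [h1, mul_assoc]
  congr 1
  · push_cast
    rfl
  · congr 1
    rw [Finset.sum_apply]
    exact Finset.sum_congr rfl fun s _ => by rw [Pi.smul_apply, one_smul]

namespace Frame

variable {V : Type*} [AddCommGroup V] [Module ℂ V] {B : V →ₗ[ℂ] V →ₗ[ℂ] ℂ} {g : V ≃ₗ[ℂ] V}
  {ν φ ι : Type*} [Fintype ν] [Fintype φ] [Fintype ι] [DecidableEq ν] [DecidableEq φ]
  (F : Frame B g ν φ) (y : Module.Basis ι ℂ V)

/-- The chain `det (u_i^{a_j})` with rows `i = 1, …, k`. -/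
def detChain (ν : Type*) {φ : Type*} {k : ℕ} (a : Fin k → φ) : Big (ν ⊕ φ) k :=
  Laurent.const (Matrix.of fun i j : Fin k => (X (Sum.inl (i.succ, Sum.inr (a j))) :
    MvPowerSeries ((Fin (k + 1) × (ν ⊕ φ)) ⊕ (ν ⊕ φ)) ℂ)).det

theorem bigBasis_inl (q : ℕ) (s : Fin (q + 1)) (a : ν ⊕ φ) :
    bigBasis F.e F.e' q (Sum.inl (s, a)) = (Pi.single s (F.e a), 0) := by
  simp [bigBasis, slotBasis_apply]

theorem linSubst_succAbove_self (q : ℕ) (i : Fin (q + 2)) (a : ν ⊕ φ) :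
    linSubst (bigBasis F.e F.e' (q + 1)) (bigBasis F.e F.e' q) (pullMap V i.succAbove)
      (X (Sum.inl (i, a))) = 0 := by
  have h : pullMap V i.succAbove (bigBasis F.e F.e' (q + 1) (Sum.inl (i, a))) = 0 := by
    rw [bigBasis_inl, pullMap_apply]
    exact Prod.ext (funext fun r => Pi.single_eq_of_ne (Fin.succAbove_ne i r) _) rfl
  rw [linSubst_X, h, map_zero]

theorem linSubst_succAbove (q : ℕ) (i : Fin (q + 2)) (r : Fin (q + 1)) (a : ν ⊕ φ) :
    linSubst (bigBasis F.e F.e' (q + 1)) (bigBasis F.e F.e' q) (pullMap V i.succAbove)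
      (X (Sum.inl (i.succAbove r, a))) = X (Sum.inl (r, a)) := by
  have h : pullMap V i.succAbove (bigBasis F.e F.e' (q + 1) (Sum.inl (i.succAbove r, a))) =
      bigBasis F.e F.e' q (Sum.inl (r, a)) := by
    rw [bigBasis_inl, bigBasis_inl, pullMap_apply]
    refine Prod.ext (funext fun r' => ?_) rfl
    by_cases hr : r' = r
    · subst hr
      simp
    · have : i.succAbove r' ≠ i.succAbove r := fun h => hr (Fin.succAbove_right_injective h)
      change (Pi.single (i.succAbove r) (F.e a) : Fin (q + 2) → V) (i.succAbove r') =
        (Pi.single r (F.e a) : Fin (q + 1) → V) r'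
      rw [Pi.single_eq_of_ne this, Pi.single_eq_of_ne hr]
  rw [linSubst_X, h, lin_basis]

/-- Of the faces of the determinant chain only the first one is not zero. -/
theorem diff_detChain_eq_const {k : ℕ} (a : Fin (k + 1) → φ) :
    F.diff k (detChain ν a) = Laurent.const (Matrix.of fun i j : Fin (k + 1) =>
      (X (Sum.inl (i, Sum.inr (a j))) :
        MvPowerSeries ((Fin (k + 1) × (ν ⊕ φ)) ⊕ (ν ⊕ φ)) ℂ)).det := by
  unfold diff
  rw [bigDiff_apply]
  have h : ∀ i : Fin (k + 2), pull F.e F.e' i.succAbove (detChain ν a) =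
      Laurent.const (Matrix.of fun r j : Fin (k + 1) =>
        linSubst (bigBasis F.e F.e' (k + 1)) (bigBasis F.e F.e' k) (pullMap V i.succAbove)
          (X (Sum.inl (r.succ, Sum.inr (a j))))).det := by
    intro i
    unfold pull detChain
    rw [gauss_zero_apply, Laurent.map_const]
    congr 1
    exact AlgHom.map_det (linSubst (bigBasis F.e F.e' (k + 1)) (bigBasis F.e F.e' k)
      (pullMap V i.succAbove)) _
  rw [Fin.sum_univ_succ, Finset.sum_eq_zero, add_zero]
  · rw [Fin.val_zero, pow_zero, one_smul, h]
    congr 3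
    funext r j
    have := F.linSubst_succAbove k 0 r (Sum.inr (a j))
    rwa [Fin.zero_succAbove] at this
  · intro i _
    rw [h, Matrix.det_eq_zero_of_row_eq_zero i, Laurent.const_zero, smul_zero]
    exact fun j => F.linSubst_succAbove_self k i.succ _

theorem Z_inr_const {q : ℕ} (c : φ)
    {p : MvPowerSeries ((Fin (q + 1) × (ν ⊕ φ)) ⊕ (ν ⊕ φ)) ℂ}
    (hp : dirDeriv (bigBasis F.e F.e' q) (F.phase (Sum.inr c) ∘ₗ LinearMap.snd ℂ _ _) p = 0) :
    F.Z (Sum.inr c) q (Laurent.const p) =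
      Laurent.const ((∑ s, X (Sum.inl (s, Sum.inr c))) * p) := by
  have h : lin (bigBasis F.e F.e' q) (fun _ => F.e (Sum.inr c), F.shift (Sum.inr c)) =
      ∑ s, X (Sum.inl (s, Sum.inr c)) := by
    have h1 : ((fun _ => F.e (Sum.inr c), F.shift (Sum.inr c)) : (Fin (q + 1) → V) × V) =
        ∑ s, bigBasis F.e F.e' q (Sum.inl (s, Sum.inr c)) := by
      simp only [bigBasis_inl]
      refine Prod.ext ?_ ?_
      · rw [Prod.fst_sum]
        exact (Finset.univ_sum_single fun _ : Fin (q + 1) => F.e (Sum.inr c)).symm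
      · rw [Prod.snd_sum]
        simp [shift]
    rw [h1, map_sum]
    exact Finset.sum_congr rfl fun s _ => lin_basis _ _
  unfold Z
  rw [heis_apply, h, Laurent.map_const, Laurent.map_const]
  have h2 : (dirDeriv (bigBasis F.e F.e' q)
      (F.phase (Sum.inr c) ∘ₗ LinearMap.snd ℂ _ _)).toLinearMap p = 0 := hp
  rw [h2, Laurent.const_zero, smul_zero, add_zero]
  rfl

/-- The differential of the determinant chain is a combination of images of the operators `Z_a`. -/
theorem diff_detChain {k : ℕ} (a : Fin (k + 1) → φ) :
    F.diff k (detChain ν a) = ∑ j : Fin (k + 1), (-1 : LaurentSeries ℂ) ^ (j : ℕ) •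
      F.Z (Sum.inr (a j)) k (detChain ν (a ∘ j.succAbove)) := by
  rw [diff_detChain_eq_const, det_eq_sum_colSum, Laurent.const_sum]
  refine Finset.sum_congr rfl fun j _ => ?_
  rw [Laurent.const_neg_one_pow_smul]
  congr 1
  unfold detChain
  rw [Z_inr_const]
  · rfl
  · refine derivation_det_eq_zero _ fun i j' => ?_
    rw [Matrix.of_apply, ← lin_basis (bigBasis F.e F.e' k), dirDeriv_lin, bigBasis_inl]
    simp

variable (hB : B.IsAlt) (hgB : ∀ u v, B (g u) (g v) = B u v)

theorem full_add_single (q : ℕ) (n : (ν ⊕ φ) ⊕ (Fin (q + 1) × ι) →₀ ℕ) (a : ν ⊕ φ) :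
    n + Finsupp.single (Sum.inl a) 1 ∈ full ν φ ι q ↔ n ∈ full ν φ ι q := by
  simp [full]

include hB hgB in
theorem Z_mem_rel_of_mem {T : ∀ q, Set ((ν ⊕ φ) ⊕ (Fin (q + 1) × ι) →₀ ℕ)} {S : Finset (ν ⊕ φ)}
    {a : ν ⊕ φ} (ha : a ∈ S) (q : ℕ) (f : Big (ν ⊕ φ) q) : F.Z a q f ∈ F.rel y T S q := by
  rw [← Finset.insert_eq_of_mem ha]
  exact (F.mem_rel_insert hB hgB S a q _).mpr ⟨f, by simp⟩

include hB hgB in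
/-- In degree `0`, where no chain is degenerate, the value at `u = x = 0` vanishes on the images of
the `Z_a` with `a ∈ ν`. -/
theorem constantCoeff_evalX_of_mem_rel (S : Finset ν) (f : Big (ν ⊕ φ) 0)
    (hf : f ∈ F.rel y (full ν φ ι) (S.map Function.Embedding.inl) 0) (k : ℤ) :
    constantCoeff ((F.evalX 0 f).coeff k) = 0 := by
  induction S using Finset.induction_on generalizing f with
  | empty =>
    have h : (full ν φ ι : ∀ q, Set ((ν ⊕ φ) ⊕ (Fin (q + 1) × ι) →₀ ℕ)) 0 = Set.univ :=
      Set.eq_univ_of_forall fun n j => j.elim0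
    have h1 : f ∈ F.rel y (fun _ => Set.univ) ∅ 0 := by
      unfold rel at hf ⊢
      rw [h] at hf
      simpa using hf
    rw [F.rel_univ_empty, Submodule.mem_bot] at h1
    rw [h1, map_zero]
    simp
  | insert i S _ ih =>
    rw [Finset.map_insert] at hf
    obtain ⟨e, he⟩ := (F.mem_rel_insert hB hgB _ _ 0 f).mp hf
    have h := ih _ he
    rw [map_sub, Function.Embedding.inl_apply, evalX_Z, trans_inl, Laurent.coeff_sub, map_sub,
      coeff_mulX, map_mul, constantCoeff_X, zero_mul, sub_zero] at h
    exact h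

include hB hgB in
/-- The determinant chain is not a boundary, even up to degenerate chains. By the formula for its
differential and the regularity of the operators `Z_a`, a chain which bounds it modulo the `Z_a`
yields one for the determinant of one size less; in degree `0` the constant coefficient decides. -/
theorem detChain_sub_diff_notMem {k : ℕ} (a : Fin k → φ) (ha : Function.Injective a)
    (f : Big (ν ⊕ φ) (k + 1)) :
    detChain ν a - F.diff k f ∉ F.rel y (full ν φ ι)
      (Finset.univ.map Function.Embedding.inl ∪
        (Finset.univ.image a).map Function.Embedding.inr) k := by
  induction k with
  | zero =>
    intro h
    have h0 : (Finset.univ.map Function.Embedding.inl ∪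
        (Finset.univ.image a).map Function.Embedding.inr : Finset (ν ⊕ φ)) =
        Finset.univ.map Function.Embedding.inl := by simp
    rw [h0] at h
    have h1 := F.constantCoeff_evalX_of_mem_rel y hB hgB _ _ h 0
    rw [map_sub, evalX_diff, sub_zero] at h1
    unfold evalX detChain at h1
    rw [gauss_zero_apply, Laurent.map_const, Laurent.coeff_const, if_pos rfl,
      Matrix.det_fin_zero] at h1
    simp at h1
  | succ k ih =>
    intro h
    have hS : (Finset.univ.map Function.Embedding.inl ∪
        (Finset.univ.image a).map Function.Embedding.inr : Finset (ν ⊕ φ)) =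
        insert (Sum.inr (a 0)) (Finset.univ.map Function.Embedding.inl ∪
        (Finset.univ.image (a ∘ Fin.succ)).map Function.Embedding.inr) := by
      ext s
      rcases s with i | c
      · simp
      · simp [Fin.exists_fin_succ, eq_comm]
    have hn : (Sum.inr (a 0) : ν ⊕ φ) ∉ (Finset.univ.map Function.Embedding.inl ∪
        (Finset.univ.image (a ∘ Fin.succ)).map Function.Embedding.inr : Finset (ν ⊕ φ)) := by
      simp [ha.eq_iff]
    rw [hS] at h
    obtain ⟨e, he⟩ := (F.mem_rel_insert hB hgB _ _ _ _).mp h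
    have h1 := F.diff_mem_rel hB hgB (F.diff_mem_rel_full y) _ k _ he
    rw [map_sub, map_sub, diff_diff, sub_zero, diff_Z, diff_detChain, Fin.sum_univ_succ] at h1
    rw [Fin.val_zero, pow_zero, one_smul, add_sub_right_comm, ← map_sub] at h1
    refine ih (a ∘ Fin.succ) (ha.comp (Fin.succ_injective _)) e
      (F.rel_regular hB hgB full_add_single hn k _ ?_)
    have h2 : ∑ i : Fin k, (-1 : LaurentSeries ℂ) ^ (i.succ : ℕ) •
        F.Z (Sum.inr (a i.succ)) k (detChain ν (a ∘ i.succ.succAbove)) ∈ F.rel y (full ν φ ι)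
        (Finset.univ.map Function.Embedding.inl ∪
        (Finset.univ.image (a ∘ Fin.succ)).map Function.Embedding.inr) k :=
      Submodule.sum_mem _ fun i _ => Submodule.smul_mem _ _
        (F.Z_mem_rel_of_mem y hB hgB (by simp) k _)
    have h3 := sub_mem h1 h2
    rw [add_sub_cancel_right] at h3
    rw [Fin.succAbove_zero] at h3
    exact h3

end Frame

/-! ### The leading term of the determinant cycle -/

section LowDeg

variable {α β : Type*}

/-- The polynomials of degree less than `d`, characterized by the vanishing of their derivatives
of order `d`. -/
def lowDeg (α : Type*) : ℕ → Submodule ℂ (MvPowerSeries α ℂ)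
  | 0 => ⊥
  | d + 1 => ⨅ a, (lowDeg α d).comap (pderiv ℂ a).toLinearMap

theorem mem_lowDeg_succ {d : ℕ} {f : MvPowerSeries α ℂ} :
    f ∈ lowDeg α (d + 1) ↔ ∀ a, pderiv ℂ a f ∈ lowDeg α d :=
  Submodule.mem_iInf _

theorem lowDeg_le_succ : ∀ d, lowDeg α d ≤ lowDeg α (d + 1)
  | 0 => bot_le
  | d + 1 => fun _ hf => mem_lowDeg_succ.mpr fun a => lowDeg_le_succ d (mem_lowDeg_succ.mp hf a)

theorem one_mem_lowDeg : (1 : MvPowerSeries α ℂ) ∈ lowDeg α 1 :=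
  mem_lowDeg_succ.mpr fun a => by
    rw [(pderiv ℂ a).map_one_eq_zero]
    exact zero_mem _

theorem coeff_eq_zero_of_mem_lowDeg : ∀ {d : ℕ} {f : MvPowerSeries α ℂ} {n : α →₀ ℕ},
    f ∈ lowDeg α d → d ≤ n.degree → coeff n f = 0
  | 0, f, n, hf, _ => by
    rw [(Submodule.mem_bot ℂ).mp hf, map_zero]
  | d + 1, f, n, hf, hn => by
    have hn0 : n ≠ 0 := by
      rintro rfl
      simp at hn
    obtain ⟨a, ha⟩ := Finsupp.ne_iff.mp hn0
    have h1 := eq_add_single ha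
    have h2 := coeff_eq_zero_of_mem_lowDeg (n := n - Finsupp.single a 1)
      (mem_lowDeg_succ.mp hf a) (by
        rw [h1, map_add, Finsupp.degree_single] at hn
        omega)
    rw [coeff_pderiv, ← h1] at h2
    exact (mul_eq_zero.mp h2).resolve_right (Nat.cast_add_one_ne_zero _)

variable [Fintype α] [Fintype β] {E E' : Type*} [AddCommGroup E] [AddCommGroup E'] [Module ℂ E]
  [Module ℂ E']

theorem lin_mul_mem_lowDeg (e : Module.Basis α ℂ E) (v : E) :
    ∀ {d : ℕ} {f : MvPowerSeries α ℂ}, f ∈ lowDeg α d → lin e v * f ∈ lowDeg α (d + 1)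
  | 0, f, hf => by
    rw [(Submodule.mem_bot ℂ).mp hf, mul_zero]
    exact zero_mem _
  | d + 1, f, hf => mem_lowDeg_succ.mpr fun a => by
    rw [(pderiv ℂ a).leibniz, pderiv_lin, smul_eq_mul, smul_eq_mul, mul_comm f, ← smul_eq_C_mul]
    exact add_mem (lin_mul_mem_lowDeg e v (mem_lowDeg_succ.mp hf a)) (Submodule.smul_mem _ _ hf)

theorem prod_lin_mem_lowDeg (e : Module.Basis α ℂ E) {J : Type*} (s : Finset J) (v : J → E) :
    ∏ j ∈ s, lin e (v j) ∈ lowDeg α (s.card + 1) := by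
  classical
  induction s using Finset.induction_on with
  | empty =>
    rw [Finset.prod_empty]
    exact one_mem_lowDeg
  | insert a s ha ih =>
    rw [Finset.prod_insert ha, Finset.card_insert_of_notMem ha]
    exact lin_mul_mem_lowDeg e _ ih

theorem det_lin_mem_lowDeg (e : Module.Basis α ℂ E) {k : ℕ} (v : Fin k → Fin k → E) :
    (Matrix.of fun i j => lin e (v i j)).det ∈ lowDeg α (k + 1) := by
  rw [Matrix.det_apply]
  refine Submodule.sum_mem _ fun σ _ => ?_
  rw [Units.smul_def]
  refine zsmul_mem ?_ _
  have h := prod_lin_mem_lowDeg e Finset.univ fun i => v (σ i) i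
  rwa [Finset.card_univ, Fintype.card_fin] at h

theorem linSubst_mem_lowDeg (e : Module.Basis α ℂ E) (e' : Module.Basis β ℂ E') (L : E →ₗ[ℂ] E') :
    ∀ {d : ℕ} {f : MvPowerSeries α ℂ}, f ∈ lowDeg α d → linSubst e e' L f ∈ lowDeg β d
  | 0, f, hf => by
    rw [(Submodule.mem_bot ℂ).mp hf, map_zero]
    exact zero_mem _
  | d + 1, f, hf => mem_lowDeg_succ.mpr fun b => by
    rw [pderiv_linSubst]
    exact Submodule.sum_mem _ fun a _ => Submodule.smul_mem _ _
      (linSubst_mem_lowDeg e e' L (mem_lowDeg_succ.mp hf a))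

theorem pderiv_mem_lowDeg {d : ℕ} {f : MvPowerSeries α ℂ} (hf : f ∈ lowDeg α d) (a : α) :
    pderiv ℂ a f ∈ lowDeg α d :=
  mem_lowDeg_succ.mp (lowDeg_le_succ d hf) a

theorem quadOp_mem_lowDeg (e : Module.Basis α ℂ E) (Q : E →ₗ[ℂ] E →ₗ[ℂ] ℂ) {d : ℕ}
    {f : MvPowerSeries α ℂ} (hf : f ∈ lowDeg α (d + 1)) : quadOp e Q f ∈ lowDeg α d := by
  rw [quadOp_apply]
  exact Submodule.sum_mem _ fun a _ => Submodule.sum_mem _ fun b _ => Submodule.smul_mem _ _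
    (pderiv_mem_lowDeg (mem_lowDeg_succ.mp hf b) a)

theorem quadOp_pow_mem_lowDeg (e : Module.Basis α ℂ E) (Q : E →ₗ[ℂ] E →ₗ[ℂ] ℂ) {d : ℕ}
    {f : MvPowerSeries α ℂ} (hf : f ∈ lowDeg α (d + 1)) (r : ℕ) :
    (quadOp e Q ^ (r + 1)) f ∈ lowDeg α d := by
  induction r with
  | zero =>
    rw [zero_add, pow_one]
    exact quadOp_mem_lowDeg e Q hf
  | succ r ih =>
    rw [pow_succ', Module.End.mul_apply]
    exact quadOp_mem_lowDeg e Q (lowDeg_le_succ _ ih)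

/-- In the top degree, a Gaussian operator acts on polynomials through its linear part. -/
theorem gauss_const_sub_mem_vanish (e : Module.Basis α ℂ E) (e' : Module.Basis β ℂ E')
    (L : E →ₗ[ℂ] E') (Q : E →ₗ[ℂ] E →ₗ[ℂ] ℂ) {d : ℕ} {p : MvPowerSeries α ℂ}
    (hp : p ∈ lowDeg α (d + 1)) :
    gauss e e' L Q (Laurent.const p) - Laurent.const (linSubst e e' L p) ∈
      vanish {n | d ≤ n.degree} := by
  refine mem_vanish.mpr fun k n hn => ?_
  have h : ∀ k, (Laurent.const p).coeff k ∈ lowDeg α (d + 1) := by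
    intro k
    rw [Laurent.coeff_const]
    split_ifs
    · exact hp
    · exact zero_mem _
  obtain ⟨N, hN⟩ := Laurent.exists_bound (Laurent.const p) k
  have h1 := Laurent.coeff_expOp (quadOp e Q) (Laurent.const p) k (N + 1)
    fun r hr => hN r (by omega)
  rw [Finset.sum_range_succ'] at h1
  have h2 : Laurent.const (linSubst e e' L p) =
      Laurent.map (linSubst e e' L).toLinearMap (Laurent.const p) := by
    rw [Laurent.map_const]
    rfl
  rw [gauss_apply, h2, ← map_sub, Laurent.coeff_map, Laurent.coeff_sub, h1]
  refine coeff_eq_zero_of_mem_lowDeg (linSubst_mem_lowDeg e e' L ?_) hn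
  simp only [Nat.cast_zero, sub_zero, pow_zero, Nat.factorial_zero, Nat.cast_one, inv_one, one_smul,
    Module.End.one_apply, add_sub_cancel_right]
  exact Submodule.sum_mem _ fun r _ => Submodule.smul_mem _ _ (quadOp_pow_mem_lowDeg e Q (h _) r)

end LowDeg

theorem le_degree_of_full {ι : Type*} [Fintype ι] {k : ℕ} {n : Fin (k + 1) × ι →₀ ℕ}
    (hn : ∀ j : Fin k, ∃ i, n (j.succ, i) ≠ 0) :
    (∑ i, n (0, i)) + k ≤ n.degree := by
  rw [Finsupp.degree_eq_sum, Fintype.sum_prod_type, Fin.sum_univ_succ]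
  refine Nat.add_le_add_left ?_ _
  have h : ∀ j : Fin k, 1 ≤ ∑ i, n (j.succ, i) := fun j => by
    obtain ⟨i, hi⟩ := hn j
    exact (Nat.one_le_iff_ne_zero.mpr hi).trans
      (Finset.single_le_sum (f := fun i => n (j.succ, i)) (fun _ _ => Nat.zero_le _)
        (Finset.mem_univ i))
  simpa using Finset.sum_le_sum fun (j : Fin k) (_ : j ∈ Finset.univ) => h j

theorem coeff_eq_zero_of_mem_span_X {α : Type*} {A : Set α} {f : MvPowerSeries α ℂ}
    (hf : f ∈ Ideal.span (X '' A)) {n : α →₀ ℕ} (hn : ∀ a ∈ A, n a = 0) : coeff n f = 0 := by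
  classical
  induction hf using Submodule.span_induction generalizing n with
  | mem f hf =>
    obtain ⟨a, ha, rfl⟩ := hf
    have h := coeff_X_mul_of_eq_zero (a := a) 1 (hn a ha)
    rwa [mul_one] at h
  | zero => exact map_zero _
  | add f g _ _ h1 h2 => rw [map_add, h1 hn, h2 hn, add_zero]
  | smul r f _ h =>
    rw [smul_eq_mul, coeff_mul]
    refine Finset.sum_eq_zero fun p hp => mul_eq_zero_of_right _ (h fun a ha => ?_)
    have h1 := congrArg (fun m => m a) (Finset.HasAntidiagonal.mem_antidiagonal.mp hp)
    have h2 := hn a ha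
    simp only [Finsupp.add_apply] at h1
    omega

/-- The matrix of the row operation which adds to each row all rows below it. -/
theorem det_upperOnes (R : Type*) [CommRing R] (k : ℕ) :
    (Matrix.of fun i j : Fin k => if i ≤ j then (1 : R) else 0).det = 1 := by
  rw [Matrix.det_of_isUpperTriangular]
  · simp
  · intro i j hij
    exact if_neg (not_le.mpr hij)

namespace Frame

variable {V : Type*} [AddCommGroup V] [Module ℂ V] {B : V →ₗ[ℂ] V →ₗ[ℂ] ℂ} {g : V ≃ₗ[ℂ] V}
  {ν φ ι : Type*} [Fintype ν] [Fintype φ] [Fintype ι] [DecidableEq ν] [DecidableEq φ]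
  (F : Frame B g ν φ) (y : Module.Basis ι ℂ V)

/-- The variables `u_{r+1}^c` become `ξ_{r+1}^c - ξ_{r+2}^c`, and the last one `ξ_k^c - ξ_0^c`, in
terms of the variables `ξ` of Hochschild chains, so that their sums telescope. -/
theorem linSubst_toChainMap_rowSum {k : ℕ} (i : Fin k) (c : ν ⊕ φ) :
    ∑ r : Fin k, (if i ≤ r then (1 : MvPowerSeries (Fin (k + 1) × ι) ℂ) else 0) *
      linSubst (bigBasis F.e F.e' k) (slotBasis y (Fin (k + 1))) (toChainMap g F.lam k)
        (X (Sum.inl (r.succ, c))) =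
      linearForm y i.succ (F.e c) - linearForm y 0 (F.e c) := by
  have h1 : ∀ r : Fin k, (if i ≤ r then (1 : MvPowerSeries (Fin (k + 1) × ι) ℂ) else 0) *
      linSubst (bigBasis F.e F.e' k) (slotBasis y (Fin (k + 1))) (toChainMap g F.lam k)
        (X (Sum.inl (r.succ, c))) = lin (slotBasis y (Fin (k + 1))) (toChainMap g F.lam k
          (if i ≤ r then (Pi.single r.succ (F.e c), 0) else 0)) := by
    intro r
    rw [linSubst_X, bigBasis_inl]
    split_ifs <;> simp
  rw [Finset.sum_congr rfl fun r _ => h1 r, ← map_sum, ← map_sum, ← lin_single, ← lin_single,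
    ← map_sub]
  congr 1
  have h2 : (∑ r : Fin k, if i ≤ r then ((Pi.single r.succ (F.e c), 0) : (Fin (k + 1) → V) × V)
      else 0) = (fun s => if i.succ ≤ s then F.e c else 0, 0) := by
    refine Prod.ext (funext fun s => ?_) ?_
    · rw [Prod.fst_sum, Finset.sum_apply]
      refine Fin.cases ?_ (fun s => ?_) s
      · refine (Finset.sum_eq_zero fun r _ => ?_).trans (if_neg (c := i.succ ≤ 0) (t := F.e c)
          (not_le.mpr (Fin.succ_pos i))).symm
        split_ifs
        · exact Pi.single_eq_of_ne (Fin.succ_ne_zero r).symm (F.e c)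
        · rfl
      · rw [Finset.sum_eq_single s]
        · simp only [Fin.succ_le_succ_iff]
          split_ifs <;> simp
        · intro r _ hr
          split_ifs
          · exact Pi.single_eq_of_ne (fun h => hr (Fin.succ_injective _ h).symm) _
          · rfl
        · simp
    · rw [Prod.snd_sum]
      refine Finset.sum_eq_zero fun r _ => ?_
      split_ifs <;> rfl
  rw [h2]
  funext s
  refine Fin.cases ?_ (fun s => ?_) s
  · rw [toChainMap_zero]
    simp [Fin.le_last]
  · rw [toChainMap_succ, Pi.sub_apply, Pi.single_eq_of_ne (Fin.succ_ne_zero s), sub_zero]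
    obtain rfl | h := eq_or_ne s i
    · simp
    · rw [Pi.single_eq_of_ne fun h' => h (Fin.succ_injective _ h')]
      have h3 : (s : ℕ) ≠ i := fun h' => h (Fin.ext h')
      simp only [Fin.le_def, Fin.val_succ, Fin.val_castSucc]
      split_ifs
      · simp
      · omega
      · omega
      · simp

/-- Up to degenerate chains, the determinant chain becomes the determinant of the linear forms
`e_{a_j}` in the slots `1, …, k`: terms of degree less than `k`, and terms of degree `k` which
contain a variable of the slot `0`, do not contain a variable of each of the slots `1, …, k`. -/
theorem toChain_detChain_sub_mem_vanish {k : ℕ} (a : Fin k → φ) :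
    toChain B g F.lam F.e F.e' y k (detChain ν a) -
      Laurent.const (Matrix.of fun i j : Fin k =>
        linearForm y i.succ (F.e (Sum.inr (a j)))).det ∈
      vanish {n : Fin (k + 1) × ι →₀ ℕ | ∀ j : Fin k, ∃ i, n (j.succ, i) ≠ 0} := by
  set M : Matrix (Fin k) (Fin k) (MvPowerSeries ((Fin (k + 1) × (ν ⊕ φ)) ⊕ (ν ⊕ φ)) ℂ) :=
    Matrix.of fun i j => X (Sum.inl (i.succ, Sum.inr (a j))) with hM
  set N : Matrix (Fin k) (Fin k) (MvPowerSeries (Fin (k + 1) × ι) ℂ) :=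
    Matrix.of fun i j => linearForm y i.succ (F.e (Sum.inr (a j))) with hN
  set ρ := linSubst (bigBasis F.e F.e' k) (slotBasis y (Fin (k + 1))) (toChainMap g F.lam k)
    with hρ
  have hM' : M.det ∈ lowDeg _ (k + 1) := by
    have h := det_lin_mem_lowDeg (bigBasis F.e F.e' k)
      fun i j : Fin k => bigBasis F.e F.e' k (Sum.inl (i.succ, Sum.inr (a j)))
    simpa only [lin_basis] using h
  have hN' : N.det ∈ lowDeg _ (k + 1) := by
    have h := det_lin_mem_lowDeg (slotBasis y (Fin (k + 1)))
      fun i j : Fin k => Pi.single i.succ (F.e (Sum.inr (a j)))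
    simpa only [lin_single] using h
  have h1 := gauss_const_sub_mem_vanish (bigBasis F.e F.e' k) (slotBasis y (Fin (k + 1)))
    (toChainMap g F.lam k) (toChainForm B g F.lam k) hM'
  have h2 : ρ M.det - N.det ∈ Ideal.span (X '' {s : Fin (k + 1) × ι | s.1 = 0}) := by
    have h3 : ρ M.det = (Matrix.of fun i j : Fin k =>
        linearForm y i.succ (F.e (Sum.inr (a j))) - linearForm y 0 (F.e (Sum.inr (a j)))).det := by
      rw [AlgHom.map_det, ← one_mul (Matrix.det _), ← det_upperOnes _ k, ← Matrix.det_mul]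
      congr 1
      ext1 i j
      exact F.linSubst_toChainMap_rowSum y i _
    rw [h3, ← Ideal.Quotient.eq, RingHom.map_det, RingHom.map_det]
    congr 1
    ext1 i j
    refine (Ideal.Quotient.eq).mpr ?_
    rw [hN, Matrix.of_apply, Matrix.of_apply, sub_sub_cancel_left]
    refine neg_mem ?_
    unfold linearForm
    refine sum_mem fun b _ => ?_
    rw [smul_eq_C_mul]
    exact Ideal.mul_mem_left _ _ (Ideal.subset_span ⟨(0, b), rfl, rfl⟩)
  refine mem_vanish.mpr fun r n hn => ?_
  have hdeg := le_degree_of_full hn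
  have h4 := mem_vanish.mp h1 r n (by
    change k ≤ n.degree
    omega)
  have h5 : coeff n (ρ M.det - N.det) = 0 := by
    by_cases h0 : ∑ i, n (0, i) = 0
    · refine coeff_eq_zero_of_mem_span_X h2 ?_
      rintro ⟨s, i⟩ hs
      obtain rfl : s = 0 := hs
      exact Finset.sum_eq_zero_iff.mp h0 i (Finset.mem_univ i)
    · exact coeff_eq_zero_of_mem_lowDeg (sub_mem (linSubst_mem_lowDeg _ _ _ hM') hN') (by omega)
  have h6 : coeff n ((Laurent.const (ρ M.det)).coeff r) =
      coeff n ((Laurent.const N.det).coeff r) := by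
    rw [Laurent.coeff_const, Laurent.coeff_const]
    split_ifs
    · rwa [map_sub, sub_eq_zero] at h5
    · rfl
  rw [Laurent.coeff_sub, map_sub] at h4 ⊢
  rw [← h6]
  exact h4

end Frame

/-! ### The Liouville chain as a determinant -/

section Component

variable {U : Type*} [AddCommGroup U] [Module ℂ U] {κ : Type*} (y : Module.Basis κ ℂ U) {k : ℕ}

/-- The alternating form which defines `component`. -/
def minorForm (a : Fin k → κ) : U [⋀^Fin k]→ₗ[ℂ] ℂ :=
  Matrix.detRowAlternating.compLinearMap (LinearMap.pi fun r => y.coord (a r))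

theorem minorForm_apply (a : Fin k → κ) (u : Fin k → U) :
    minorForm y a u = (Matrix.of fun s r => y.coord (a r) (u s)).det := rfl

theorem component_eq (a : Fin k → κ) :
    component y a = ExteriorAlgebra.liftAlternating
      (Pi.single (M := fun i => U [⋀^Fin i]→ₗ[ℂ] ℂ) k (minorForm y a)) := rfl

theorem component_comp_perm (a : Fin k → κ) (σ : Equiv.Perm (Fin k)) (w : ExteriorAlgebra ℂ U) :
    component y (a ∘ σ) w = ((Equiv.Perm.sign σ : ℤ) : ℂ) * component y a w := by
  have h : minorForm y (a ∘ σ) = ((Equiv.Perm.sign σ : ℤ) : ℂ) • minorForm y a := by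
    ext u
    rw [AlternatingMap.smul_apply, minorForm_apply, minorForm_apply, smul_eq_mul,
      ← Matrix.det_permute']
    rfl
  rw [component_eq, component_eq, h, Pi.single_smul, map_smul]
  rfl

theorem component_eq_zero (a : Fin k → κ) (ha : ¬Function.Injective a) (w : ExteriorAlgebra ℂ U) :
    component y a w = 0 := by
  have h : minorForm y a = 0 := by
    ext u
    simp only [Function.Injective, not_forall] at ha
    obtain ⟨i, j, hij, hne⟩ := ha
    rw [minorForm_apply]
    exact Matrix.det_zero_of_column_eq hne fun s => by
      rw [Matrix.of_apply, Matrix.of_apply, hij]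
  rw [component_eq, h, Pi.single_zero, map_zero]
  rfl

end Component

section Tensor

variable {V : Type*} [AddCommGroup V] [Module ℂ V] {ι : Type*} [Fintype ι]
  (y : Module.Basis ι ℂ V)

theorem tensor_const {σ : Type*} [Fintype σ] (p : σ → MvPowerSeries (Fin 1 × ι) ℂ) :
    tensor (fun s => Laurent.const (p s)) = Laurent.const
      (∏ s, rename (R := ℂ) (Prod.map (fun _ : Fin 1 => s) (id : ι → ι)) (p s)) := by
  have h : ∀ s, (renameSlots ι (fun _ : Fin 1 => s) (Laurent.const (p s)) :
      HahnSeries ℤ (MvPowerSeries (σ × ι) ℂ)) =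
      HahnSeries.C (rename (R := ℂ) (Prod.map (fun _ : Fin 1 => s) (id : ι → ι)) (p s)) :=
    fun s => Laurent.map_const _ _
  refine Eq.trans (Finset.prod_congr (M := HahnSeries ℤ (MvPowerSeries (σ × ι) ℂ)) rfl
    fun s _ => h s) ?_
  exact (map_prod (HahnSeries.C : MvPowerSeries (σ × ι) ℂ →+* HahnSeries ℤ _) _ _).symm

theorem rename_linearForm {σ : Type*} [Fintype σ] (s : σ) (v : V) :
    rename (R := ℂ) (Prod.map (fun _ : Fin 1 => s) (id : ι → ι)) (linearForm y 0 v) =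
      linearForm y s v := by
  unfold linearForm
  rw [map_sum]
  exact Finset.sum_congr rfl fun j _ => by rw [map_smul, rename_X]; rfl

theorem tensor_cons_one {k : ℕ} (v : Fin k → V) :
    tensor (Fin.cons (weylOne ι) fun r => ofVector y (v r)) =
      Laurent.const (∏ r : Fin k, linearForm y r.succ (v r)) := by
  have h : (Fin.cons (weylOne ι) fun r => ofVector y (v r) : Fin (k + 1) → Weyl ι) =
      fun s => Laurent.const ((Fin.cons 1 fun r => linearForm y 0 (v r) :
        Fin (k + 1) → MvPowerSeries (Fin 1 × ι) ℂ) s) := by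
    funext s
    refine Fin.cases rfl (fun r => rfl) s
  rw [h, tensor_const, Fin.prod_univ_succ]
  simp only [Fin.cons_zero, Fin.cons_succ, map_one, one_mul, rename_linearForm]

/-- As the components are antisymmetric, the Liouville chain is a multiple of a determinant. -/
theorem liouvilleChain_eq (B : V →ₗ[ℂ] V →ₗ[ℂ] ℂ) (g : V ≃ₗ[ℂ] V) {m : ℕ}
    (c : Module.Basis (Fin (2 * m)) ℂ (fixedSubspace g)) :
    liouvilleChain B g y c = (HahnSeries.C : ℂ →+* LaurentSeries ℂ)
      (component c id (dualForm (B.domRestrict₁₂ (fixedSubspace g) (fixedSubspace g)) c ^ m)) •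
      Laurent.const (Matrix.of fun i j : Fin (2 * m) => linearForm y i.succ (c j : V)).det := by
  set w := dualForm (B.domRestrict₁₂ (fixedSubspace g) (fixedSubspace g)) c ^ m with hw
  have h := Fintype.sum_of_injective (fun σ : Equiv.Perm (Fin (2 * m)) => ⇑σ) DFunLike.coe_injective
    (fun σ => (HahnSeries.C : ℂ →+* LaurentSeries ℂ) (component c σ w) •
      tensor (Fin.cons (weylOne ι) fun r => ofVector y (c (σ r) : V)))
    (fun a => (HahnSeries.C : ℂ →+* LaurentSeries ℂ) (component c a w) •
      tensor (Fin.cons (weylOne ι) fun r => ofVector y (c (a r) : V)))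
    (fun a ha => by
      rw [component_eq_zero c a (fun h => ha ⟨Equiv.ofBijective a
        (Finite.injective_iff_bijective.mp h), rfl⟩), map_zero, zero_smul])
    (fun σ => rfl)
  refine Eq.trans h.symm ?_
  refine Laurent.ext_coeff fun k => ?_
  have h1 : ∀ σ : Equiv.Perm (Fin (2 * m)),
      (HahnSeries.C : ℂ →+* LaurentSeries ℂ) (component c σ w) •
        tensor (Fin.cons (weylOne ι) fun r => ofVector y (c (σ r) : V)) =
      Laurent.const (component c id w • Equiv.Perm.sign σ •
        ∏ r, linearForm y r.succ (c (σ r) : V)) := by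
    intro σ
    rw [tensor_cons_one]
    refine Laurent.ext_coeff fun k => ?_
    rw [Laurent.coeff_C_smul, Laurent.coeff_const, Laurent.coeff_const]
    split_ifs
    · have h2 := component_comp_perm c id σ w
      rw [Function.id_comp] at h2
      rw [h2, mul_comm ((Equiv.Perm.sign σ : ℤ) : ℂ), mul_smul, Units.smul_def,
        Int.cast_smul_eq_zsmul]
    · rw [smul_zero]
  rw [Finset.sum_congr rfl fun σ _ => h1 σ, ← Laurent.const_sum, ← Finset.smul_sum,
    Laurent.coeff_C_smul, Laurent.coeff_const, Laurent.coeff_const, ← Matrix.det_transpose,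
    Matrix.det_apply]
  split_ifs
  · rfl
  · rw [smul_zero]

end Tensor

/-! ### The Liouville form is not zero -/

section Liouville

variable {U : Type*} [AddCommGroup U] [Module ℂ U] {κ : Type*} [Fintype κ]

/-- The contraction of the exterior algebra by a linear form. -/
def contr (d : U →ₗ[ℂ] ℂ) : ExteriorAlgebra ℂ U →ₗ[ℂ] ExteriorAlgebra ℂ U :=
  CliffordAlgebra.contractLeft d

theorem contr_ι_mul (d : U →ₗ[ℂ] ℂ) (u : U) (x : ExteriorAlgebra ℂ U) :
    contr d (ExteriorAlgebra.ι ℂ u * x) = d u • x - ExteriorAlgebra.ι ℂ u * contr d x :=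
  CliffordAlgebra.contractLeft_ι_mul ..

theorem contr_one (d : U →ₗ[ℂ] ℂ) : contr d (1 : ExteriorAlgebra ℂ U) = 0 :=
  CliffordAlgebra.contractLeft_one ..

theorem ι_mul_ι_swap (u v : U) : ExteriorAlgebra.ι ℂ u * ExteriorAlgebra.ι ℂ v =
    -(ExteriorAlgebra.ι ℂ v * ExteriorAlgebra.ι ℂ u) :=
  eq_neg_of_add_eq_zero_left (ExteriorAlgebra.ι_add_mul_swap u v)

/-- The bivector with coefficients `b` in the basis `c`. -/
def bivector (c : Module.Basis κ ℂ U) (b : Matrix κ κ ℂ) : ExteriorAlgebra ℂ U :=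
  (1 / 2 : ℂ) • ∑ i, ∑ j, b i j • (ExteriorAlgebra.ι ℂ (c i) * ExteriorAlgebra.ι ℂ (c j))

variable (c : Module.Basis κ ℂ U) {b : Matrix κ κ ℂ}

theorem commute_bivector_ι (b : Matrix κ κ ℂ) (u : U) :
    Commute (bivector c b) (ExteriorAlgebra.ι ℂ u) := by
  refine Commute.smul_left (Commute.sum_left _ _ _ fun i _ => Commute.sum_left _ _ _ fun j _ =>
    Commute.smul_left ?_ _) _
  change _ * _ = _ * _
  rw [mul_assoc, ι_mul_ι_swap (c j) u, mul_neg, ← mul_assoc, ι_mul_ι_swap (c i) u, neg_mul,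
    neg_neg, mul_assoc]

/-- The contraction by a dual basis vector is a derivation on the even element `bivector c b`. -/
theorem contr_bivector_mul [DecidableEq κ] (hb : ∀ i j, b j i = -b i j) (i : κ)
    (x : ExteriorAlgebra ℂ U) : contr (c.coord i) (bivector c b * x) =
      ExteriorAlgebra.ι ℂ (∑ j, b i j • c j) * x + bivector c b * contr (c.coord i) x := by
  have h : ∀ k j, contr (c.coord i)
      (b k j • (ExteriorAlgebra.ι ℂ (c k) * ExteriorAlgebra.ι ℂ (c j)) * x) =
      (if k = i then b k j • (ExteriorAlgebra.ι ℂ (c j) * x) else 0) -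
      (if j = i then b k j • (ExteriorAlgebra.ι ℂ (c k) * x) else 0) +
      b k j • (ExteriorAlgebra.ι ℂ (c k) * ExteriorAlgebra.ι ℂ (c j)) * contr (c.coord i) x := by
    intro k j
    have h1 : ∀ k, c.coord i (c k) = if k = i then 1 else 0 := fun k => by
      rw [c.coord_apply, c.repr_self, Finsupp.single_apply]
    rw [smul_mul_assoc, mul_assoc, map_smul, contr_ι_mul, contr_ι_mul, h1, h1, mul_sub,
      smul_mul_assoc, mul_assoc]
    split_ifs <;> simp [smul_sub] <;> abel
  unfold bivector
  simp only [smul_mul_assoc, map_smul, Finset.sum_mul, map_sum] at h ⊢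
  simp only [h, Finset.sum_add_distrib, Finset.sum_sub_distrib]
  rw [Finset.sum_comm (f := fun k j => if k = i then _ else _)]
  simp only [Finset.sum_ite_eq', Finset.mem_univ, if_true]
  have h3 : ∑ k, b k i • (ExteriorAlgebra.ι ℂ (c k) * x) =
      -∑ k, b i k • (ExteriorAlgebra.ι ℂ (c k) * x) := by
    rw [← Finset.sum_neg_distrib]
    exact Finset.sum_congr rfl fun k _ => by rw [hb i k, neg_smul]
  rw [h3, sub_neg_eq_add, ← two_smul ℂ, smul_add, smul_smul]
  norm_num [Finset.sum_mul]

theorem contr_bivector_pow [DecidableEq κ] (hb : ∀ i j, b j i = -b i j) (i : κ) (k : ℕ) :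
    contr (c.coord i) (bivector c b ^ k) =
      (k : ℂ) • (bivector c b ^ (k - 1) * ExteriorAlgebra.ι ℂ (∑ j, b i j • c j)) := by
  induction k with
  | zero => simp [contr_one]
  | succ k ih =>
    rw [pow_succ', contr_bivector_mul c hb, ih, ((commute_bivector_ι c b _).pow_left k).eq.symm,
      mul_smul_comm, ← mul_assoc, Nat.add_sub_cancel]
    rcases k with _ | k
    · simp
    · rw [Nat.add_sub_cancel, ← pow_succ']
      push_cast
      module

/-- The powers of a nondegenerate bivector, up to half of the dimension, are not zero. -/
theorem bivector_pow_ne_zero [DecidableEq κ] (hb : ∀ i j, b j i = -b i j) {a : Matrix κ κ ℂ}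
    (hab : a * b = 1) : ∀ {k : ℕ}, 2 * k ≤ Fintype.card κ → bivector c b ^ k ≠ 0
  | 0, _ => by
    rw [pow_zero]
    exact one_ne_zero
  | k + 1, hk => by
    intro h0
    refine bivector_pow_ne_zero hb hab (k := k) (by omega) ?_
    have h1 : ∀ i, bivector c b ^ k * ExteriorAlgebra.ι ℂ (∑ j, b i j • c j) = 0 := by
      intro i
      have h := contr_bivector_pow c hb i (k + 1)
      rw [h0, map_zero, Nat.add_sub_cancel] at h
      exact (smul_eq_zero.mp h.symm).resolve_left (Nat.cast_ne_zero.mpr k.succ_ne_zero)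
    have h2 : ∀ i, bivector c b ^ k * ExteriorAlgebra.ι ℂ (c i) = 0 := by
      intro i
      have h3 : c i = ∑ l, a i l • ∑ j, b l j • c j := by
        simp only [Finset.smul_sum, smul_smul]
        rw [Finset.sum_comm]
        simp only [← Finset.sum_smul, ← Matrix.mul_apply, hab]
        simp [Matrix.one_apply, Finset.sum_ite_eq]
      rw [h3, map_sum, Finset.mul_sum]
      exact Finset.sum_eq_zero fun l _ => by rw [map_smul, mul_smul_comm, h1, smul_zero]
    -- Contracting `y^i ω^k = 0` with the dual basis gives `dim U • ω^k = 2 k • ω^k`.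
    have h4 : ∀ i, bivector c b ^ k = (k : ℂ) • (bivector c b ^ (k - 1) *
        (ExteriorAlgebra.ι ℂ (c i) * ExteriorAlgebra.ι ℂ (∑ j, b i j • c j))) := by
      intro i
      have h5 := h2 i
      rw [((commute_bivector_ι c b _).pow_left k).eq] at h5
      have h6 := congrArg (contr (c.coord i)) h5
      rw [contr_ι_mul, contr_bivector_pow c hb, map_zero, mul_smul_comm, ← mul_assoc,
        ← ((commute_bivector_ι c b _).pow_left (k - 1)).eq, mul_assoc] at h6
      rw [c.coord_apply, c.repr_self, Finsupp.single_eq_same, one_smul] at h6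
      exact sub_eq_zero.mp h6
    have h7 : ∑ i, ExteriorAlgebra.ι ℂ (c i) * ExteriorAlgebra.ι ℂ (∑ j, b i j • c j) =
        (2 : ℂ) • bivector c b := by
      unfold bivector
      rw [smul_smul]
      norm_num [Finset.mul_sum, map_sum]
    have h8 : (Fintype.card κ : ℂ) • bivector c b ^ k = ((2 * k : ℕ) : ℂ) • bivector c b ^ k := by
      calc (Fintype.card κ : ℂ) • bivector c b ^ k = ∑ i : κ, bivector c b ^ k := by
            rw [Finset.sum_const, Finset.card_univ, Nat.cast_smul_eq_nsmul]
        _ = (k : ℂ) • (bivector c b ^ (k - 1) * ((2 : ℂ) • bivector c b)) := by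
            rw [Finset.sum_congr rfl fun i _ => h4 i, ← Finset.smul_sum, ← Finset.mul_sum, h7]
        _ = ((2 * k : ℕ) : ℂ) • bivector c b ^ k := by
            rcases k with _ | k
            · simp
            · rw [mul_smul_comm, Nat.add_sub_cancel, ← pow_succ, smul_smul]
              push_cast
              ring_nf
    rw [← sub_eq_zero, ← sub_smul, smul_eq_zero, sub_eq_zero, Nat.cast_inj] at h8
    exact h8.resolve_left (by omega)

theorem ιMulti_eq_det_smul {N : ℕ} (c : Module.Basis (Fin N) ℂ U) (v : Fin N → U) :
    ExteriorAlgebra.ιMulti ℂ N v = c.det v • ExteriorAlgebra.ιMulti ℂ N c := by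
  have h : ExteriorAlgebra.ιMulti ℂ N (M := U) = (LinearMap.toSpanSingleton ℂ _
      (ExteriorAlgebra.ιMulti ℂ N c)).compAlternatingMap c.det := by
    refine c.ext_alternating fun w hw => ?_
    set σ := Equiv.ofBijective w (Finite.injective_iff_bijective.mp hw) with hσ
    have h1 : (fun i => c (w i)) = (fun i => c (σ i)) := rfl
    rw [h1]
    have h2 := AlternatingMap.map_perm (ExteriorAlgebra.ιMulti ℂ N) (⇑c) σ
    have h3 := AlternatingMap.map_perm c.det (⇑c) σ
    refine h2.trans ?_
    rw [LinearMap.compAlternatingMap_apply, LinearMap.toSpanSingleton_apply]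
    change _ = c.det (⇑c ∘ σ) • _
    rw [h3, c.det_self, smul_assoc, one_smul]
  exact congrArg (fun f => f v) h

/-- The component of the Liouville form with all indices in increasing order. -/
theorem component_dualForm_pow_ne_zero {m : ℕ} (c : Module.Basis (Fin (2 * m)) ℂ U)
    (B : U →ₗ[ℂ] U →ₗ[ℂ] ℂ) (hB : B.IsAlt)
    (hdet : IsUnit (Matrix.of fun a b => B (c a) (c b)).det) :
    component c id (dualForm B c ^ m) ≠ 0 := by
  set A := Matrix.of fun a b => B (c a) (c b) with hA
  have hAt : A.transpose = -A := by
    ext i j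
    exact (hB.neg _ _).symm
  have hb : ∀ i j, A⁻¹ j i = -A⁻¹ i j := by
    have h : A⁻¹.transpose = -A⁻¹ := by
      rw [Matrix.transpose_nonsing_inv, hAt]
      refine Matrix.inv_eq_right_inv ?_
      rw [neg_mul_neg, Matrix.mul_nonsing_inv _ hdet]
    intro i j
    exact congrFun (congrFun h i) j
  have h0 : dualForm B c ^ m ≠ 0 :=
    bivector_pow_ne_zero c hb (Matrix.mul_nonsing_inv _ hdet) (by simp)
  have h1 : dualForm B c ∈ ⋀[ℂ]^2 U := by
    refine Submodule.smul_mem _ _ (Submodule.sum_mem _ fun i _ => Submodule.sum_mem _ fun j _ =>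
      Submodule.smul_mem _ _ ?_)
    rw [ExteriorAlgebra.exteriorPower, pow_two]
    exact Submodule.mul_mem_mul ⟨_, rfl⟩ ⟨_, rfl⟩
  have h2 : dualForm B c ^ m ∈ ⋀[ℂ]^(2 * m) U := by
    rw [ExteriorAlgebra.exteriorPower, pow_mul]
    exact Submodule.pow_mem_pow _ h1 m
  have h3 : ⋀[ℂ]^(2 * m) U ≤ Submodule.span ℂ {ExteriorAlgebra.ιMulti ℂ (2 * m) c} := by
    rw [← ExteriorAlgebra.ιMulti_span_fixedDegree, Submodule.span_le]
    rintro _ ⟨v, rfl⟩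
    rw [ιMulti_eq_det_smul c v]
    exact Submodule.smul_mem _ _ (Submodule.mem_span_singleton_self _)
  obtain ⟨t, ht⟩ := Submodule.mem_span_singleton.mp (h3 h2)
  rw [← ht] at h0 ⊢
  rw [map_smul, component_eq, ExteriorAlgebra.liftAlternating_apply_ιMulti, Pi.single_eq_same,
    minorForm_apply]
  have h4 : (Matrix.of fun s r => c.coord (id r) (c s)) = 1 := by
    ext i j
    simp [Matrix.one_apply, Finsupp.single_apply]
  rw [h4, Matrix.det_one, smul_eq_mul, mul_one]
  rintro rfl
  exact h0 (zero_smul _ _)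

end Liouville

/-! ### Automorphisms of finite order -/

theorem isUnit_det_of_nondegenerate {U κ : Type*} [AddCommGroup U] [Module ℂ U] [Fintype κ]
    [DecidableEq κ] (c : Module.Basis κ ℂ U) {B : U →ₗ[ℂ] U →ₗ[ℂ] ℂ} (hB : B.Nondegenerate) :
    IsUnit (Matrix.of fun a b => B (c a) (c b)).det := by
  have h : (Matrix.of fun a b => B (c a) (c b)) = LinearMap.toMatrix₂ c c B := by
    ext i j
    rw [LinearMap.toMatrix₂_apply, Matrix.of_apply]
  rw [h]
  exact isUnit_iff_ne_zero.mpr ((LinearMap.nondegenerate_iff_det_ne_zero c).mp hB)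

/-- A symplectic vector space has even dimension: the Gram matrix `A` of a basis satisfies
`det A = det Aᵀ = (-1) ^ dim U * det A`. -/
theorem even_finrank_of_isAlt {U : Type*} [AddCommGroup U] [Module ℂ U] [FiniteDimensional ℂ U]
    {B : U →ₗ[ℂ] U →ₗ[ℂ] ℂ} (hB : B.IsAlt) (hB' : B.Nondegenerate) :
    Even (Module.finrank ℂ U) := by
  have hdet := (isUnit_det_of_nondegenerate (Module.finBasis ℂ U) hB').ne_zero
  set A := Matrix.of fun a b => B (Module.finBasis ℂ U a) (Module.finBasis ℂ U b)
  have hAt : A.transpose = -A := by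
    ext i j
    exact (hB.neg _ _).symm
  have h := Matrix.det_transpose A
  rw [hAt, Matrix.det_neg, Fintype.card_fin] at h
  by_contra hodd
  rw [(Nat.not_even_iff_odd.mp hodd).neg_one_pow, neg_one_mul] at h
  exact hdet (self_eq_neg.mp h.symm)

section Average

variable {V : Type*} [AddCommGroup V] [Module ℂ V] {g : V ≃ₗ[ℂ] V}

theorem mem_fixedSubspace {v : V} : v ∈ fixedSubspace g ↔ g v = v := by
  change g v - v = 0 ↔ _
  exact sub_eq_zero

/-- The average of the powers of an automorphism of finite order, which is the projection to the
fixed subspace along the image of `g - 1`. -/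
def average (g : V ≃ₗ[ℂ] V) : V →ₗ[ℂ] V :=
  (orderOf g : ℂ)⁻¹ • ∑ k ∈ Finset.range (orderOf g), (g ^ k).toLinearMap

theorem average_apply (v : V) : average g v =
    (orderOf g : ℂ)⁻¹ • ∑ k ∈ Finset.range (orderOf g), (g ^ k) v := by
  unfold average
  rw [LinearMap.smul_apply, LinearMap.sum_apply]
  rfl

theorem sum_pow_succ (v : V) : ∑ k ∈ Finset.range (orderOf g), (g ^ (k + 1)) v =
    ∑ k ∈ Finset.range (orderOf g), (g ^ k) v := by
  have h := (Finset.sum_range_succ' (fun k => (g ^ k) v) (orderOf g)).symm.trans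
    (Finset.sum_range_succ (fun k => (g ^ k) v) (orderOf g))
  rw [pow_orderOf_eq_one, pow_zero] at h
  exact add_right_cancel h

theorem map_average (v : V) : g (average g v) = average g v := by
  rw [average_apply, map_smul, map_sum, ← sum_pow_succ]
  congr 1
  exact Finset.sum_congr rfl fun k _ => by rw [pow_succ' g k]; rfl

theorem average_map (v : V) : average g (g v) = average g v := by
  rw [average_apply, average_apply, ← sum_pow_succ (g := g) v]
  rfl

theorem pow_apply_of_fixed {v : V} (hv : g v = v) (k : ℕ) : (g ^ k) v = v := by
  induction k with
  | zero => rfl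
  | succ k ih =>
    rw [pow_succ]
    exact (congrArg (g ^ k) hv).trans ih

theorem average_eq (hg : IsOfFinOrder g) {v : V} (hv : g v = v) : average g v = v := by
  rw [average_apply, Finset.sum_congr rfl fun k _ => pow_apply_of_fixed hv k, Finset.sum_const,
    Finset.card_range, ← Nat.cast_smul_eq_nsmul ℂ, smul_smul,
    inv_mul_cancel₀ (Nat.cast_ne_zero.mpr hg.orderOf_pos.ne'), one_smul]

theorem apply_average {B : V →ₗ[ℂ] V →ₗ[ℂ] ℂ} (hg : IsOfFinOrder g)
    (hgB : ∀ u v, B (g u) (g v) = B u v) {u : V} (hu : g u = u) (v : V) :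
    B u (average g v) = B u v := by
  have h : ∀ k : ℕ, B u ((g ^ k) v) = B u v := by
    intro k
    induction k with
    | zero => rfl
    | succ k ih =>
      rw [pow_succ', ← ih]
      exact (congrArg (fun w => B w (g ((g ^ k) v))) hu.symm).trans (hgB _ _)
  rw [average_apply, map_smul, map_sum, Finset.sum_congr rfl fun k _ => h k, Finset.sum_const,
    Finset.card_range, ← Nat.cast_smul_eq_nsmul ℂ, smul_smul,
    inv_mul_cancel₀ (Nat.cast_ne_zero.mpr hg.orderOf_pos.ne'), one_smul]

theorem isCompl_ker_average (hg : IsOfFinOrder g) :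
    IsCompl (LinearMap.ker (average g)) (fixedSubspace g) := by
  have h := LinearMap.isCompl_of_proj (p := fixedSubspace g)
    (f := (average g).codRestrict _ fun v => mem_fixedSubspace.mpr (map_average v))
    fun x => Subtype.ext (average_eq hg (mem_fixedSubspace.mp x.2))
  rw [LinearMap.ker_codRestrict] at h
  exact h.symm

/-- The fixed subspace is symplectic, as it is orthogonal to the kernel of the average. -/
theorem nondegenerate_fixedSubspace {B : V →ₗ[ℂ] V →ₗ[ℂ] ℂ} (hB : B.IsAlt)
    (hB' : B.Nondegenerate) (hg : IsOfFinOrder g) (hgB : ∀ u v, B (g u) (g v) = B u v) :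
    (B.domRestrict₁₂ (fixedSubspace g) (fixedSubspace g)).Nondegenerate := by
  have h : ∀ u ∈ fixedSubspace g, (∀ v ∈ fixedSubspace g, B u v = 0) → u = 0 := by
    intro u hu h
    refine hB'.1 u fun v => ?_
    rw [← apply_average hg hgB (mem_fixedSubspace.mp hu)]
    exact h _ (mem_fixedSubspace.mpr (map_average v))
  refine ⟨fun u hu => Subtype.ext (h u u.2 fun v hv => hu ⟨v, hv⟩),
    fun u hu => Subtype.ext (h u u.2 fun v hv => ?_)⟩
  rw [← hB.neg v u, neg_eq_zero]
  exact hu ⟨v, hv⟩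

end Average

/-- Every basis of the fixed subspace extends to a frame. -/
theorem exists_frame {V : Type*} [AddCommGroup V] [Module ℂ V] [FiniteDimensional ℂ V]
    {g : V ≃ₗ[ℂ] V} {B : V →ₗ[ℂ] V →ₗ[ℂ] ℂ} (hB : B.IsAlt) (hB' : B.Nondegenerate)
    (hg : IsOfFinOrder g) (hgB : ∀ u v, B (g u) (g v) = B u v) {φ : Type*} [Fintype φ]
    (c : Module.Basis φ ℂ (fixedSubspace g)) :
    ∃ (k : ℕ) (F : Frame B g (Fin k) φ), ∀ i, F.e (Sum.inr i) = c i := by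
  classical
  set E := Submodule.prodEquivOfIsCompl _ _ (isCompl_ker_average hg) with hE
  set b := Module.finBasis ℂ (LinearMap.ker (average g))
  set B' := B.domRestrict₁₂ (fixedSubspace g) (fixedSubspace g) with hB'_def
  have hflip : B'.flip.Nondegenerate := by
    have h := nondegenerate_fixedSubspace hB hB' hg hgB
    exact ⟨h.2, h.1⟩
  set c' := LinearMap.BilinForm.dualBasis B'.flip hflip c with hc'
  have hinl : ∀ d : Module.Basis φ ℂ (fixedSubspace g), ∀ i,
      ((b.prod d).map E) (Sum.inl i) = b i := by
    intro d i
    rw [Module.Basis.map_apply, Submodule.coe_prodEquivOfIsCompl',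
      Module.Basis.prod_apply_inl_fst, Module.Basis.prod_apply_inl_snd, ZeroMemClass.coe_zero,
      add_zero]
  have hinr : ∀ d : Module.Basis φ ℂ (fixedSubspace g), ∀ i,
      ((b.prod d).map E) (Sum.inr i) = d i := by
    intro d i
    rw [Module.Basis.map_apply, Submodule.coe_prodEquivOfIsCompl',
      Module.Basis.prod_apply_inr_fst, Module.Basis.prod_apply_inr_snd, ZeroMemClass.coe_zero,
      zero_add]
  refine ⟨_, ⟨average g, (b.prod c).map E, (b.prod c').map E, map_average, average_map,
    fun v hv => average_eq hg hv, fun i => ?_, fun i => ?_, fun i => ?_, fun i v => ?_⟩,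
    fun i => hinr c i⟩
  · rw [hinl]
    exact (b i).2
  · rw [hinr]
    exact mem_fixedSubspace.mp (c i).2
  · rw [hinl, hinl]
  · rw [hinr, Module.Basis.coord_apply, Module.Basis.map_repr, LinearEquiv.trans_apply,
      Module.Basis.prod_repr_inr, hc', LinearMap.BilinForm.dualBasis_repr_apply]
    have hc := mem_fixedSubspace.mp (c i).2
    obtain ⟨w, rfl⟩ := E.surjective v
    rw [LinearEquiv.symm_apply_apply]
    change B (c i) w.2 = B (c i) (E w)
    rw [hE, Submodule.coe_prodEquivOfIsCompl', map_add, ← apply_average hg hgB hc w.1,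
      (show average g w.1 = 0 from w.1.2), map_zero, zero_add]

/-! ### The fundamental class in the normalized complex -/

theorem mem_of_C_smul_mem {M : Type*} [AddCommGroup M] [Module (LaurentSeries ℂ) M]
    {P : Submodule (LaurentSeries ℂ) M} {r : ℂ} (hr : r ≠ 0) {x : M}
    (h : (HahnSeries.C : ℂ →+* LaurentSeries ℂ) r • x ∈ P) : x ∈ P := by
  have h1 := P.smul_mem ((HahnSeries.C : ℂ →+* LaurentSeries ℂ) r⁻¹) h
  rwa [smul_smul, ← map_mul, inv_mul_cancel₀ hr, map_one, one_smul] at h1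

namespace Frame

variable {V : Type*} [AddCommGroup V] [Module ℂ V] {B : V →ₗ[ℂ] V →ₗ[ℂ] ℂ} {g : V ≃ₗ[ℂ] V}
  {ν φ ι : Type*} [Fintype ν] [Fintype φ] [Fintype ι] [DecidableEq ν] [DecidableEq φ]
  (F : Frame B g ν φ) (y : Module.Basis ι ℂ V)
  (hB : B.IsAlt) (hgB : ∀ u v, B (g u) (g v) = B u v)

/-- A homogeneous chain is a sum of images of the `Z_a` and of a lift of a degenerate chain if its
image is degenerate. -/
theorem mem_rel_full_of_toChain_mem (q : ℕ) (f : Big (ν ⊕ φ) q)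
    (h : toChain B g F.lam F.e F.e' y q f ∈ degenerate ι q) :
    f ∈ F.rel y (full ν φ ι) Finset.univ q := by
  rw [degenerate_eq_vanish] at h
  refine mem_vanish.mpr fun k n hn => ?_
  rw [eq_embDomain_inr fun a => hn.2 a (Finset.mem_univ a), ← F.coeff_toChain]
  exact mem_vanish.mp h k _ hn.1

include hB hgB in
/-- The differential of `detChain` is a combination of images of the `Z_a`, which map to zero. -/
theorem toChain_detChain_mem_cycles : ∀ {k : ℕ} (a : Fin k → φ),
    toChain B g F.lam F.e F.e' y k (detChain ν a) ∈ cycles B g y k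
  | 0, _ => trivial
  | k + 1, a => by
    refine (F.differential_toChain y hB hgB k _).trans ((F.toChain_eq_zero_iff y k _).mpr ?_)
    rw [F.diff_detChain a]
    exact Submodule.sum_mem _ fun j _ => Submodule.smul_mem _ _
      (F.Z_mem_rel_of_mem y hB hgB (Finset.mem_univ _) k _)

theorem mkQ_det_eq {k : ℕ} (a : Fin k → φ) :
    (degenerate ι k).mkQ (Laurent.const (Matrix.of fun i j : Fin k =>
        linearForm y i.succ (F.e (Sum.inr (a j)))).det) =
      (degenerate ι k).mkQ (toChain B g F.lam F.e F.e' y k (detChain ν a)) := by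
  refine ((Submodule.Quotient.eq _).mpr ?_).symm
  rw [degenerate_eq_vanish]
  exact F.toChain_detChain_sub_mem_vanish y a

theorem mkQ_mem_normalizedCycles : ∀ {k : ℕ} {x : Chain ι k}, x ∈ cycles B g y k →
    (degenerate ι k).mkQ x ∈ normalizedCycles B g y k
  | 0, _, _ => trivial
  | k + 1, x, hx => ⟨x, by
      change differential B g y k x ∈ degenerate ι k
      rw [show differential B g y k x = 0 from hx]
      exact zero_mem _, rfl⟩

include hB hgB in
theorem mkQ_det_mem_normalizedCycles {k : ℕ} (a : Fin k → φ) :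
    (degenerate ι k).mkQ (Laurent.const (Matrix.of fun i j : Fin k =>
        linearForm y i.succ (F.e (Sum.inr (a j)))).det) ∈ normalizedCycles B g y k := by
  rw [F.mkQ_det_eq y]
  exact mkQ_mem_normalizedCycles y (F.toChain_detChain_mem_cycles y hB hgB a)

include hB hgB in
theorem mkQ_det_notMem_normalizedBoundaries {k : ℕ} (a : Fin k → φ)
    (ha : Function.Bijective a) :
    (degenerate ι k).mkQ (Laurent.const (Matrix.of fun i j : Fin k =>
        linearForm y i.succ (F.e (Sum.inr (a j)))).det) ∉ normalizedBoundaries B g y k := by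
  rw [F.mkQ_det_eq y]
  rintro ⟨_, ⟨c, rfl⟩, hc⟩
  obtain ⟨f, rfl⟩ := F.toChain_surjective y (k + 1) c
  have h := (Submodule.Quotient.eq _).mp hc.symm
  rw [F.differential_toChain y hB hgB, ← map_sub] at h
  have hS : Finset.univ.map Function.Embedding.inl ∪
      (Finset.univ.image a).map Function.Embedding.inr = (Finset.univ : Finset (ν ⊕ φ)) := by
    rw [Finset.image_univ_of_surjective ha.2]
    ext s
    rcases s with s | s <;> simp
  refine F.detChain_sub_diff_notMem y hB hgB a ha.1 f ?_
  rw [hS]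
  exact F.mem_rel_full_of_toChain_mem y k _ h

end Frame

end FormalWeyl

end

theorem mainTheorem7 {V : Type*} [AddCommGroup V] [Module ℂ V] {ι : Type*} [Fintype ι]
    (y : Module.Basis ι ℂ V) (B : V →ₗ[ℂ] V →ₗ[ℂ] ℂ) (hB : B.IsAlt) (hB' : B.Nondegenerate)
    (g : V ≃ₗ[ℂ] V) (hg : IsOfFinOrder g) (hgB : ∀ u v, B (g u) (g v) = B u v) :
    ∃ m : ℕ, Module.finrank ℂ (FormalWeyl.fixedSubspace g) = 2 * m ∧
      Nonempty (FormalWeyl.HH B g y (2 * m) ≃ₗ[LaurentSeries ℂ] LaurentSeries ℂ) ∧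
      (∀ q : ℕ, q ≠ 2 * m → Subsingleton (FormalWeyl.HH B g y q)) ∧
      ∀ c : Module.Basis (Fin (2 * m)) ℂ (FormalWeyl.fixedSubspace g),
        (FormalWeyl.degenerate ι (2 * m)).mkQ (FormalWeyl.liouvilleChain B g y c) ∈
            FormalWeyl.normalizedCycles B g y (2 * m) ∧
          (FormalWeyl.degenerate ι (2 * m)).mkQ (FormalWeyl.liouvilleChain B g y c) ∉
            FormalWeyl.normalizedBoundaries B g y (2 * m) := by
  have : FiniteDimensional ℂ V := y.finiteDimensional_of_finite
  have hBg := FormalWeyl.nondegenerate_fixedSubspace hB hB' hg hgB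
  have hAlt : (B.domRestrict₁₂ (FormalWeyl.fixedSubspace g)
      (FormalWeyl.fixedSubspace g)).IsAlt := fun u => hB u
  obtain ⟨m, hm⟩ := (FormalWeyl.even_finrank_of_isAlt hAlt hBg).two_dvd
  obtain ⟨k, F, -⟩ := FormalWeyl.exists_frame hB hB' hg hgB
    (Module.finBasisOfFinrankEq ℂ (FormalWeyl.fixedSubspace g) hm)
  have h1 := F.nonempty_HH_equiv y hB hgB
  have h2 := F.subsingleton_HH y hB hgB
  rw [Fintype.card_fin] at h1 h2
  refine ⟨m, hm, h1, h2, fun c => ?_⟩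
  obtain ⟨k, F, hF⟩ := FormalWeyl.exists_frame hB hB' hg hgB c
  have hr := FormalWeyl.component_dualForm_pow_ne_zero c _ hAlt
    (FormalWeyl.isUnit_det_of_nondegenerate c hBg)
  have h3 := F.mkQ_det_mem_normalizedCycles y hB hgB id
  have h4 := F.mkQ_det_notMem_normalizedBoundaries y hB hgB id Function.bijective_id
  simp only [hF, id_eq] at h3 h4
  rw [FormalWeyl.liouvilleChain_eq, map_smul]
  refine ⟨Submodule.smul_mem _ _ h3, fun h => h4 ?_⟩
  exact FormalWeyl.mem_of_C_smul_mem hr h
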